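/- **Setting.** Let $(\Omega,\mathcal F,P)$ be a probability space, $\mathcal G\subset\mathcal F$ a sub-$\sigma$-algebra, $\mathbb T\subset\mathbb R$ with $\sup\mathbb T=\infty$ (limits $T\to\infty$ are along $\mathbb T$), $\Theta\subset\mathbb R^{p}$ ($p\ge1$) and $\mathcal T\subset\mathbb R^{q}$ compact, and $\theta^*\in\Theta$. Let $\mathcal N\subset\mathbb R^p$ be a bounded open set such that $\Theta\cap\{|\theta-\theta^*|<\delta\}\subset\overline{\mathcal N}$ for some $\delta>0$, and $t\theta+(1-t)\theta^*\in\mathcal N$ for all $\theta\in\mathcal N$, $0<t\le1$. For $T\in\mathbb T$ let $\mathcal H_T(\theta,\tau)$ be a random field that is continuous on $\Theta\times\mathcal T$ and extends continuously to $\overline{\mathcal N}\times\mathcal T$, such that $\mathcal H_T(\omega,\cdot,\tau)$ is, for all $\omega,\tau$, of class $C^2$ in $\mathcal N$ with derivatives extending continuously to $\overline{\mathcal N}$. Let $\mathcal J\subset\{1,\dots,p\}$; for $j\in\mathcal J$ let $\xi_{j,T}\ge0$ be random variables and $p_j:\mathbb R\to[0,\infty)$ continuous functions, $C^1$ on $\mathbb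 R\setminus\{0\}$, with $p_j(x)=0$ iff $x=0$, and $p_j(x)=|x|^{q_j}$ on a neighbourhood of $0$ for some $q_j>0$; let $s_T\ge 0$ be continuous random fields on $\mathbb R^q$. Put $$\mathbb H_T(\theta,\tau)=\mathcal H_T(\theta,\tau)-\sum_{j\in\mathcal J}\xi_{j,T}\,p_j(\theta_j)-s_T(\tau).$$ Let $\hat\tau_T$ be arbitrary $\mathcal T$-valued random variables, and $\hat\theta_T$ $\Theta$-valued random variables that asymptotically maximize $\mathbb H_T(\cdot,\hat\tau_T)$: for every $\varepsilon>0$, $P[\mathbb H_T(\hat\theta_T,\hat\tau_T)+\varepsilon<\sup_{\theta\in\Theta}\mathbb H_T(\theta,\hat\tau_T)]\to0$ (in particular, $\hat\theta_T$ may be a maximizer with probability tending to one). Let $\mathcal J_1=\{j\in\mathcal J:\theta_j^*\ne0\}$ and $\mathcal J_0=\{j\in\mathcal J:\theta_j^*=0\}$. Let $\mathfrak a_{j,T}>0$ ($1\le j\le p$) be deterministic with $\mathfrak a_{j,T}\to0$, $\mathfrak a_T=\mathrm{diag}(\mathfrak a_{1,T},\dots,\mathfrak a_{p,T})$, $\mathfrak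 b_T=\lambda_{\min}[(\mathfrak a_T'\mathfrak a_T)^{-1}]=\min_{1\le j\le p}\mathfrak a_{j,T}^{-2}$, and let $\rho_k\ge1$ ($k\in\mathcal J_0$) be constants. Let $a_T$ be diagonal with $(a_T)_{jj}=\mathfrak a_{j,T}$ for $j\notin\mathcal J_0$ and $(a_T)_{jj}=\mathfrak a_{j,T}^{\rho_j}$ for $j\in\mathcal J_0$, and $b=\lim_T\mathfrak a_T^{-1}a_T$, that is, $b$ is diagonal with $b_{jj}=1$ for $j\notin\mathcal J_0$ and $b_{jj}=1_{\{\rho_j=1\}}$ for $j\in\mathcal J_0$. Let $\mathcal Y$ be a continuous random field on $\Theta$, $\Delta(\theta^*)$ an $\mathbb R^p$-valued random variable, $\Gamma(\theta^*)$ a $\mathcal G$-measurable random $p\times p$ matrix, and $c_i\ge0$ ($i\in\mathcal J_1$), $d_k\ge0$ ($k\in\mathcal J_0$) random variables, all on $\Omega$. Write $\Delta_T(\theta^*,\tau)=\mathfrak a_T\partial_\theta\mathcal H_T(\theta^*,\tau)$ and $\mathcal Y_T(\theta,\tau)=\mathfrak b_T^{-1}(\mathcal H_T(\theta,\tau)-\mathcal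 H_T(\theta^*,\tau))$. For random variables with values in a topological space, $Y_T\to^{d_s(\mathcal G)}Y$ (stable convergence) means $E[f(Y_T)Z]\to E[f(Y)Z]$ for all bounded continuous $f$ and all bounded $\mathcal G$-measurable $Z$. Let $$U_T=\{u\in\mathbb R^p:\theta^*+a_Tu\in\Theta\},\qquad U=\bigcap_{\delta>0}\bigcup_{N\ge1}\bigcap_{T\ge N}U_T^{\delta},$$ where $A^\delta$ is the open $\delta$-neighbourhood of $A$, and $\hat u_T=a_T^{-1}(\hat\theta_T-\theta^*)$. Define for $u\in\mathbb R^p$ $$\mathbb Z(u)=\exp\Big\{\Delta(\theta^*)[bu]-\tfrac12\Gamma(\theta^*)[(bu)^{\otimes2}]-\sum_{i\in\mathcal J_1}c_i\,p_i'(\theta_i^*)\,u_i-\sum_{k\in\mathcal J_0}d_k|u_k|^{q_k}\Big\},$$ $$\mathbb V_T(u)=\exp\Big\{\Delta_T(\theta^*,\hat\tau_T)[bu]-\tfrac12\Gamma(\theta^*)[(bu)^{\otimes2}]-\sum_{i\in\mathcal J_1}\mathfrak a_{i,T}\,\xi_{i,T}\,p_i'(\theta_i^*)\,u_i-\sum_{k\in\mathcal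 J_0}\mathfrak a_{k,T}^{q_k\rho_k}\,\xi_{k,T}\,|u_k|^{q_k}\Big\}.$$ **Conditions.** - [C1] $\sup_{\Theta\times\mathcal T}|\mathcal Y_T(\theta,\tau)-\mathcal Y(\theta)|\to^P0$, and with probability one $\mathcal Y(\theta)<0$ for all $\theta\in\Theta$, $\theta\ne\theta^*$. - [C2] For some $\tau_0\in\mathcal T$, $\sup_{\tau\in\mathcal T}|\Delta_T(\theta^*,\tau)-\Delta_T(\theta^*,\tau_0)|\to^P0$ and $$\big(\Delta_T(\theta^*,\tau_0),(\mathfrak a_{i,T}\xi_{i,T})_{i\in\mathcal J_1},(\mathfrak a_{k,T}^{q_k\rho_k}\xi_{k,T})_{k\in\mathcal J_0}\big)\to^{d_s(\mathcal G)}\big(\Delta(\theta^*),(c_i)_{i\in\mathcal J_1},(d_k)_{k\in\mathcal J_0}\big);$$ and for every positive $\delta_T\to0$, $\sup\{\|\mathfrak a_T\partial_\theta^2\mathcal H_T(\theta,\tau)\mathfrak a_T+\Gamma(\theta^*)\|:\theta\in\overline{\mathcal N},\ \tau\in\mathcal T,\ |\theta-\theta^*|<\delta_T\}\to^P0$. -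 [C3] $\Gamma(\theta^*)$ is almost surely positive definite. - [C4] $\xi_{i,T}\,\mathfrak b_T^{-1}\to^P0$ for each $i\in\mathcal J_1$. - [C5] If $k\in\mathcal J_0$ and $\rho_k>1$, then $d_k>0$ a.s. - [A3] $U\supset\bigcap_{N\ge1}\overline{\bigcup_{T\ge N}U_T}$. - [A4] There is a $U$-valued random variable $\hat u$ such that almost surely $\mathbb Z(\hat u)=\sup_U\mathbb Z$, and almost surely $\mathbb Z(u)<\mathbb Z(\hat u)$ for all $u\in U$, $u\ne\hat u$. - [A5] There are $T_0\in\mathbb T$ and a tight family of $U$-valued random variables $\hat v_T$ ($T\in\mathbb T$, $T\ge T_0$) such that for each $T$, almost surely $\mathbb V_T(\hat v_T)=\sup_U\mathbb V_T$. **Theorem.** Assume [C1]–[C5], [A3] and [A4]. Then, for the $\hat u$ of [A4], $$\hat u_T=a_T^{-1}(\hat\theta_T-\theta^*)\to^{d_s(\mathcal G)}\hat u .$$ If moreover [A5] holds, then, for the $\hat v_T$ of [A5], $\hat u_T-\hat v_T=o_P(1)$. -/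

import Mathlib

open MeasureTheory Filter Topology Set
open scoped ENNReal BoundedContinuousFunction Matrix

noncomputable section

/-- `ℝⁿ` with its Euclidean norm. -/
abbrev Vec (n : ℕ) : Type := EuclideanSpace ℝ (Fin n)

/-- The product of the diagonal matrix with entries `d` and the vector `u`. -/
def diagMul {n : ℕ} (d : Fin n → ℝ) (u : Vec n) : Vec n :=
  WithLp.toLp 2 fun j => d j * u j

/-- `‖A‖ = (Tr (A Aᵀ)) ^ (1/2)`. -/
def matNorm {n : ℕ} (A : Matrix (Fin n) (Fin n) ℝ) : ℝ :=
  Real.sqrt (A * Aᵀ).trace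

/-- `A[u^{⊗2}] = ∑ i j, A i j * u i * u j`. -/
def quadForm {n : ℕ} (A : Matrix (Fin n) (Fin n) ℝ) (u : Vec n) : ℝ :=
  ∑ i, ∑ j, A i j * u i * u j

/-- The matrix of second order partial derivatives of `f` at `x`. -/
def hessian {n : ℕ} (f : Vec n → ℝ) (x : Vec n) : Matrix (Fin n) (Fin n) ℝ :=
  Matrix.of fun i j =>
    iteratedFDeriv ℝ 2 f x ![EuclideanSpace.single i 1, EuclideanSpace.single j 1]

/-- `f` is of class `C²(closure N)` for an open set `N`: it is continuous on `closure N`, of class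
`C²` in `N`, and its derivatives of order one and two extend continuously to `closure N`. -/
def IsC2OnClosure {n : ℕ} (N : Set (Vec n)) (f : Vec n → ℝ) : Prop :=
  ContinuousOn f (closure N) ∧ ContDiffOn ℝ 2 f N ∧
  (∃ g : Vec n → Vec n, ContinuousOn g (closure N) ∧ EqOn g (gradient f) N) ∧
  (∃ h : Vec n → Matrix (Fin n) (Fin n) ℝ,
    ContinuousOn h (closure N) ∧ EqOn h (hessian f) N)

/-- The gradient `∂f` on `closure N`: the extension by continuity of the gradient of `f` in the
open set `N`. -/
def gradOn {n : ℕ} (N : Set (Vec n)) (f : Vec n → ℝ) : Vec n → Vec n :=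
  extendFrom N (gradient f)

/-- The Hessian `∂²f` on `closure N`: the extension by continuity of the Hessian of `f` in the
open set `N`. -/
def hessOn {n : ℕ} (N : Set (Vec n)) (f : Vec n → ℝ) : Vec n → Matrix (Fin n) (Fin n) ℝ :=
  extendFrom N (hessian f)

/-- A continuous random field on the set `S`: every `X · s` is a random variable and every path
is continuous on `S`. -/
def IsContRandomField {Ω α : Type*} [MeasurableSpace Ω] [TopologicalSpace α] (S : Set α)
    (X : Ω → α → ℝ) : Prop :=
  (∀ s ∈ S, Measurable fun ω => X ω s) ∧ ∀ ω, ContinuousOn (X ω) S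

/-- `sup_{s ∈ S T} |X T s| → 0` in probability. The supremum is taken in `[0, ∞]`; where it is not
measurable, the probability is the outer probability. -/
def SupTendstoZero {Ω : Type*} {mΩ : MeasurableSpace Ω} (P : Measure Ω) {ι α : Type*}
    (l : Filter ι) (S : ι → Set α) (X : ι → Ω → α → ℝ) : Prop :=
  ∀ ε : ℝ, 0 < ε →
    Tendsto (fun T => P {ω | ENNReal.ofReal ε < ⨆ s ∈ S T, ENNReal.ofReal |X T ω s|}) l (𝓝 0)

/-- Stable convergence with respect to the sub-σ-algebra `𝒢`, of random variables with values in a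
topological space: `E[f(Y_T) Z] → E[f(Y) Z]` for all bounded continuous `f` and all bounded
`𝒢`-measurable `Z`. -/
def StablyConverges {Ω : Type*} {mΩ : MeasurableSpace Ω} (P : Measure Ω) (𝒢 : MeasurableSpace Ω)
    {ι S : Type*} [TopologicalSpace S] [MeasurableSpace S] [BorelSpace S] (l : Filter ι)
    (Y : ι → Ω → S) (Y₀ : Ω → S) : Prop :=
  (∀ T, Measurable[mΩ] (Y T)) ∧ Measurable[mΩ] Y₀ ∧
  ∀ (f : S →ᵇ ℝ) (Z : Ω → ℝ), Measurable[𝒢] Z → (∃ C : ℝ, ∀ ω, |Z ω| ≤ C) →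
    Tendsto (fun T => ∫ ω, f (Y T ω) * Z ω ∂P) l (𝓝 (∫ ω, f (Y₀ ω) * Z ω ∂P))

/-- The setting of penalized quasi-maximum likelihood estimation: parameter spaces, quasi-log
likelihood, penalties, rates, candidate limits, and the estimators. -/
structure PenalizedModel {Ω : Type*} {mΩ : MeasurableSpace Ω} (P : Measure Ω) (p q : ℕ) where
  /-- the time set, with `sup 𝕋 = ∞` -/
  𝕋 : Set ℝ
  𝕋_unbounded : ¬ BddAbove 𝕋
  /-- the parameter space -/
  Θ : Set (Vec p)
  Θ_compact : IsCompact Θ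
  /-- the nuisance parameter space -/
  𝒯 : Set (Vec q)
  𝒯_compact : IsCompact 𝒯
  /-- the true value -/
  θs : Vec p
  θs_mem : θs ∈ Θ
  /-- a bounded open set, star-shaped about the true value (which need not belong to it), whose
  closure contains `Θ` near the true value -/
  N : Set (Vec p)
  N_open : IsOpen N
  N_bounded : Bornology.IsBounded N
  N_near : ∃ δ > 0, Θ ∩ Metric.ball θs δ ⊆ closure N
  N_star : ∀ θ ∈ N, ∀ t : ℝ, 0 < t → t ≤ 1 → t • θ + (1 - t) • θs ∈ N
  /-- the quasi-log likelihood on `Θ × 𝒯`, together with its extension to `closure N × 𝒯` -/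
  qll : 𝕋 → Ω → Vec p → Vec q → ℝ
  qll_field : ∀ T, IsContRandomField ((Θ ∪ closure N) ×ˢ 𝒯)
    (fun ω (x : Vec p × Vec q) => qll T ω x.1 x.2)
  qll_C2 : ∀ T ω, ∀ τ ∈ 𝒯, IsC2OnClosure N fun θ => qll T ω θ τ
  /-- the indices of the penalized components -/
  J : Finset (Fin p)
  /-- the weights `ξ_{j,T}` of the penalties -/
  ξ : Fin p → 𝕋 → Ω → ℝ
  ξ_measurable : ∀ j ∈ J, ∀ T, Measurable (ξ j T)
  ξ_nonneg : ∀ j ∈ J, ∀ T ω, 0 ≤ ξ j T ω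
  /-- the penalty functions `p_j` -/
  pen : Fin p → ℝ → ℝ
  /-- the exponents `q_j` -/
  qexp : Fin p → ℝ
  qexp_pos : ∀ j ∈ J, 0 < qexp j
  pen_nonneg : ∀ j ∈ J, ∀ x, 0 ≤ pen j x
  pen_continuous : ∀ j ∈ J, Continuous (pen j)
  pen_C1 : ∀ j ∈ J, ContDiffOn ℝ 1 (pen j) {0}ᶜ
  pen_eq_zero_iff : ∀ j ∈ J, ∀ x, pen j x = 0 ↔ x = 0
  pen_near_zero : ∀ j ∈ J, ∃ δ₀ > 0, ∀ x ∈ Icc (-δ₀) δ₀, pen j x = |x| ^ qexp j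
  /-- the penalty `s_T` on the nuisance parameter -/
  s : 𝕋 → Ω → Vec q → ℝ
  s_field : ∀ T, IsContRandomField univ (s T)
  s_nonneg : ∀ T ω τ, 0 ≤ s T ω τ
  /-- the diagonal entries of the rate matrix `𝔞_T` -/
  𝔞 : Fin p → 𝕋 → ℝ
  𝔞_pos : ∀ j T, 0 < 𝔞 j T
  𝔞_tendsto : ∀ j, Tendsto (𝔞 j) atTop (𝓝 0)
  /-- the exponents `ρ_k`, for penalized components with true value zero -/
  ρ : Fin p → ℝ
  one_le_ρ : ∀ k ∈ J, θs k = 0 → 1 ≤ ρ k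
  /-- the limit of the normalized quasi-log likelihood -/
  𝒴 : Ω → Vec p → ℝ
  𝒴_field : IsContRandomField Θ 𝒴
  /-- the random vector `Δ(θ*)` -/
  Δ : Ω → Vec p
  Δ_measurable : Measurable Δ
  /-- the limits `c_i`, for penalized components with nonzero true value -/
  c : Fin p → Ω → ℝ
  c_measurable : ∀ i ∈ J, θs i ≠ 0 → Measurable (c i)
  c_nonneg : ∀ i ∈ J, θs i ≠ 0 → ∀ ω, 0 ≤ c i ω
  /-- the limits `d_k`, for penalized components with true value zero -/
  d : Fin p → Ω → ℝ
  d_measurable : ∀ k ∈ J, θs k = 0 → Measurable (d k)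
  d_nonneg : ∀ k ∈ J, θs k = 0 → ∀ ω, 0 ≤ d k ω
  /-- an arbitrary `𝒯`-valued random variable -/
  τhat : 𝕋 → Ω → Vec q
  τhat_measurable : ∀ T, Measurable (τhat T)
  τhat_mem : ∀ T ω, τhat T ω ∈ 𝒯
  /-- the penalized quasi-maximum likelihood estimator: it asymptotically maximizes the penalized
  quasi-log likelihood `H_T(·, τhat_T)` on `Θ`, that is, it maximizes it up to `o_P(1)` -/
  θhat : 𝕋 → Ω → Vec p
  θhat_measurable : ∀ T, Measurable (θhat T)
  θhat_mem : ∀ T ω, θhat T ω ∈ Θ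
  θhat_maximizes : ∀ ε : ℝ, 0 < ε → Tendsto (fun T => P {ω | ∃ θ ∈ Θ,
      (qll T ω (θhat T ω) (τhat T ω) - ∑ j ∈ J, ξ j T ω * pen j (θhat T ω j) - s T ω (τhat T ω)) + ε
        < qll T ω θ (τhat T ω) - ∑ j ∈ J, ξ j T ω * pen j (θ j) - s T ω (τhat T ω)})
    atTop (𝓝 0)
  /-- the random matrix `Γ(θ*)` -/
  Γ : Ω → Matrix (Fin p) (Fin p) ℝ
  /-- the sub-σ-algebra of the stable convergence -/
  𝒢 : MeasurableSpace Ω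
  𝒢_le : 𝒢 ≤ mΩ
  Γ_measurable : ∀ i j, Measurable[𝒢] fun ω => Γ ω i j

namespace PenalizedModel

variable {Ω : Type*} {mΩ : MeasurableSpace Ω} {P : Measure Ω} {p q : ℕ} (M : PenalizedModel P p q)

/-- Penalized components whose true value is not zero. -/
def J₁ : Finset (Fin p) := M.J.filter fun j => M.θs j ≠ 0

/-- Penalized components whose true value is zero. -/
def J₀ : Finset (Fin p) := M.J.filter fun j => M.θs j = 0

/-- `𝔟_T`, the smallest eigenvalue of `(𝔞_T' 𝔞_T)⁻¹`. -/
def 𝔟 (T : M.𝕋) : ℝ := ⨅ j : Fin p, ((M.𝔞 j T) ^ 2)⁻¹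

/-- The normalized quasi-log likelihood `𝒴_T(θ, τ)`. -/
def 𝒴T (T : M.𝕋) (ω : Ω) (θ : Vec p) (τ : Vec q) : ℝ :=
  (M.𝔟 T)⁻¹ * (M.qll T ω θ τ - M.qll T ω M.θs τ)

/-- The diagonal entries of `a_T`: the rate `𝔞_{j,T}`, raised to the power `ρ_j` for `j ∈ J₀`. -/
def a (T : M.𝕋) (j : Fin p) : ℝ := if j ∈ M.J₀ then (M.𝔞 j T) ^ (M.ρ j) else M.𝔞 j T

/-- The diagonal entries of the matrix `b`, the limit of `𝔞_T⁻¹ a_T`. -/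
def b (j : Fin p) : ℝ := if j ∈ M.J₀ then (if M.ρ j = 1 then 1 else 0) else 1

/-- `Δ_T(θ*, τ) = 𝔞_T ∂_θ 𝓗_T(θ*, τ)`. -/
def ΔT (T : M.𝕋) (ω : Ω) (τ : Vec q) : Vec p :=
  diagMul (fun j => M.𝔞 j T) (gradOn M.N (fun θ => M.qll T ω θ τ) M.θs)

/-- `𝔞_T ∂_θ² 𝓗_T(θ, τ) 𝔞_T`. -/
def hessT (T : M.𝕋) (ω : Ω) (θ : Vec p) (τ : Vec q) : Matrix (Fin p) (Fin p) ℝ :=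
  Matrix.diagonal (fun j => M.𝔞 j T) * hessOn M.N (fun θ => M.qll T ω θ τ) θ *
    Matrix.diagonal (fun j => M.𝔞 j T)

/-- The local parameter space `U_T = {u | θ* + a_T u ∈ Θ}`. -/
def UT (T : M.𝕋) : Set (Vec p) := {u | M.θs + diagMul (M.a T) u ∈ M.Θ}

/-- The limit `U = ⋂_{δ>0} ⋃_{N≥1} ⋂_{T≥N} U_T^δ` of the local parameter spaces, where `A^δ` is the
open `δ`-neighbourhood of `A`. -/
def U : Set (Vec p) :=
  ⋂ (δ : ℝ) (_ : 0 < δ), ⋃ (n : ℕ) (_ : 1 ≤ n), ⋂ (T : M.𝕋) (_ : (n : ℝ) ≤ (T : ℝ)),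
    Metric.thickening δ (M.UT T)

/-- The normalized estimation error `u_T = a_T⁻¹ (θhat_T - θ*)`. -/
def uhat (T : M.𝕋) (ω : Ω) : Vec p := diagMul (fun j => (M.a T j)⁻¹) (M.θhat T ω - M.θs)

/-- The limit random field `ℤ(u)`. -/
def Z (ω : Ω) (u : Vec p) : ℝ :=
  Real.exp (inner ℝ (M.Δ ω) (diagMul M.b u) - (1 / 2) * quadForm (M.Γ ω) (diagMul M.b u)
    - ∑ i ∈ M.J₁, M.c i ω * deriv (M.pen i) (M.θs i) * u i
    - ∑ k ∈ M.J₀, M.d k ω * |u k| ^ M.qexp k)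

/-- The approximating random field `𝕍_T(u)`. -/
def V (T : M.𝕋) (ω : Ω) (u : Vec p) : ℝ :=
  Real.exp (inner ℝ (M.ΔT T ω (M.τhat T ω)) (diagMul M.b u) - (1 / 2) * quadForm (M.Γ ω) (diagMul M.b u)
    - ∑ i ∈ M.J₁, M.𝔞 i T * M.ξ i T ω * deriv (M.pen i) (M.θs i) * u i
    - ∑ k ∈ M.J₀, (M.𝔞 k T) ^ (M.qexp k * M.ρ k) * M.ξ k T ω * |u k| ^ M.qexp k)

/-- Identifiability: `𝒴_T → 𝒴` uniformly in probability, and `𝒴 < 0` off the true value. -/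
def C1 : Prop :=
  SupTendstoZero P atTop (fun _ : M.𝕋 => M.Θ ×ˢ M.𝒯)
    (fun T ω (x : Vec p × Vec q) => M.𝒴T T ω x.1 x.2 - M.𝒴 ω x.1) ∧
  ∀ᵐ ω ∂P, ∀ θ ∈ M.Θ, θ ≠ M.θs → M.𝒴 ω θ < 0

/-- Asymptotics of the score, of the penalty weights and of the Hessian. -/
def C2 : Prop :=
  (∃ τ₀ ∈ M.𝒯,
    SupTendstoZero P atTop (fun _ : M.𝕋 => M.𝒯) (fun T ω τ => ‖M.ΔT T ω τ - M.ΔT T ω τ₀‖) ∧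
    StablyConverges P M.𝒢 (S := Vec p × (M.J₁ → ℝ) × (M.J₀ → ℝ)) (atTop : Filter M.𝕋)
      (fun T ω => (M.ΔT T ω τ₀, fun i => M.𝔞 i T * M.ξ i T ω,
        fun k => (M.𝔞 k T) ^ (M.qexp k * M.ρ k) * M.ξ k T ω))
      (fun ω => (M.Δ ω, fun i => M.c i ω, fun k => M.d k ω))) ∧
  ∀ δ : M.𝕋 → ℝ, (∀ T, 0 < δ T) → Tendsto δ atTop (𝓝 0) →
    SupTendstoZero P atTop
      (fun T => {x : Vec p × Vec q | x.1 ∈ closure M.N ∧ x.2 ∈ M.𝒯 ∧ ‖x.1 - M.θs‖ < δ T})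
      (fun T ω x => matNorm (M.hessT T ω x.1 x.2 + M.Γ ω))

/-- `Γ(θ*)` is almost surely positive definite. -/
def C3 : Prop := ∀ᵐ ω ∂P, (M.Γ ω).PosDef

/-- `ξ_{i,T} / 𝔟_T → 0` in probability, for `i ∈ J₁`. -/
def C4 : Prop :=
  ∀ i ∈ M.J₁, TendstoInMeasure P (fun T ω => M.ξ i T ω * (M.𝔟 T)⁻¹) atTop (fun _ => 0)

/-- `d_k > 0` almost surely, for `k ∈ J₀` with `ρ_k > 1`. -/
def C5 : Prop := ∀ k ∈ M.J₀, 1 < M.ρ k → ∀ᵐ ω ∂P, 0 < M.d k ω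

/-- `U` contains every limit point of the sets `U_T` as `T → ∞`. -/
def A3 : Prop :=
  (⋂ (n : ℕ) (_ : 1 ≤ n), closure (⋃ (T : M.𝕋) (_ : (n : ℝ) ≤ (T : ℝ)), M.UT T)) ⊆ M.U

/-- `u` is a `U`-valued random variable that almost surely is the unique maximizer of `ℤ`
on `U`. -/
def A4 (u : Ω → Vec p) : Prop :=
  Measurable u ∧ (∀ ω, u ω ∈ M.U) ∧
  (∀ᵐ ω ∂P, IsLUB (M.Z ω '' M.U) (M.Z ω (u ω))) ∧
  ∀ᵐ ω ∂P, ∀ x ∈ M.U, x ≠ u ω → M.Z ω x < M.Z ω (u ω)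

/-- `v_T`, `T ≥ T₀`, are `U`-valued random variables that form a tight family, and each `v_T` almost
surely maximizes `𝕍_T` on `U`. -/
def A5 (T₀ : M.𝕋) (v : M.𝕋 → Ω → Vec p) : Prop :=
  (∀ T ≥ T₀, Measurable (v T) ∧ (∀ ω, v T ω ∈ M.U) ∧
    ∀ᵐ ω ∂P, IsLUB (M.V T ω '' M.U) (M.V T ω (v T ω))) ∧
  IsTightMeasureSet ((fun T => P.map (v T)) '' Ici T₀)

end PenalizedModel

end

/-! The proof is an argmax argument: the increment of the penalized field, in the local variable
`u`, is uniformly close on bounded sets to the logarithm of a limit field with converging random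
coefficients, and near maximizers follow their limit because the limiting maximizer is unique.

Consistency (`C1.eventually_norm_lt`) comes from comparing the field at the estimator with its value
at the true parameter: outside a ball the normalized likelihood is strictly negative, while the only
penalties that could favour a distant point are those of `J₁`, negligible on the scale `𝔟`.
Consistency in probability gives a deterministic radius tending to zero
(`exists_rate_of_probFilter`), so that the Hessian condition can be used in a second order expansion
at a point that may lie on the boundary (`IsC2OnClosure.abs_taylor_le_of_mem_closure`,
`C2.eventually_abs_gain_sub_le`).

Boundedness of the normalized error (`norm_le_of_localGain_ge`) has two sources. With `w = 𝔞⁻¹ a u`,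
positive definiteness of `Γ` bounds `w`. This says nothing uniform about the coordinates of `u` with
`ρ k > 1`, which are shrunk in `w`; there the penalty itself, with weight bounded away from zero, is
coercive. On bounded sets the gain is then replaced by `logZ` with the coefficients `coeffT`
(`eventually_abs_gain_sub_logZ_le`), and the local spaces `UT` by `U`, using compactness.

The stochastic core is `StablyConverges.eventually_integral_argmax_le`. The argmax is not continuous
in the coefficients, but `sup (g + n Ψ) - sup (n Ψ)` is; it dominates `g` at near maximizers of `Ψ`
up to a small error, and tends to `g` at the maximizer as `n` grows if that maximizer is unique.
Only the `𝒢`-measurable `Γ` is absent from the stable convergence; it is adjoined by simple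
approximation (`StablyConverges.tendsto_integral_of_lipschitz`). Applying the one-sided bound to `g`
and `-g` gives the first claim.

For the second claim the same bound is applied on a product, to `Ψ(z.1) + Ψ(z.2)`. The pair of
estimator and maximizer of `V` nearly maximizes it, its limiting maximizer is the diagonal point
`(u, u)`, and testing with the truncated distance gives convergence in probability. -/

/-! ### Events of probability tending to one -/

/-- The filter on `ι × Ω` of the sets whose sections have probability tending to one. -/
def probFilter {Ω ι : Type*} {mΩ : MeasurableSpace Ω} (P : Measure Ω) (l : Filter ι) :
    Filter (ι × Ω) where
  sets := {S | Tendsto (fun T => P {ω | (T, ω) ∉ S}) l (𝓝 0)}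
  univ_sets := by simpa using tendsto_const_nhds
  sets_of_superset := by
    intro S S' hS hSS'
    refine tendsto_of_tendsto_of_tendsto_of_le_of_le tendsto_const_nhds hS (fun _ => zero_le) ?_
    exact fun T => measure_mono fun ω hω h => hω (hSS' h)
  inter_sets := by
    intro S S' hS hS'
    have h : Tendsto (fun T => P {ω | (T, ω) ∉ S} + P {ω | (T, ω) ∉ S'}) l (𝓝 0) := by
      simpa using Tendsto.add hS hS'
    refine tendsto_of_tendsto_of_tendsto_of_le_of_le tendsto_const_nhds h (fun _ => zero_le) ?_
    intro T
    refine (measure_mono ?_).trans (measure_union_le _ _)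
    intro ω hω
    by_cases h1 : (T, ω) ∈ S
    · exact Or.inr fun h2 => hω ⟨h1, h2⟩
    · exact Or.inl h1

section ProbFilter

variable {Ω ι : Type*} {mΩ : MeasurableSpace Ω} {P : Measure Ω} {l : Filter ι}

lemma eventually_probFilter_iff {Q : ι × Ω → Prop} :
    (∀ᶠ x in probFilter P l, Q x) ↔ Tendsto (fun T => P {ω | ¬ Q (T, ω)}) l (𝓝 0) := Iff.rfl

lemma tendsto_fst_probFilter : Tendsto Prod.fst (probFilter P l) l := by
  intro S hS
  change Tendsto (fun T => P {ω | (T, ω) ∉ Prod.fst ⁻¹' S}) l (𝓝 0)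
  refine tendsto_const_nhds.congr' ?_
  filter_upwards [hS] with T hT
  simp [hT]

/-- Restricting the filter to `S` amounts to arguing on `S`; the price is the probability of its
complement, paid once when returning to probabilities. -/
lemma eventually_measure_le_of_probFilter_inf {S : Set (ι × Ω)} {Q : ι × Ω → Prop} {η₁ η₂ : ℝ≥0∞}
    (hS : ∀ᶠ T in l, P {ω | (T, ω) ∉ S} ≤ η₁) (hη₂ : 0 < η₂)
    (hQ : ∀ᶠ x in probFilter P l ⊓ 𝓟 S, Q x) :
    ∀ᶠ T in l, P {ω | ¬ Q (T, ω)} ≤ η₁ + η₂ := by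
  rw [eventually_inf_principal, eventually_probFilter_iff] at hQ
  filter_upwards [hS, hQ.eventually (ge_mem_nhds hη₂)] with T h1 h2
  refine (measure_mono ?_).trans ((measure_union_le _ _).trans (add_le_add h1 h2))
  intro ω hω
  by_cases h : (T, ω) ∈ S
  · exact Or.inr fun h' => hω (h' h)
  · exact Or.inl h

lemma eventually_probFilter_of_forall_pos {Q : ι × Ω → Prop}
    (h : ∀ η : ℝ, 0 < η → ∃ S : Set (ι × Ω), (∀ᶠ T in l, P {ω | (T, ω) ∉ S} ≤ ENNReal.ofReal η) ∧
      ∀ᶠ x in probFilter P l ⊓ 𝓟 S, Q x) :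
    ∀ᶠ x in probFilter P l, Q x := by
  rw [eventually_probFilter_iff, ENNReal.tendsto_nhds_zero]
  intro ε hε
  obtain ⟨e, he, he'⟩ : ∃ e : ℝ, 0 < e ∧ ENNReal.ofReal e + ENNReal.ofReal e ≤ ε := by
    rcases eq_or_ne ε ⊤ with rfl | htop
    · exact ⟨1, one_pos, le_top⟩
    · refine ⟨ε.toReal / 2, half_pos (ENNReal.toReal_pos hε.ne' htop), ?_⟩
      rw [← ENNReal.ofReal_add (by positivity) (by positivity), add_halves,
        ENNReal.ofReal_toReal htop]
  obtain ⟨S, hS, hQ⟩ := h e he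
  filter_upwards [eventually_measure_le_of_probFilter_inf hS (ENNReal.ofReal_pos.2 he) hQ]
    with T hT using hT.trans he'

lemma SupTendstoZero.eventually {α : Type*} {S : ι → Set α} {X : ι → Ω → α → ℝ}
    (h : SupTendstoZero P l S X) {ε : ℝ} (hε : 0 < ε) :
    ∀ᶠ x in probFilter P l, ∀ s ∈ S x.1, |X x.1 x.2 s| ≤ ε := by
  rw [eventually_probFilter_iff]
  refine tendsto_of_tendsto_of_tendsto_of_le_of_le tendsto_const_nhds (h ε hε)
    (fun _ => zero_le) fun T => measure_mono fun ω hω => ?_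
  simp only [mem_ofPred_eq, not_forall, not_le] at hω ⊢
  obtain ⟨s, hs, hlt⟩ := hω
  refine lt_of_lt_of_le ((ENNReal.ofReal_lt_ofReal_iff (hε.trans hlt)).2 hlt) ?_
  exact le_iSup₂ (f := fun s (_ : s ∈ S T) => ENNReal.ofReal |X T ω s|) s hs

/-- A sequence of random variables that is `o_P(1)` is bounded, with probability tending to one, by
a deterministic sequence that tends to zero. -/
lemma exists_rate_of_probFilter [IsProbabilityMeasure P] {X : ι → Ω → ℝ}
    (hX : ∀ δ : ℝ, 0 < δ → ∀ᶠ x in probFilter P l, X x.1 x.2 < δ)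
    {t : ι → ℝ} (ht : ∀ T, 0 < t T) (ht0 : Tendsto t l (𝓝 0)) :
    ∃ δ : ι → ℝ, (∀ T, 0 < δ T) ∧ Tendsto δ l (𝓝 0) ∧
      ∀ᶠ x in probFilter P l, X x.1 x.2 < δ x.1 := by
  -- The rate is essentially the smallest `δ` for which the probability of exceeding `δ` is at most
  -- `δ`. Adding `t T` makes the rate positive and strictly larger than the infimum, which need not
  -- be attained.
  set A : ι → Set ℝ := fun T => {δ | 0 < δ ∧ P {ω | ¬ X T ω < δ} ≤ ENNReal.ofReal δ} with hA
  have hne : ∀ T, (A T).Nonempty := fun T => ⟨1, one_pos, by simpa using prob_le_one⟩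
  have hbdd : ∀ T, BddBelow (A T) := fun T => ⟨0, fun δ h => h.1.le⟩
  have hnn : ∀ T, 0 ≤ sInf (A T) := fun T => le_csInf (hne T) fun δ h => h.1.le
  have hlim : Tendsto (fun T => sInf (A T) + t T) l (𝓝 0) := by
    have h1 : Tendsto (fun T => sInf (A T)) l (𝓝 0) := by
      rw [Metric.tendsto_nhds]
      intro e he
      have h := hX (e / 2) (half_pos he)
      rw [eventually_probFilter_iff] at h
      filter_upwards [h.eventually (ge_mem_nhds (ENNReal.ofReal_pos.2 (half_pos he)))] with T hT
      rw [Real.dist_eq, sub_zero, abs_of_nonneg (hnn T)]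
      exact (csInf_le (hbdd T) ⟨half_pos he, hT⟩).trans_lt (half_lt_self he)
    simpa using h1.add ht0
  refine ⟨fun T => sInf (A T) + t T, fun T => add_pos_of_nonneg_of_pos (hnn T) (ht T), hlim, ?_⟩
  rw [eventually_probFilter_iff]
  have h2 : Tendsto (fun T => ENNReal.ofReal (sInf (A T) + t T)) l (𝓝 0) := by
    simpa using ENNReal.tendsto_ofReal hlim
  refine tendsto_of_tendsto_of_tendsto_of_le_of_le tendsto_const_nhds h2 (fun _ => zero_le) ?_
  intro T
  obtain ⟨δ', hδ', hlt⟩ := exists_lt_of_csInf_lt (hne T) (lt_add_of_pos_right _ (ht T))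
  refine (measure_mono ?_).trans (hδ'.2.trans (ENNReal.ofReal_le_ofReal hlt.le))
  intro ω hω h
  exact hω (h.trans hlt)

/-- A continuous random field that is almost surely positive on a compact set is bounded away from
zero there with probability close to one. -/
lemma exists_pos_measure_lt_le [IsFiniteMeasure P] {α : Type*} [TopologicalSpace α]
    [SecondCountableTopology α] {K : Set α} (hK : IsCompact K) {X : Ω → α → ℝ}
    (hX : IsContRandomField K X) (hpos : ∀ᵐ ω ∂P, ∀ s ∈ K, 0 < X ω s) {η : ℝ} (hη : 0 < η) :
    ∃ κ : ℝ, 0 < κ ∧ P {ω | ¬ ∀ s ∈ K, κ ≤ X ω s} ≤ ENNReal.ofReal η := by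
  -- Bounds over a countable dense subset are measurable events, to which continuity from above of
  -- `P` applies; path continuity transfers them to all of `K` at the end.
  obtain ⟨D, hDK, hD, hKD⟩ : ∃ D ⊆ K, D.Countable ∧ K ⊆ closure D := by
    obtain ⟨D₀, hD₀, hd⟩ := TopologicalSpace.exists_countable_dense K
    refine ⟨Subtype.val '' D₀, Subtype.coe_image_subset _ _, hD₀.image _, fun s hs => ?_⟩
    exact image_closure_subset_closure_image continuous_subtype_val ⟨⟨s, hs⟩, hd _, rfl⟩
  set A : ℕ → Set Ω := fun n => {ω | ∀ s ∈ D, 1 / ((n : ℝ) + 1) ≤ X ω s}ᶜ with hA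
  have hmeas : ∀ n, MeasurableSet (A n) := fun n => by
    refine MeasurableSet.compl ?_
    have : {ω | ∀ s ∈ D, 1 / ((n : ℝ) + 1) ≤ X ω s} =
        ⋂ s ∈ D, {ω | 1 / ((n : ℝ) + 1) ≤ X ω s} := by
      ext ω; simp
    rw [this]
    exact MeasurableSet.biInter hD fun s hs =>
      measurableSet_le measurable_const (hX.1 s (hDK hs))
  have hanti : Antitone A := by
    intro n m hnm
    refine compl_subset_compl.2 fun ω hω s hs => le_trans ?_ (hω s hs)
    gcongr
  have hnull : P (⋂ n, A n) = 0 := by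
    refine measure_mono_null ?_ hpos
    intro ω hω h
    simp only [hA, mem_iInter, mem_compl_iff, mem_ofPred_eq] at hω
    rcases K.eq_empty_or_nonempty with rfl | hne
    · exact hω 0 fun s hs => absurd (hDK hs) (by simp)
    · obtain ⟨s₀, hs₀, hmin⟩ := hK.exists_isMinOn hne (hX.2 ω)
      obtain ⟨n, hn⟩ := exists_nat_one_div_lt (h s₀ hs₀)
      exact hω n fun s hs => hn.le.trans (hmin (hDK hs))
  have htend := tendsto_measure_iInter_atTop (μ := P) (fun n => (hmeas n).nullMeasurableSet) hanti
    ⟨0, measure_ne_top _ _⟩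
  rw [hnull] at htend
  obtain ⟨n, hn⟩ := (htend.eventually (ge_mem_nhds (ENNReal.ofReal_pos.2 hη))).exists
  refine ⟨1 / ((n : ℝ) + 1), by positivity, (measure_mono ?_).trans hn⟩
  intro ω hω h
  refine hω fun s hs => ?_
  have hcl := hKD hs
  by_contra hlt
  rw [not_le] at hlt
  have hev := (hX.2 ω s hs).eventually (gt_mem_nhds hlt)
  rw [eventually_nhdsWithin_iff] at hev
  obtain ⟨s', hs', hs'D⟩ := mem_closure_iff_nhds.1 hcl _ hev
  exact absurd (hs' (hDK hs'D)) (not_lt.2 (h s' hs'D))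

lemma exists_pos_measure_lt_le_of_ae_pos [IsFiniteMeasure P] {X : Ω → ℝ} (hX : Measurable X)
    (hpos : ∀ᵐ ω ∂P, 0 < X ω) {η : ℝ} (hη : 0 < η) :
    ∃ κ : ℝ, 0 < κ ∧ P {ω | ¬ κ ≤ X ω} ≤ ENNReal.ofReal η := by
  obtain ⟨κ, hκ, h⟩ := exists_pos_measure_lt_le (P := P) (K := (univ : Set Unit)) isCompact_univ
    (X := fun ω _ => X ω) ⟨fun _ _ => hX, fun ω => continuousOn_const⟩
    (by simpa using hpos) hη
  exact ⟨κ, hκ, by simpa using h⟩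

/-- A norm is bounded exactly when `(1 + ‖X‖)⁻¹` stays away from zero, so this is an instance of the
positivity lemma. -/
lemma exists_measure_norm_gt_le [IsFiniteMeasure P] {E : Type*} [NormedAddCommGroup E]
    [MeasurableSpace E] [OpensMeasurableSpace E] {X : Ω → E} (hX : Measurable X)
    {η : ℝ} (hη : 0 < η) : ∃ R : ℝ, 0 < R ∧ P {ω | ¬ ‖X ω‖ ≤ R} ≤ ENNReal.ofReal η := by
  obtain ⟨κ, hκ, h⟩ := exists_pos_measure_lt_le_of_ae_pos (P := P)
    (X := fun ω => (1 + ‖X ω‖)⁻¹) (by fun_prop) (ae_of_all _ fun ω => by positivity) hη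
  refine ⟨κ⁻¹, by positivity, (measure_mono ?_).trans h⟩
  intro ω hω h'
  refine hω ?_
  have := (le_inv_comm₀ hκ (by positivity)).1 h'
  linarith

/-- If `G Y > 0` almost surely and `Y_T` converges to `Y` stably, then `G Y_T` is bounded away from
zero in probability. -/
lemma StablyConverges.exists_pos_measure_lt_le [IsProbabilityMeasure P] {𝒢 : MeasurableSpace Ω}
    {S : Type*} [TopologicalSpace S] [MeasurableSpace S] [BorelSpace S] {Y : ι → Ω → S} {Y₀ : Ω → S}
    (h : StablyConverges P 𝒢 l Y Y₀) {G : S → ℝ} (hG : Continuous G)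
    (hpos : ∀ᵐ ω ∂P, 0 < G (Y₀ ω)) {η : ℝ} (hη : 0 < η) :
    ∃ κ : ℝ, 0 < κ ∧ ∀ᶠ T in l, P {ω | ¬ κ ≤ G (Y T ω)} ≤ ENNReal.ofReal η := by
  obtain ⟨κ, hκ, hPκ⟩ := exists_pos_measure_lt_le_of_ae_pos (P := P)
    (hG.measurable.comp h.2.1) hpos (half_pos hη)
  -- A continuous cutoff of `G`, equal to one where `G ≤ κ / 2` and to zero where `G ≥ κ`; it lies
  -- between the indicators of the two bad events, which explains the loss of a factor two.
  let f : S → ℝ := fun y => max 0 (min 1 (2 - 2 * G y / κ))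
  have hf0 : ∀ y, 0 ≤ f y := fun y => le_max_left _ _
  have hf1 : ∀ y, f y ≤ 1 := fun y => max_le zero_le_one (min_le_left _ _)
  have hfc : Continuous f := by fun_prop
  let F : S →ᵇ ℝ := BoundedContinuousFunction.ofNormedAddCommGroup f hfc 1
    fun y => by rw [Real.norm_eq_abs, abs_of_nonneg (hf0 y)]; exact hf1 y
  have hint : ∀ X : Ω → S, Measurable[mΩ] X → Integrable (fun ω => f (X ω)) P := fun X hX =>
    Integrable.of_bound (hfc.measurable.comp hX).aestronglyMeasurable 1
      (ae_of_all _ fun ω => by rw [Real.norm_eq_abs, abs_of_nonneg (hf0 _)]; exact hf1 _)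
  have hlim := h.2.2 F (fun _ => 1) measurable_const ⟨1, by simp⟩
  simp only [mul_one] at hlim
  change Tendsto (fun T => ∫ ω, f (Y T ω) ∂P) l (𝓝 (∫ ω, f (Y₀ ω) ∂P)) at hlim
  have hmeas : ∀ (X : Ω → S) (κ : ℝ), Measurable[mΩ] X → MeasurableSet[mΩ] {ω | ¬ κ ≤ G (X ω)} :=
    fun X κ hX => (measurableSet_le measurable_const (hG.measurable.comp hX)).compl
  have hlimit : ∫ ω, f (Y₀ ω) ∂P ≤ η / 2 := by
    have h1 : ∫ ω, f (Y₀ ω) ∂P ≤ ∫ ω, ({ω | ¬ κ ≤ G (Y₀ ω)}.indicator 1 ω : ℝ) ∂P := by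
      refine integral_mono (hint _ h.2.1)
        ((integrable_const (1 : ℝ)).indicator (hmeas _ _ h.2.1)) fun ω => ?_
      by_cases hω : κ ≤ G (Y₀ ω)
      · have : 2 ≤ 2 * G (Y₀ ω) / κ := by rw [le_div_iff₀ hκ]; linarith
        have h0 : f (Y₀ ω) = 0 := max_eq_left ((min_le_right _ _).trans (by linarith))
        simp [h0, hω]
      · exact (hf1 _).trans_eq
          (indicator_of_mem (show ω ∈ {ω | ¬ κ ≤ G (Y₀ ω)} from hω) (1 : Ω → ℝ)).symm
    refine h1.trans ?_
    rw [integral_indicator_one (hmeas _ _ h.2.1)]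
    exact ENNReal.toReal_le_of_le_ofReal (by positivity) hPκ
  refine ⟨κ / 2, half_pos hκ, ?_⟩
  filter_upwards [hlim.eventually (gt_mem_nhds (hlimit.trans_lt (half_lt_self hη)))] with T hT
  have h1 : ∫ ω, ({ω | ¬ κ / 2 ≤ G (Y T ω)}.indicator 1 ω : ℝ) ∂P ≤ ∫ ω, f (Y T ω) ∂P := by
    refine integral_mono ((integrable_const (1 : ℝ)).indicator (hmeas _ _ (h.1 T)))
      (hint _ (h.1 T)) fun ω => ?_
    by_cases hω : κ / 2 ≤ G (Y T ω)
    · simpa [hω] using hf0 _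
    · have : 2 * G (Y T ω) / κ ≤ 1 := by rw [div_le_iff₀ hκ]; linarith
      have h0 : f (Y T ω) = 1 := by
        simp only [f]
        rw [min_eq_left (by linarith), max_eq_right zero_le_one]
      rw [h0]
      exact (indicator_of_mem (show ω ∈ {ω | ¬ κ / 2 ≤ G (Y T ω)} from hω) (1 : Ω → ℝ)).le
  rw [integral_indicator_one (hmeas _ _ (h.1 T))] at h1
  exact (ENNReal.le_ofReal_iff_toReal_le (measure_ne_top _ _) hη.le).2 (h1.trans hT.le)

end ProbFilter

/-! ### Adjoining `𝒢`-measurable variables to stable convergence -/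

/-- Stated for a single σ-algebra so that it can be instantiated at `𝒢`: the level sets of the
approximations must be `𝒢`-measurable. -/
lemma exists_finite_range_approx {Ω E : Type*} [MeasurableSpace Ω] [PseudoMetricSpace E]
    [SecondCountableTopology E] [MeasurableSpace E] [BorelSpace E] {Γ : Ω → E}
    (hΓ : Measurable Γ) :
    ∃ G : ℕ → Ω → E, (∀ n, (range (G n)).Finite) ∧ (∀ n, Measurable (G n)) ∧
      (∀ n g, MeasurableSet (G n ⁻¹' {g})) ∧ ∀ ω, Tendsto (fun n => G n ω) atTop (𝓝 (Γ ω)) :=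
  ⟨fun n => hΓ.stronglyMeasurable.approx n, fun n => (hΓ.stronglyMeasurable.approx n).finite_range,
    fun n => (hΓ.stronglyMeasurable.approx n).measurable,
    fun n => (hΓ.stronglyMeasurable.approx n).measurableSet_fiber,
    hΓ.stronglyMeasurable.tendsto_approx⟩

/-- Stable convergence of `Y_T` with respect to `𝒢` is joint with `𝒢`-measurable variables. -/
lemma StablyConverges.tendsto_integral_of_lipschitz {Ω ι : Type*}
    {𝒢 mΩ : MeasurableSpace Ω} {P : Measure Ω} [IsProbabilityMeasure P] {l : Filter ι} (h𝒢 : 𝒢 ≤ mΩ)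
    {S : Type*} [TopologicalSpace S] [MeasurableSpace S] [BorelSpace S] {Y : ι → Ω → S} {Y₀ : Ω → S}
    (h : StablyConverges P 𝒢 l Y Y₀)
    {E : Type*} [PseudoMetricSpace E] [SecondCountableTopology E] [MeasurableSpace E] [BorelSpace E]
    {Γ : Ω → E} (hΓ : Measurable[𝒢] Γ) {φ : S → E → ℝ} {B L C : ℝ}
    (hφ : ∀ γ, Continuous fun x => φ x γ) (hB : ∀ x γ, |φ x γ| ≤ B)
    (hL : ∀ x γ γ', |φ x γ - φ x γ'| ≤ L * dist γ γ')
    {Z : Ω → ℝ} (hZ : Measurable[𝒢] Z) (hC : ∀ ω, |Z ω| ≤ C) :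
    (∀ X : Ω → S, Measurable[mΩ] X → Measurable[mΩ] fun ω => φ (X ω) (Γ ω)) ∧
    Tendsto (fun T => ∫ ω, φ (Y T ω) (Γ ω) * Z ω ∂P) l (𝓝 (∫ ω, φ (Y₀ ω) (Γ ω) * Z ω ∂P)) := by
  obtain ⟨G, hGfin, hGmble, hGmeas, hGlim⟩ := @exists_finite_range_approx Ω E 𝒢 _ _ _ _ Γ hΓ
  have hZm : Measurable[mΩ] Z := hZ.mono h𝒢 le_rfl
  have hGm : ∀ n g, MeasurableSet[mΩ] (G n ⁻¹' {g}) := fun n g => h𝒢 _ (hGmeas n g)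
  have hsum : ∀ (n : ℕ) (X : Ω → S) (ω : Ω), φ (X ω) (G n ω) =
      ∑ g ∈ (hGfin n).toFinset, φ (X ω) g * (G n ⁻¹' {g}).indicator 1 ω := by
    intro n X ω
    rw [Finset.sum_eq_single (G n ω)]
    · simp
    · intro g _ hg
      have : ω ∉ G n ⁻¹' {g} := fun hω => hg (mem_singleton_iff.1 hω).symm
      simp [indicator_of_notMem this]
    · intro hω
      exact absurd ((hGfin n).mem_toFinset.2 (mem_range_self ω)) hω
  have hmeasn : ∀ (n : ℕ) (X : Ω → S), Measurable[mΩ] X →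
      Measurable[mΩ] fun ω => φ (X ω) (G n ω) := by
    intro n X hX
    simp_rw [hsum n X]
    exact Finset.measurable_sum _ fun g _ =>
      ((hφ g).measurable.comp hX).mul (measurable_one.indicator (hGm n g))
  have hφ2 : ∀ x, Continuous (φ x) := by
    intro x
    have hL0 : ∀ γ γ', |φ x γ - φ x γ'| ≤ (max L 0) * dist γ γ' := fun γ γ' =>
      (hL x γ γ').trans (mul_le_mul_of_nonneg_right (le_max_left _ _) dist_nonneg)
    have : LipschitzWith ⟨max L 0, le_max_right _ _⟩ (φ x) := LipschitzWith.of_dist_le_mul hL0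
    exact this.continuous
  have hmeas : ∀ X : Ω → S, Measurable[mΩ] X → Measurable[mΩ] fun ω => φ (X ω) (Γ ω) := by
    intro X hX
    refine measurable_of_tendsto_metrizable (fun n => hmeasn n X hX) ?_
    rw [tendsto_pi_nhds]
    exact fun ω => ((hφ2 (X ω)).tendsto _).comp (hGlim ω)
  refine ⟨hmeas, ?_⟩
  have hint : ∀ f : Ω → ℝ, Measurable[mΩ] f → (∀ ω, |f ω| ≤ B) →
      Integrable (fun ω => f ω * Z ω) P := by
    intro f hf hfB
    refine Integrable.of_bound (hf.mul hZm).aestronglyMeasurable (B * C) (ae_of_all _ fun ω => ?_)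
    rw [Real.norm_eq_abs, abs_mul]
    exact mul_le_mul (hfB ω) (hC ω) (abs_nonneg _) ((abs_nonneg _).trans (hfB ω))
  have hstep : ∀ n, Tendsto (fun T => ∫ ω, φ (Y T ω) (G n ω) * Z ω ∂P) l
      (𝓝 (∫ ω, φ (Y₀ ω) (G n ω) * Z ω ∂P)) := by
    intro n
    have hrew : ∀ X : Ω → S, Measurable[mΩ] X → ∫ ω, φ (X ω) (G n ω) * Z ω ∂P =
        ∑ g ∈ (hGfin n).toFinset, ∫ ω, φ (X ω) g * ((G n ⁻¹' {g}).indicator 1 ω * Z ω) ∂P := by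
      intro X hX
      rw [← integral_finsetSum]
      · refine integral_congr_ae (ae_of_all _ fun ω => ?_)
        simp only [hsum n X ω, Finset.sum_mul, mul_assoc]
      · intro g _
        have h1 := (hint (fun ω => φ (X ω) g) ((hφ g).measurable.comp hX)
          fun ω => hB _ _).indicator (hGm n g)
        refine h1.congr (ae_of_all _ fun ω => ?_)
        by_cases hω : ω ∈ G n ⁻¹' {g} <;> simp [hω]
    rw [hrew _ h.2.1]
    simp_rw [fun T => hrew _ (h.1 T)]
    refine tendsto_finsetSum _ fun g _ => ?_
    let F : S →ᵇ ℝ := BoundedContinuousFunction.ofNormedAddCommGroup (fun x => φ x g) (hφ g) B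
      fun x => hB x g
    -- For a simple function the level set indicator is bounded and `𝒢`-measurable, so it can be
    -- absorbed into the multiplier `Z` of the definition of stable convergence.
    refine h.2.2 F _ ((@measurable_const ℝ Ω _ 𝒢 1).indicator (hGmeas n g) |>.mul hZ) ⟨C, fun ω => ?_⟩
    by_cases hω : ω ∈ G n ⁻¹' {g}
    · simpa [hω] using hC ω
    · simpa [hω] using (abs_nonneg _).trans (hC ω)
  -- The replacement error is bounded by a quantity not involving the variable `X`, hence uniformly
  -- in `T`. This is where the Lipschitz bound in `γ`, uniform in `x`, is needed.
  set e : ℕ → ℝ := fun n => ∫ ω, min (L * dist (G n ω) (Γ ω)) (2 * B) * C ∂P with he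
  have hdm : ∀ n, Measurable[mΩ] fun ω => dist (G n ω) (Γ ω) := fun n =>
    ((hGmble n).mono h𝒢 le_rfl).dist (hΓ.mono h𝒢 le_rfl)
  have hbd : ∀ n ω, ‖min (L * dist (G n ω) (Γ ω)) (2 * B) * C‖ ≤ 2 * B * C := by
    intro n ω
    have hBn : 0 ≤ B := (abs_nonneg _).trans (hB (Y₀ ω) (Γ ω))
    have hLn : 0 ≤ L * dist (G n ω) (Γ ω) := (abs_nonneg _).trans (hL (Y₀ ω) _ _)
    have hCn : 0 ≤ C := (abs_nonneg _).trans (hC ω)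
    rw [Real.norm_eq_abs, abs_of_nonneg (by positivity)]
    exact mul_le_mul_of_nonneg_right (min_le_right _ _) hCn
  have hclose : ∀ n (X : Ω → S), Measurable[mΩ] X →
      |∫ ω, φ (X ω) (Γ ω) * Z ω ∂P - ∫ ω, φ (X ω) (G n ω) * Z ω ∂P| ≤ e n := by
    intro n X hX
    rw [← integral_sub (hint _ (hmeas X hX) fun ω => hB _ _) (hint _ (hmeasn n X hX) fun ω => hB _ _)]
    refine abs_integral_le_integral_abs.trans (integral_mono_of_nonneg
      (ae_of_all _ fun ω => abs_nonneg _) ?_ (ae_of_all _ fun ω => ?_))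
    · exact Integrable.of_bound ((((hdm n).const_mul L).min measurable_const).mul_const
        C).aestronglyMeasurable (2 * B * C) (ae_of_all _ fun ω => hbd n ω)
    · change |φ (X ω) (Γ ω) * Z ω - φ (X ω) (G n ω) * Z ω| ≤ _
      have h1 : |φ (X ω) (Γ ω) - φ (X ω) (G n ω)| ≤ min (L * dist (G n ω) (Γ ω)) (2 * B) := by
        refine le_min ?_ ?_
        · rw [dist_comm]; exact hL _ _ _
        · refine (abs_sub _ _).trans ?_
          linarith [hB (X ω) (Γ ω), hB (X ω) (G n ω)]
      rw [← sub_mul, abs_mul]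
      exact mul_le_mul h1 (hC ω) (abs_nonneg _) ((abs_nonneg _).trans h1)
  have hetend : Tendsto e atTop (𝓝 0) := by
    have h0 : ∫ ω, min (L * dist (Γ ω) (Γ ω)) (2 * B) * C ∂P = 0 := by
      rw [integral_eq_zero_of_ae]
      refine ae_of_all _ fun ω => ?_
      have hBn : 0 ≤ B := (abs_nonneg _).trans (hB (Y₀ ω) (Γ ω))
      simp [hBn]
    rw [← h0]
    refine tendsto_integral_of_dominated_convergence (fun _ => 2 * B * C)
      (fun n => (((hdm n).const_mul L).min measurable_const).mul_const C |>.aestronglyMeasurable)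
      (integrable_const _) (fun n => ae_of_all _ fun ω => hbd n ω) (ae_of_all _ fun ω => ?_)
    exact ((tendsto_const_nhds.mul ((hGlim ω).dist tendsto_const_nhds)).min
      tendsto_const_nhds).mul_const C
  rw [Metric.tendsto_nhds]
  intro ε hε
  obtain ⟨n, hn⟩ := (hetend.eventually (gt_mem_nhds (by positivity : 0 < ε / 3))).exists
  filter_upwards [(Metric.tendsto_nhds.1 (hstep n)) (ε / 3) (by positivity)] with T hT
  have h1 := hclose n _ (h.1 T)
  have h2 := hclose n _ h.2.1
  rw [Real.dist_eq] at hT ⊢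
  rw [abs_lt] at *
  rw [abs_le] at h1 h2
  constructor <;> linarith [h1.1, h1.2, h2.1, h2.2, hT.1, hT.2]

/-! ### A continuous substitute for the argmax functional -/

section SoftArgmax

variable {F : Type*} [TopologicalSpace F] {K : Set F}

lemma IsCompact.le_sSup_image (hK : IsCompact K) {f : F → ℝ} (hf : ContinuousOn f K) {w : F}
    (hw : w ∈ K) : f w ≤ sSup (f '' K) :=
  le_csSup (hK.bddAbove_image hf) (mem_image_of_mem f hw)

lemma IsCompact.sSup_image_le_add (hK : IsCompact K) (hne : K.Nonempty) {f f' : F → ℝ}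
    (hf' : ContinuousOn f' K) {c : ℝ} (h : ∀ w ∈ K, f w ≤ f' w + c) :
    sSup (f '' K) ≤ sSup (f' '' K) + c := by
  refine csSup_le (hne.image f) ?_
  rintro _ ⟨w, hw, rfl⟩
  linarith [h w hw, hK.le_sSup_image hf' hw]

/-- A continuous surrogate of the value of `g` at the maximizer of `Ψ` on `K`. -/
noncomputable def softArgmax (K : Set F) (g Ψ : F → ℝ) (n : ℝ) : ℝ :=
  sSup ((fun w => g w + n * Ψ w) '' K) - sSup ((fun w => n * Ψ w) '' K)

variable {g Ψ : F → ℝ} {B : ℝ}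

lemma abs_softArgmax_le (hK : IsCompact K) (hne : K.Nonempty) (hg : ContinuousOn g K)
    (hΨ : ContinuousOn Ψ K) (hB : ∀ w, |g w| ≤ B) (n : ℝ) : |softArgmax K g Ψ n| ≤ B := by
  have hΨn : ContinuousOn (fun w => n * Ψ w) K := hΨ.const_mul n
  rw [softArgmax, abs_le]
  constructor
  · have := hK.sSup_image_le_add hne (f := fun w => n * Ψ w)
      (f' := fun w => g w + n * Ψ w) (hg.add hΨn) (c := B) fun w _ => by linarith [(abs_le.1 (hB w)).1]
    linarith
  · have := hK.sSup_image_le_add hne (f := fun w => g w + n * Ψ w) hΨn (c := B)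
      fun w _ => by linarith [(abs_le.1 (hB w)).2]
    linarith

/-- A near maximizer `w` is a competitor in the first supremum and almost attains the second. No
uniqueness is required, so the bound applies before the limit. -/
lemma le_softArgmax (hK : IsCompact K) (hg : ContinuousOn g K)
    (hΨ : ContinuousOn Ψ K) {n κ : ℝ} (hn : 0 ≤ n) {w : F} (hw : w ∈ K)
    (hmax : ∀ v ∈ K, Ψ v ≤ Ψ w + κ) : g w - n * κ ≤ softArgmax K g Ψ n := by
  have hΨn : ContinuousOn (fun w => n * Ψ w) K := hΨ.const_mul n
  have h1 : g w + n * Ψ w ≤ sSup ((fun w => g w + n * Ψ w) '' K) :=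
    hK.le_sSup_image (hg.add hΨn) hw
  have h2 : sSup ((fun w => n * Ψ w) '' K) ≤ n * (Ψ w + κ) := by
    refine csSup_le (Set.Nonempty.image _ ⟨w, hw⟩) ?_
    rintro _ ⟨v, hv, rfl⟩
    exact mul_le_mul_of_nonneg_left (hmax v hv) hn
  rw [softArgmax]
  linarith

/-- Each supremum is nonexpansive for the uniform norm. The result supplies the Lipschitz dependence
on `γ` used to adjoin `Γ`. -/
lemma abs_softArgmax_sub_le (hK : IsCompact K) (hne : K.Nonempty) (hg : ContinuousOn g K)
    {Ψ' : F → ℝ} (hΨ : ContinuousOn Ψ K) (hΨ' : ContinuousOn Ψ' K) {n c : ℝ} (hn : 0 ≤ n)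
    (h : ∀ w ∈ K, |Ψ w - Ψ' w| ≤ c) :
    |softArgmax K g Ψ n - softArgmax K g Ψ' n| ≤ 2 * n * c := by
  have hΨn : ContinuousOn (fun w => n * Ψ w) K := hΨ.const_mul n
  have hΨn' : ContinuousOn (fun w => n * Ψ' w) K := hΨ'.const_mul n
  have hle : ∀ w ∈ K, n * Ψ w ≤ n * Ψ' w + n * c := fun w hw => by
    rw [← mul_add]; exact mul_le_mul_of_nonneg_left (by linarith [(abs_le.1 (h w hw)).2]) hn
  have hle' : ∀ w ∈ K, n * Ψ' w ≤ n * Ψ w + n * c := fun w hw => by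
    rw [← mul_add]; exact mul_le_mul_of_nonneg_left (by linarith [(abs_le.1 (h w hw)).1]) hn
  have h1 : sSup ((fun w => g w + n * Ψ w) '' K) ≤ sSup ((fun w => g w + n * Ψ' w) '' K) + n * c :=
    hK.sSup_image_le_add hne (f' := fun w => g w + n * Ψ' w) (hg.add hΨn') fun w hw => by linarith [hle w hw]
  have h2 : sSup ((fun w => g w + n * Ψ' w) '' K) ≤ sSup ((fun w => g w + n * Ψ w) '' K) + n * c :=
    hK.sSup_image_le_add hne (f' := fun w => g w + n * Ψ w) (hg.add hΨn) fun w hw => by linarith [hle' w hw]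
  have h3 := hK.sSup_image_le_add hne hΨn' hle
  have h4 := hK.sSup_image_le_add hne hΨn hle'
  rw [softArgmax, softArgmax, abs_le]
  constructor <;> linarith

/-- As `n` grows, a point where `Ψ` is smaller by a fixed gap cannot compete, since `g` can
compensate at most `2 * B`. Compactness provides the gap on the set where `g` exceeds its value at
the maximizer. -/
lemma tendsto_softArgmax (hK : IsCompact K) (hg : Continuous g) (hΨ : ContinuousOn Ψ K)
    (hB : ∀ w, |g w| ≤ B) {w : F} (hw : w ∈ K) (hmax : ∀ v ∈ K, v ≠ w → Ψ v < Ψ w) :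
    Tendsto (fun n : ℕ => softArgmax K g Ψ n) atTop (𝓝 (g w)) := by
  have hlow : ∀ n : ℕ, g w ≤ softArgmax K g Ψ n := fun n => by
    have := le_softArgmax hK hg.continuousOn hΨ (n := n) (κ := 0) n.cast_nonneg hw fun v hv => by
      rcases eq_or_ne v w with rfl | hne
      · simp
      · linarith [hmax v hv hne]
    simpa using this
  rw [Metric.tendsto_nhds]
  intro ε hε
  obtain ⟨d, hd, hgap⟩ : ∃ d : ℝ, 0 < d ∧ ∀ v ∈ K, g w + ε / 2 ≤ g v → Ψ v ≤ Ψ w - d := by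
    have hA : IsCompact (K ∩ {v | g w + ε / 2 ≤ g v}) :=
      hK.inter_right (isClosed_le continuous_const hg)
    rcases (K ∩ {v | g w + ε / 2 ≤ g v}).eq_empty_or_nonempty with he | hne
    · refine ⟨1, one_pos, fun v hv hgv => ?_⟩
      have : v ∈ K ∩ {v | g w + ε / 2 ≤ g v} := ⟨hv, hgv⟩
      simp [he] at this
    · obtain ⟨v₀, hv₀, hv₀max⟩ := hA.exists_isMaxOn hne (hΨ.mono inter_subset_left)
      have hne : v₀ ≠ w := by
        rintro rfl
        have : g v₀ + ε / 2 ≤ g v₀ := hv₀.2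
        linarith
      refine ⟨Ψ w - Ψ v₀, sub_pos.2 (hmax v₀ hv₀.1 hne), fun v hv hgv => ?_⟩
      have : Ψ v ≤ Ψ v₀ := hv₀max ⟨hv, hgv⟩
      linarith
  obtain ⟨n₀, hn₀⟩ := exists_nat_ge (2 * B / d)
  filter_upwards [eventually_ge_atTop n₀] with n hn
  have hnd : 2 * B ≤ n * d := by
    rw [← div_le_iff₀ hd]
    exact hn₀.trans (by exact_mod_cast hn)
  have h1 : sSup ((fun v => g v + n * Ψ v) '' K) ≤ g w + ε / 2 + n * Ψ w := by
    refine csSup_le (Set.Nonempty.image _ ⟨w, hw⟩) ?_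
    rintro _ ⟨v, hv, rfl⟩
    by_cases hgv : g w + ε / 2 ≤ g v
    · have h2 : (n : ℝ) * Ψ v ≤ n * (Ψ w - d) :=
        mul_le_mul_of_nonneg_left (hgap v hv hgv) n.cast_nonneg
      have := (abs_le.1 (hB v)).2
      have := (abs_le.1 (hB w)).1
      simp only
      nlinarith
    · have h2 : (n : ℝ) * Ψ v ≤ n * Ψ w := by
        refine mul_le_mul_of_nonneg_left ?_ n.cast_nonneg
        rcases eq_or_ne v w with rfl | hne
        · exact le_rfl
        · exact (hmax v hv hne).le
      simp only
      linarith
  have h2 : (n : ℝ) * Ψ w ≤ sSup ((fun v => n * Ψ v) '' K) :=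
    hK.le_sSup_image (hΨ.const_mul (n : ℝ)) hw
  have h3 : softArgmax K g Ψ n ≤ g w + ε / 2 := by rw [softArgmax]; linarith
  rw [Real.dist_eq, abs_of_nonneg (by linarith [hlow n])]
  linarith

end SoftArgmax

/-! ### The argmax theorem -/

/-- The argmax theorem under stable convergence, in one-sided form: approximate maximizers `w_T` on
a compact set `K` of `Ψ(Y_T, Γ, ·)` are asymptotically close to the unique maximizer `w` on `K` of
`Ψ(Y, Γ, ·)`. -/
lemma StablyConverges.eventually_integral_argmax_le {Ω ι : Type*}
    {𝒢 mΩ : MeasurableSpace Ω} {P : Measure Ω} [IsProbabilityMeasure P] {l : Filter ι} (h𝒢 : 𝒢 ≤ mΩ)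
    {S : Type*} [TopologicalSpace S] [MeasurableSpace S] [BorelSpace S] {Y : ι → Ω → S} {Y₀ : Ω → S}
    (h : StablyConverges P 𝒢 l Y Y₀)
    {E : Type*} [PseudoMetricSpace E] [SecondCountableTopology E] [MeasurableSpace E] [BorelSpace E]
    {Γ : Ω → E} (hΓ : Measurable[𝒢] Γ)
    {F : Type*} [PseudoMetricSpace F] [MeasurableSpace F] [BorelSpace F] {K : Set F}
    (hK : IsCompact K) (hne : K.Nonempty) {Ψ : S → E → F → ℝ}
    (hΨ : ∀ γ, Continuous fun z : S × F => Ψ z.1 γ z.2) {L : ℝ}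
    (hΨL : ∀ x γ γ', ∀ w ∈ K, |Ψ x γ w - Ψ x γ' w| ≤ L * dist γ γ')
    {Z : Ω → ℝ} (hZ : Measurable[𝒢] Z) {C : ℝ} (hC : 0 < C) (hZ0 : ∀ ω, 0 ≤ Z ω) (hZC : ∀ ω, Z ω ≤ C)
    {g : F → ℝ} (hg : Continuous g) {B : ℝ} (hB : ∀ w, |g w| ≤ B)
    {w : ι → Ω → F} {w₀ : Ω → F} (hw : ∀ᶠ T in l, Measurable[mΩ] (w T)) (hw₀ : Measurable[mΩ] w₀)
    {η : ℝ} (hη : 0 ≤ η)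
    (happrox : ∀ κ : ℝ, 0 < κ → ∀ᶠ T in l, P {ω | ¬ ∃ w' ∈ K, dist (w T ω) w' ≤ κ ∧
      ∀ v ∈ K, Ψ (Y T ω) (Γ ω) v ≤ Ψ (Y T ω) (Γ ω) w' + κ} ≤ ENNReal.ofReal η)
    (hmax : P {ω | ¬ (w₀ ω ∈ K ∧ ∀ v ∈ K, v ≠ w₀ ω →
      Ψ (Y₀ ω) (Γ ω) v < Ψ (Y₀ ω) (Γ ω) (w₀ ω))} ≤ ENNReal.ofReal η) {e : ℝ} (he : 0 < e) :
    ∀ᶠ T in l, ∫ ω, g (w T ω) * Z ω ∂P ≤ ∫ ω, g (w₀ ω) * Z ω ∂P + 4 * B * C * η + e := by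
  have hB0 : 0 ≤ B := (abs_nonneg _).trans (hB hne.some)
  have hZm : Measurable[mΩ] Z := hZ.mono h𝒢 le_rfl
  have hΨw : ∀ x γ, Continuous (Ψ x γ) := fun x γ => (hΨ γ).comp (by fun_prop : Continuous fun w => (x, w))
  let φ : ℕ → S → E → ℝ := fun n x γ => softArgmax K g (Ψ x γ) n
  have hφB : ∀ n x γ, |φ n x γ| ≤ B := fun n x γ =>
    abs_softArgmax_le hK hne hg.continuousOn (hΨw x γ).continuousOn hB n
  have hφ : ∀ n : ℕ, (∀ X : Ω → S, Measurable[mΩ] X → Measurable[mΩ] fun ω => φ n (X ω) (Γ ω)) ∧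
      Tendsto (fun T => ∫ ω, φ n (Y T ω) (Γ ω) * Z ω ∂P) l
        (𝓝 (∫ ω, φ n (Y₀ ω) (Γ ω) * Z ω ∂P)) := by
    intro n
    refine h.tendsto_integral_of_lipschitz h𝒢 hΓ (L := 2 * n * L) (fun γ => ?_) (hφB n) ?_ hZ
      (C := C) fun ω => by rw [abs_of_nonneg (hZ0 ω)]; exact hZC ω
    · have hc1 : Continuous fun z : S × F => g z.2 + n * Ψ z.1 γ z.2 :=
        (hg.comp continuous_snd).add (continuous_const.mul (hΨ γ))
      have hc2 : Continuous fun z : S × F => n * Ψ z.1 γ z.2 := continuous_const.mul (hΨ γ)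
      exact (hK.continuous_sSup (f := fun x w => g w + n * Ψ x γ w) hc1).sub
        (hK.continuous_sSup (f := fun x w => n * Ψ x γ w) hc2)
    · intro x γ γ'
      have := abs_softArgmax_sub_le hK hne hg.continuousOn (hΨw x γ).continuousOn
        (hΨw x γ').continuousOn n.cast_nonneg (hΨL x γ γ')
      rwa [← mul_assoc] at this
  have hint : ∀ f : Ω → ℝ, Measurable[mΩ] f → (∀ ω, |f ω| ≤ B) →
      Integrable (fun ω => f ω * Z ω) P := by
    intro f hf hfB
    refine Integrable.of_bound (hf.mul hZm).aestronglyMeasurable (B * C) (ae_of_all _ fun ω => ?_)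
    rw [Real.norm_eq_abs, abs_mul, abs_of_nonneg (hZ0 ω)]
    exact mul_le_mul (hfB ω) (hZC ω) (hZ0 ω) hB0
  -- The exceptional events are not known to be measurable, so they are replaced by measurable hulls
  -- of the same probability.
  have hind : ∀ {A : Set Ω}, P A ≤ ENNReal.ofReal η →
      ∫ ω, (toMeasurable P A).indicator (fun _ => 1 : Ω → ℝ) ω ∂P ≤ η := by
    intro A hA
    rw [integral_indicator_const _ (measurableSet_toMeasurable _ _), smul_eq_mul, mul_one,
      Measure.real, measure_toMeasurable]
    exact ENNReal.toReal_le_of_le_ofReal hη hA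
  have hindint : ∀ A : Set Ω, Integrable ((toMeasurable P A).indicator (fun _ => 1 : Ω → ℝ)) P :=
    fun A => (integrable_const (1 : ℝ)).indicator (measurableSet_toMeasurable _ _)
  have hgw₀ : Measurable[mΩ] fun ω => g (w₀ ω) := hg.measurable.comp hw₀
  -- The level `n` is fixed on the limit side, by dominated convergence off the exceptional set;
  -- discarding that set in both integrals costs `B * C * η` each. Only afterwards is `T` sent to
  -- the limit.
  obtain ⟨n, hn⟩ : ∃ n : ℕ, ∫ ω, φ n (Y₀ ω) (Γ ω) * Z ω ∂P ≤
      ∫ ω, g (w₀ ω) * Z ω ∂P + 2 * B * C * η + e / 4 := by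
    set A := {ω | ¬ (w₀ ω ∈ K ∧ ∀ v ∈ K, v ≠ w₀ ω →
      Ψ (Y₀ ω) (Γ ω) v < Ψ (Y₀ ω) (Γ ω) (w₀ ω))} with hA
    set N := toMeasurable P A with hN
    have hNm : MeasurableSet[mΩ] N := measurableSet_toMeasurable _ _
    have hlim : Tendsto (fun n : ℕ => ∫ ω, Nᶜ.indicator (fun ω => φ n (Y₀ ω) (Γ ω) * Z ω) ω ∂P)
        atTop (𝓝 (∫ ω, Nᶜ.indicator (fun ω => g (w₀ ω) * Z ω) ω ∂P)) := by
      refine tendsto_integral_of_dominated_convergence (fun _ => B * C) (fun n => ?_)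
        (integrable_const _) (fun n => ae_of_all _ fun ω => ?_) (ae_of_all _ fun ω => ?_)
      · exact ((((hφ n).1 _ h.2.1).mul hZm).indicator hNm.compl).aestronglyMeasurable
      · refine (norm_indicator_le_norm_self _ _).trans ?_
        rw [Real.norm_eq_abs, abs_mul, abs_of_nonneg (hZ0 ω)]
        exact mul_le_mul (hφB _ _ _) (hZC ω) (hZ0 ω) hB0
      · by_cases hω : ω ∈ N
        · simp [hω]
        · have hω' : ω ∈ Nᶜ := hω
          simp only [indicator_of_mem hω']
          have hgood : w₀ ω ∈ K ∧ ∀ v ∈ K, v ≠ w₀ ω →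
              Ψ (Y₀ ω) (Γ ω) v < Ψ (Y₀ ω) (Γ ω) (w₀ ω) := by
            by_contra hcon
            exact hω (subset_toMeasurable P A hcon)
          exact (tendsto_softArgmax hK hg (hΨw _ _).continuousOn hB hgood.1 hgood.2).mul_const _
    obtain ⟨n, hn⟩ := (hlim.eventually (gt_mem_nhds (lt_add_of_pos_right _
      (by positivity : 0 < e / 4)))).exists
    refine ⟨n, ?_⟩
    have hdiff : ∀ f : Ω → ℝ, Measurable[mΩ] f → (∀ ω, |f ω| ≤ B) →
        |∫ ω, f ω * Z ω ∂P - ∫ ω, Nᶜ.indicator (fun ω => f ω * Z ω) ω ∂P| ≤ B * C * η := by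
      intro f hf hfB
      rw [← integral_sub (hint f hf hfB) ((hint f hf hfB).indicator hNm.compl)]
      refine abs_integral_le_integral_abs.trans ?_
      have : ∫ ω, B * C * N.indicator (fun _ => 1 : Ω → ℝ) ω ∂P ≤ B * C * η := by
        rw [integral_const_mul]
        exact mul_le_mul_of_nonneg_left (hind hmax) (by positivity)
      refine le_trans (integral_mono_of_nonneg (ae_of_all _ fun ω => abs_nonneg _)
        ((hindint A).const_mul _) (ae_of_all _ fun ω => ?_)) this
      by_cases hω : ω ∈ N
      · have : |f ω * Z ω| ≤ B * C := by
          rw [abs_mul, abs_of_nonneg (hZ0 ω)]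
          exact mul_le_mul (hfB _) (hZC ω) (hZ0 ω) hB0
        change |f ω * Z ω - Nᶜ.indicator (fun ω => f ω * Z ω) ω| ≤
          B * C * N.indicator (fun _ => 1 : Ω → ℝ) ω
        rwa [indicator_of_mem hω, indicator_of_notMem (not_not.2 hω), sub_zero, mul_one]
      · change |f ω * Z ω - Nᶜ.indicator (fun ω => f ω * Z ω) ω| ≤
          B * C * N.indicator (fun _ => 1 : Ω → ℝ) ω
        rw [indicator_of_notMem hω, indicator_of_mem (show ω ∈ Nᶜ from hω), sub_self, mul_zero,
          abs_zero]
    have h1 := abs_le.1 (hdiff _ ((hφ n).1 _ h.2.1) fun ω => hφB n _ _)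
    have h2 := abs_le.1 (hdiff _ hgw₀ fun ω => hB _)
    linarith [h1.1, h1.2, h2.1, h2.2]
  obtain ⟨κ₀, hκ₀, hgκ⟩ : ∃ κ₀ : ℝ, 0 < κ₀ ∧ ∀ w' ∈ K, ∀ w, dist w w' ≤ κ₀ →
      g w ≤ g w' + e / (4 * C) := by
    have := hK.uniformContinuousAt_of_continuousAt g (fun a _ => hg.continuousAt)
      (Metric.dist_mem_uniformity (by positivity : 0 < e / (4 * C)))
    obtain ⟨κ₀, hκ₀, hsub⟩ := Metric.mem_uniformity_dist.1 this
    refine ⟨κ₀ / 2, half_pos hκ₀, fun w' hw' w hww' => ?_⟩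
    have h1 : dist (g w') (g w) < e / (4 * C) :=
      hsub (by rw [dist_comm]; exact hww'.trans_lt (half_lt_self hκ₀)) hw'
    rw [Real.dist_eq, abs_lt] at h1
    linarith [h1.1]
  -- The tolerance must beat the factor `n` in `le_softArgmax`, so it is chosen after `n`; `n + 1`
  -- avoids division by zero.
  set κ := min κ₀ (e / (4 * C * (n + 1))) with hκ
  have hκpos : 0 < κ := lt_min hκ₀ (by positivity)
  have hnκ : n * κ ≤ e / (4 * C) := by
    calc (n : ℝ) * κ ≤ (n + 1) * (e / (4 * C * (n + 1))) := by
          refine mul_le_mul (by linarith) (min_le_right _ _) hκpos.le (by positivity)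
      _ = e / (4 * C) := by field_simp
  filter_upwards [happrox κ hκpos, hw, (hφ n).2.eventually (gt_mem_nhds (lt_add_of_pos_right _
      (by positivity : 0 < e / 4)))] with T hT hwT hφT
  set A := {ω | ¬ ∃ w' ∈ K, dist (w T ω) w' ≤ κ ∧
      ∀ v ∈ K, Ψ (Y T ω) (Γ ω) v ≤ Ψ (Y T ω) (Γ ω) w' + κ} with hA
  have hmain : ∫ ω, g (w T ω) * Z ω ∂P ≤ ∫ ω, (φ n (Y T ω) (Γ ω) * Z ω + e / 2 +
      2 * B * C * (toMeasurable P A).indicator (fun _ => 1 : Ω → ℝ) ω) ∂P := by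
    refine integral_mono (hint _ (hg.measurable.comp hwT) fun ω => hB _)
      (((hint _ ((hφ n).1 _ (h.1 T)) fun ω => hφB _ _ _).add (integrable_const _)).add
        ((hindint A).const_mul _)) fun ω => ?_
    by_cases hω : ω ∈ toMeasurable P A
    · simp only [indicator_of_mem hω]
      have h1 : g (w T ω) * Z ω ≤ B * C :=
        mul_le_mul (abs_le.1 (hB _)).2 (hZC ω) (hZ0 ω) hB0
      have h2 : -(B * C) ≤ φ n (Y T ω) (Γ ω) * Z ω := by
        have h3 : -φ n (Y T ω) (Γ ω) * Z ω ≤ B * C :=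
          mul_le_mul (by linarith [(abs_le.1 (hφB n (Y T ω) (Γ ω))).1]) (hZC ω) (hZ0 ω) hB0
        linarith
      linarith
    · simp only [indicator_of_notMem hω]
      have hgood : ∃ w' ∈ K, dist (w T ω) w' ≤ κ ∧
          ∀ v ∈ K, Ψ (Y T ω) (Γ ω) v ≤ Ψ (Y T ω) (Γ ω) w' + κ := by
        by_contra hcon
        exact hω (subset_toMeasurable P A hcon)
      obtain ⟨w', hw'K, hdist, hw'max⟩ := hgood
      have h1 := hgκ w' hw'K _ (hdist.trans (min_le_left _ _))
      have h2 := le_softArgmax hK hg.continuousOn (hΨw (Y T ω) (Γ ω)).continuousOn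
        n.cast_nonneg hw'K hw'max
      have h3 : g (w T ω) ≤ φ n (Y T ω) (Γ ω) + e / (2 * C) := by
        have : e / (2 * C) = e / (4 * C) + e / (4 * C) := by field_simp; ring
        simp only [φ]
        linarith
      have h4 := mul_le_mul_of_nonneg_right h3 (hZ0 ω)
      have h5 : e / (2 * C) * Z ω ≤ e / 2 := by
        calc e / (2 * C) * Z ω ≤ e / (2 * C) * C :=
              mul_le_mul_of_nonneg_left (hZC ω) (by positivity)
          _ = e / 2 := by field_simp
      linarith
  have hI : ∫ ω, (φ n (Y T ω) (Γ ω) * Z ω + e / 2 +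
      2 * B * C * (toMeasurable P A).indicator (fun _ => 1 : Ω → ℝ) ω) ∂P ≤
      ∫ ω, φ n (Y T ω) (Γ ω) * Z ω ∂P + e / 2 + 2 * B * C * η := by
    have hi1 := hint _ ((hφ n).1 _ (h.1 T)) fun ω => hφB n (Y T ω) (Γ ω)
    have hi2 : Integrable (fun ω => φ n (Y T ω) (Γ ω) * Z ω + e / 2) P :=
      hi1.add (integrable_const _)
    rw [integral_add hi2 ((hindint A).const_mul _), integral_add hi1 (integrable_const _), integral_const_mul]
    have := mul_le_mul_of_nonneg_left (hind hT) (by positivity : 0 ≤ 2 * B * C)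
    simp only [integral_const, probReal_univ, smul_eq_mul, one_mul]
    linarith
  linarith

/-! ### Diagonal scaling and quadratic forms -/

section QuadraticForms

variable {n : ℕ}

@[simp] lemma diagMul_apply (d : Fin n → ℝ) (u : Vec n) (j : Fin n) :
    diagMul d u j = d j * u j := rfl

lemma continuous_diagMul (d : Fin n → ℝ) : Continuous (diagMul d) := by
  unfold diagMul
  fun_prop

lemma inner_diagMul_right (d : Fin n → ℝ) (u v : Vec n) :
    inner ℝ u (diagMul d v) = inner ℝ (diagMul d u) v := by
  simp only [PiLp.inner_apply, diagMul_apply, RCLike.inner_apply, conj_trivial]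
  exact Finset.sum_congr rfl fun j _ => by ring

lemma matNorm_nonneg (A : Matrix (Fin n) (Fin n) ℝ) : 0 ≤ matNorm A := Real.sqrt_nonneg _

/-- Cauchy–Schwarz over pairs of indices: the squares of the products `u i * u j` sum to `‖u‖ ^ 4`.
-/
lemma abs_quadForm_le (A : Matrix (Fin n) (Fin n) ℝ) (u : Vec n) :
    |quadForm A u| ≤ matNorm A * ‖u‖ ^ 2 := by
  have h1 : quadForm A u = ∑ x : Fin n × Fin n, A x.1 x.2 * (u x.1 * u x.2) := by
    rw [Fintype.sum_prod_type]
    simp only [quadForm, mul_assoc]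
  have h2 : (A * Aᵀ).trace = ∑ x : Fin n × Fin n, A x.1 x.2 ^ 2 := by
    rw [Fintype.sum_prod_type]
    simp only [Matrix.trace, Matrix.diag_apply, Matrix.mul_apply, Matrix.transpose_apply, sq]
  have h3 : (‖u‖ ^ 2) ^ 2 = ∑ x : Fin n × Fin n, (u x.1 * u x.2) ^ 2 := by
    rw [EuclideanSpace.real_norm_sq_eq, Fintype.sum_prod_type, sq, Finset.sum_mul_sum]
    simp only [mul_pow]
  have h4 := Finset.sum_mul_sq_le_sq_mul_sq Finset.univ
    (fun x : Fin n × Fin n => A x.1 x.2) fun x => u x.1 * u x.2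
  rw [← h1, ← h2, ← h3] at h4
  have h5 : |quadForm A u| = Real.sqrt (quadForm A u ^ 2) := (Real.sqrt_sq_eq_abs _).symm
  rw [h5, matNorm]
  have hnn : 0 ≤ (A * Aᵀ).trace := by rw [h2]; positivity
  refine (Real.sqrt_le_sqrt h4).trans_eq ?_
  rw [Real.sqrt_mul hnn, Real.sqrt_sq (by positivity)]

lemma quadForm_add (A B : Matrix (Fin n) (Fin n) ℝ) (u : Vec n) :
    quadForm (A + B) u = quadForm A u + quadForm B u := by
  simp only [quadForm, Matrix.add_apply, add_mul, Finset.sum_add_distrib]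

lemma quadForm_diagonal_mul (d : Fin n → ℝ) (A : Matrix (Fin n) (Fin n) ℝ) (u : Vec n) :
    quadForm (Matrix.diagonal d * A * Matrix.diagonal d) u = quadForm A (diagMul d u) := by
  simp only [quadForm, Matrix.mul_diagonal, Matrix.diagonal_mul, diagMul_apply]
  exact Finset.sum_congr rfl fun i _ => Finset.sum_congr rfl fun j _ => by ring

lemma quadForm_smul (A : Matrix (Fin n) (Fin n) ℝ) (c : ℝ) (u : Vec n) :
    quadForm A (c • u) = c ^ 2 * quadForm A u := by
  simp only [quadForm, PiLp.smul_apply, smul_eq_mul, Finset.mul_sum]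
  exact Finset.sum_congr rfl fun i _ => Finset.sum_congr rfl fun j _ => by ring

lemma continuous_quadForm (A : Matrix (Fin n) (Fin n) ℝ) : Continuous (quadForm A) := by
  unfold quadForm
  fun_prop

lemma abs_coord_le_norm (u : Vec n) (j : Fin n) : |u j| ≤ ‖u‖ := PiLp.norm_apply_le u j

lemma norm_le_sum_abs (u : Vec n) : ‖u‖ ≤ ∑ j, |u j| := by
  refine abs_le_of_sq_le_sq' ?_ (Finset.sum_nonneg fun j _ => abs_nonneg _) |>.2
  rw [EuclideanSpace.real_norm_sq_eq]
  calc ∑ j, u j ^ 2 = ∑ j, |u j| ^ 2 := by simp only [sq_abs]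
    _ ≤ (∑ j, |u j|) ^ 2 := Finset.sum_sq_le_sq_sum_of_nonneg fun j _ => abs_nonneg _

lemma quadForm_hessian (f : Vec n → ℝ) (x h : Vec n) :
    quadForm (hessian f x) h = fderiv ℝ (fderiv ℝ f) x h h := by
  have hh : h = ∑ i, h i • EuclideanSpace.single i (1 : ℝ) := by
    ext j
    simp [Finset.sum_apply, Pi.single_apply]
  conv_rhs => rw [hh]
  simp only [map_sum, map_smul, sum_apply, smul_apply,
    smul_eq_mul, quadForm, hessian, Matrix.of_apply, iteratedFDeriv_two_apply,
    Matrix.cons_val_zero, Matrix.cons_val_one, Finset.mul_sum]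
  rw [Finset.sum_comm]
  exact Finset.sum_congr rfl fun i _ => Finset.sum_congr rfl fun j _ => by ring

end QuadraticForms

/-! ### Second order expansion at a boundary point -/

section Taylor

variable {n : ℕ} {N : Set (Vec n)} {f : Vec n → ℝ}

lemma extendFrom_eqOn_closure {X Y : Type*} [TopologicalSpace X] [TopologicalSpace Y] [T2Space Y]
    {A : Set X} {f g : X → Y} (hg : ContinuousOn g (closure A)) (hgf : EqOn g f A) :
    EqOn (extendFrom A f) g (closure A) := by
  intro x hx
  refine extendFrom_eq hx ?_
  exact ((hg x hx).mono subset_closure).tendsto.congr'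
    (eventually_nhdsWithin_of_forall fun y hy => hgf hy)

lemma IsC2OnClosure.continuousOn_gradOn (hf : IsC2OnClosure N f) :
    ContinuousOn (gradOn N f) (closure N) := by
  obtain ⟨g, hg, hgf⟩ := hf.2.2.1
  exact hg.congr (extendFrom_eqOn_closure hg hgf)

lemma IsC2OnClosure.gradOn_eq (hf : IsC2OnClosure N f) : EqOn (gradOn N f) (gradient f) N := by
  obtain ⟨g, hg, hgf⟩ := hf.2.2.1
  exact fun x hx => (extendFrom_eqOn_closure hg hgf (subset_closure hx)).trans (hgf hx)

lemma IsC2OnClosure.hessOn_eq (hf : IsC2OnClosure N f) : EqOn (hessOn N f) (hessian f) N := by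
  obtain ⟨g, hg, hgf⟩ := hf.2.2.2
  exact fun x hx => (extendFrom_eqOn_closure hg hgf (subset_closure hx)).trans (hgf hx)

/-- Second order expansion at a point of the closure of an open set `N` about which `N` is
star-shaped. -/
lemma IsC2OnClosure.abs_taylor_le (hN : IsOpen N) (hf : IsC2OnClosure N f) {x₀ : Vec n}
    (hx₀ : x₀ ∈ closure N)
    (hstar : ∀ θ ∈ N, ∀ t : ℝ, 0 < t → t ≤ 1 → t • θ + (1 - t) • x₀ ∈ N)
    {d : Fin n → ℝ} {G : Matrix (Fin n) (Fin n) ℝ} {δ ε : ℝ}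
    (hε : ∀ x ∈ N, ‖x - x₀‖ < δ →
      matNorm (Matrix.diagonal d * hessOn N f x * Matrix.diagonal d + G) ≤ ε)
    {w : Vec n} (hw : x₀ + diagMul d w ∈ N) (hδ : ‖diagMul d w‖ < δ) :
    |f (x₀ + diagMul d w) - f x₀ - inner ℝ (diagMul d (gradOn N f x₀)) w + 1 / 2 * quadForm G w| ≤
      ε * ‖w‖ ^ 2 := by
  set h := diagMul d w with hh
  have hpath : ∀ t : ℝ, 0 < t → t ≤ 1 → x₀ + t • h ∈ N := by
    intro t ht ht1
    convert hstar _ hw t ht ht1 using 1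
    module
  have hpath' : ∀ t ∈ Icc (0 : ℝ) 1, x₀ + t • h ∈ closure N := by
    intro t ht
    rcases ht.1.eq_or_lt with rfl | h0
    · simpa using hx₀
    · exact subset_closure (hpath t h0 ht.2)
  have hcγ : Continuous fun t : ℝ => x₀ + t • h := by fun_prop
  have hdγ : ∀ t : ℝ, HasDerivAt (fun t : ℝ => x₀ + t • h) h t := fun t => by
    simpa using ((hasDerivAt_id t).smul_const h).const_add x₀
  have hcd : ∀ x ∈ N, ContDiffAt ℝ 2 f x := fun x hx => hf.2.1.contDiffAt (hN.mem_nhds hx)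
  set G0 : ℝ := inner ℝ (gradOn N f x₀) h with hG0
  set qf : ℝ := quadForm G w with hqf
  -- `φ` is the function along the segment minus its quadratic model, and `ψ` its derivative. The
  -- point `x₀` may lie outside `N`, so both are differentiated only on the open interval and are
  -- merely continuous at the ends; two mean value theorems then suffice, giving the constant one
  -- instead of one half.
  let φ : ℝ → ℝ := fun t => f (x₀ + t • h) - t * G0 + t ^ 2 / 2 * qf
  let ψ : ℝ → ℝ := fun t => inner ℝ (gradOn N f (x₀ + t • h)) h - G0 + t * qf
  have hφc : ContinuousOn φ (Icc 0 1) := by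
    have : ContinuousOn (fun t : ℝ => f (x₀ + t • h)) (Icc 0 1) :=
      hf.1.comp hcγ.continuousOn hpath'
    exact (this.sub (by fun_prop)).add (by fun_prop)
  have hψc : ContinuousOn ψ (Icc 0 1) := by
    have : ContinuousOn (fun t : ℝ => gradOn N f (x₀ + t • h)) (Icc 0 1) :=
      hf.continuousOn_gradOn.comp hcγ.continuousOn hpath'
    exact ((this.inner continuousOn_const).sub (by fun_prop)).add (by fun_prop)
  have hgrad : ∀ x ∈ N, inner ℝ (gradOn N f x) h = fderiv ℝ f x h := by
    intro x hx
    rw [hf.gradOn_eq hx, gradient, InnerProductSpace.toDual_symm_apply]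
  have hφd : ∀ t ∈ Ioo (0 : ℝ) 1, HasDerivAt φ (ψ t) t := by
    intro t ht
    have hx := hpath t ht.1 ht.2.le
    have h1 : HasDerivAt (fun t : ℝ => f (x₀ + t • h)) (fderiv ℝ f (x₀ + t • h) h) t :=
      ((hcd _ hx).differentiableAt (by norm_num)).hasFDerivAt.comp_hasDerivAt t (hdγ t)
    have h2 : HasDerivAt (fun t : ℝ => t * G0) G0 t := by
      simpa using (hasDerivAt_id t).mul_const G0
    have h3 : HasDerivAt (fun t : ℝ => t ^ 2 / 2 * qf) (t * qf) t := by
      simpa using (((hasDerivAt_id t).pow 2).div_const 2).mul_const qf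
    refine ((h1.sub h2).add h3).congr_deriv ?_
    simp only [ψ, hgrad _ hx]
  have hψd : ∀ t ∈ Ioo (0 : ℝ) 1,
      HasDerivAt ψ (quadForm (hessOn N f (x₀ + t • h)) h + qf) t := by
    intro t ht
    have hx := hpath t ht.1 ht.2.le
    have h1 : HasFDerivAt (fderiv ℝ f) (fderiv ℝ (fderiv ℝ f) (x₀ + t • h)) (x₀ + t • h) :=
      (((hcd _ hx).fderiv_right (m := 1) (by norm_num)).differentiableAt
        (by norm_num)).hasFDerivAt
    have h2 : HasDerivAt (fun t : ℝ => fderiv ℝ f (x₀ + t • h) h)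
        (fderiv ℝ (fderiv ℝ f) (x₀ + t • h) h h) t := by
      have h5 := h1.comp_hasDerivAt t (hdγ t)
      exact (ContinuousLinearMap.apply ℝ ℝ h).hasFDerivAt.comp_hasDerivAt t h5
    have h3 : HasDerivAt (fun t : ℝ => t * qf) qf t := by
      simpa using (hasDerivAt_id t).mul_const qf
    have h4 : (fun t : ℝ => fderiv ℝ f (x₀ + t • h) h - G0 + t * qf) =ᶠ[𝓝 t] ψ := by
      filter_upwards [hcγ.continuousAt.eventually (hN.mem_nhds hx)] with s hs
      simp only [ψ, hgrad _ hs]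
    rw [hf.hessOn_eq hx, quadForm_hessian]
    exact ((h2.sub_const G0).add h3).congr_of_eventuallyEq h4.symm
  have hbound : ∀ t ∈ Ioo (0 : ℝ) 1,
      |quadForm (hessOn N f (x₀ + t • h)) h + qf| ≤ ε * ‖w‖ ^ 2 := by
    intro t ht
    have hx := hpath t ht.1 ht.2.le
    have hlt : ‖x₀ + t • h - x₀‖ < δ := by
      rw [add_sub_cancel_left, norm_smul, Real.norm_eq_abs, abs_of_pos ht.1]
      exact (mul_le_of_le_one_left (norm_nonneg _) ht.2.le).trans_lt hδ
    have h1 := abs_quadForm_le (Matrix.diagonal d * hessOn N f (x₀ + t • h) *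
      Matrix.diagonal d + G) w
    rw [quadForm_add, quadForm_diagonal_mul] at h1
    exact h1.trans (mul_le_mul_of_nonneg_right (hε _ hx hlt) (by positivity))
  have hψ0 : ψ 0 = 0 := by simp [ψ, G0]
  have hψb : ∀ t ∈ Ioo (0 : ℝ) 1, |ψ t| ≤ ε * ‖w‖ ^ 2 := by
    intro t ht
    obtain ⟨s, hs, hs'⟩ := exists_hasDerivAt_eq_slope ψ _ ht.1
      (hψc.mono (Icc_subset_Icc_right ht.2.le)) fun s hs => hψd s ⟨hs.1, hs.2.trans ht.2⟩
    have hb := hbound s ⟨hs.1, hs.2.trans ht.2⟩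
    rw [hs', hψ0, sub_zero, sub_zero, abs_div, abs_of_pos ht.1, div_le_iff₀ ht.1] at hb
    exact hb.trans (mul_le_of_le_one_right ((abs_nonneg _).trans
      (hbound s ⟨hs.1, hs.2.trans ht.2⟩)) ht.2.le)
  obtain ⟨t, ht, ht'⟩ := exists_hasDerivAt_eq_slope φ ψ one_pos hφc hφd
  have hb := hψb t ht
  rw [ht'] at hb
  convert hb using 2
  rw [← inner_diagMul_right]
  simp only [φ, ← hh, ← hG0]
  simp
  ring

/-- Both sides are continuous on `closure N`, so the inequality extends from `N`. The ball
constraint survives because the ball is open, and invertibility of `d` lets `w` be expressed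
continuously through the point. -/
lemma IsC2OnClosure.abs_taylor_le_of_mem_closure (hN : IsOpen N) (hf : IsC2OnClosure N f)
    {x₀ : Vec n} (hx₀ : x₀ ∈ closure N)
    (hstar : ∀ θ ∈ N, ∀ t : ℝ, 0 < t → t ≤ 1 → t • θ + (1 - t) • x₀ ∈ N)
    {d : Fin n → ℝ} (hd : ∀ j, d j ≠ 0) {G : Matrix (Fin n) (Fin n) ℝ} {δ ε : ℝ}
    (hε : ∀ x ∈ N, ‖x - x₀‖ < δ →
      matNorm (Matrix.diagonal d * hessOn N f x * Matrix.diagonal d + G) ≤ ε)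
    {w : Vec n} (hw : x₀ + diagMul d w ∈ closure N) (hδ : ‖diagMul d w‖ < δ) :
    |f (x₀ + diagMul d w) - f x₀ - inner ℝ (diagMul d (gradOn N f x₀)) w + 1 / 2 * quadForm G w| ≤
      ε * ‖w‖ ^ 2 := by
  let W : Vec n → Vec n := fun θ => diagMul (fun j => (d j)⁻¹) (θ - x₀)
  have hW : ∀ θ, diagMul d (W θ) = θ - x₀ := fun θ => by
    ext j
    simp [W, mul_inv_cancel_left₀ (hd j)]
  have hWc : Continuous W := (continuous_diagMul _).comp (by fun_prop)
  have hWw : W (x₀ + diagMul d w) = w := by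
    ext j
    simp [W, inv_mul_cancel_left₀ (hd j)]
  have hmem : x₀ + diagMul d w ∈ closure (N ∩ Metric.ball x₀ δ) :=
    (Metric.isOpen_ball (x := x₀) (ε := δ)).closure_inter ⟨hw, by simpa using hδ⟩
  have hsub : closure (N ∩ Metric.ball x₀ δ) ⊆ closure N := closure_mono inter_subset_left
  have key := le_on_closure (s := N ∩ Metric.ball x₀ δ)
    (f := fun θ => |f θ - f x₀ - inner ℝ (diagMul d (gradOn N f x₀)) (W θ) +
      1 / 2 * quadForm G (W θ)|) (g := fun θ => ε * ‖W θ‖ ^ 2) ?_ ?_ ?_ hmem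
  · simpa only [hWw] using key
  · intro θ hθ
    have hθ' : x₀ + diagMul d (W θ) = θ := by rw [hW]; abel
    have := hf.abs_taylor_le hN hx₀ hstar hε (w := W θ) (by rw [hθ']; exact hθ.1)
      (by rw [hW, ← dist_eq_norm]; exact hθ.2)
    rwa [hθ'] at this
  · have h1 := hf.1.mono hsub
    have h2 : Continuous fun θ => inner ℝ (diagMul d (gradOn N f x₀)) (W θ) := by fun_prop
    have h3 : Continuous fun θ => 1 / 2 * quadForm G (W θ) :=
      continuous_const.mul ((continuous_quadForm G).comp hWc)
    exact (((h1.sub continuousOn_const).sub h2.continuousOn).add h3.continuousOn).abs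
  · fun_prop

end Taylor

/-! ### Local parameter spaces and their limit -/

namespace PenalizedModel

variable {Ω : Type*} {mΩ : MeasurableSpace Ω} {P : Measure Ω} {p q : ℕ} (M : PenalizedModel P p q)

lemma eventually_le_time (r : ℝ) : ∀ᶠ T : M.𝕋 in atTop, r ≤ (T : ℝ) := by
  obtain ⟨t, ht, hrt⟩ := not_bddAbove_iff.1 M.𝕋_unbounded r
  filter_upwards [eventually_ge_atTop (⟨t, ht⟩ : M.𝕋)] with T hT
  exact hrt.le.trans hT

lemma mem_U_iff {u : Vec p} : u ∈ M.U ↔ ∀ δ : ℝ, 0 < δ → ∃ n : ℕ, 1 ≤ n ∧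
    ∀ T : M.𝕋, (n : ℝ) ≤ (T : ℝ) → u ∈ Metric.thickening δ (M.UT T) := by
  simp only [U, mem_iInter, mem_iUnion, exists_prop]

lemma isClosed_U : IsClosed M.U := by
  refine isClosed_of_closure_subset fun u hu => ?_
  rw [mem_U_iff]
  intro δ hδ
  obtain ⟨u', hu', hd⟩ := Metric.mem_closure_iff.1 hu (δ / 2) (half_pos hδ)
  obtain ⟨n, hn, h⟩ := M.mem_U_iff.1 hu' (δ / 2) (half_pos hδ)
  refine ⟨n, hn, fun T hT => ?_⟩
  obtain ⟨z, hz, hz'⟩ := Metric.mem_thickening_iff.1 (h T hT)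
  exact Metric.mem_thickening_iff.2 ⟨z, hz, (dist_triangle _ _ _).trans_lt (by linarith)⟩

lemma zero_mem_UT (T : M.𝕋) : (0 : Vec p) ∈ M.UT T := by
  have : diagMul (M.a T) (0 : Vec p) = 0 := by ext j; simp
  simpa [UT, this] using M.θs_mem

lemma zero_mem_U : (0 : Vec p) ∈ M.U := M.mem_U_iff.2 fun _ hδ =>
  ⟨1, le_rfl, fun T _ => Metric.self_subset_thickening hδ _ (M.zero_mem_UT T)⟩

variable {M}

/-- The part of a closed ball at distance at least `κ` from `U` is compact and, by `A3`, misses the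
intersection of the decreasing closed sets `F n`; hence it already misses one of them. -/
lemma A3.eventually_exists_mem_U (h : M.A3) (R : ℝ) {κ : ℝ} (hκ : 0 < κ) :
    ∀ᶠ T in atTop, ∀ u ∈ M.UT T, ‖u‖ ≤ R → ∃ v ∈ M.U, dist u v < κ := by
  let F : ℕ → Set (Vec p) := fun n =>
    closure (⋃ (T : M.𝕋) (_ : ((n + 1 : ℕ) : ℝ) ≤ (T : ℝ)), M.UT T)
  have hanti : Antitone F := by
    intro n m hnm
    refine closure_mono ?_
    refine iUnion_mono fun T => ?_
    refine iUnion_subset fun hT => ?_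
    exact subset_iUnion_of_subset (le_trans (by exact_mod_cast Nat.succ_le_succ hnm) hT)
      subset_rfl
  have hA : IsCompact (Metric.closedBall (0 : Vec p) R \ Metric.thickening κ M.U) :=
    (isCompact_closedBall _ _).diff Metric.isOpen_thickening
  have hemp : (Metric.closedBall (0 : Vec p) R \ Metric.thickening κ M.U) ∩ ⋂ n, F n = ∅ := by
    rw [eq_empty_iff_forall_notMem]
    rintro u ⟨hu, huF⟩
    refine hu.2 (Metric.self_subset_thickening hκ _ (h ?_))
    simp only [mem_iInter] at huF ⊢
    intro n hn
    have := huF (n - 1)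
    simp only [F, Nat.sub_add_cancel hn] at this
    exact this
  obtain ⟨n, hn⟩ := hA.elim_directed_family_closed F (fun n => isClosed_closure) hemp
    (directed_of_isDirected_le fun _ _ h => hanti h)
  filter_upwards [M.eventually_le_time ((n + 1 : ℕ) : ℝ)] with T hT u hu hR
  by_contra hcon
  have hmem : u ∈ (Metric.closedBall (0 : Vec p) R \ Metric.thickening κ M.U) ∩ F n := by
    refine ⟨⟨by simpa using hR, fun hth => hcon ?_⟩, subset_closure ?_⟩
    · exact Metric.mem_thickening_iff.1 hth
    · simp only [mem_iUnion]
      exact ⟨T, hT, hu⟩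
  rw [hn] at hmem
  exact hmem

variable (M)

/-- The definition of `U` gives approximation pointwise; a finite cover of the bounded part of `U`,
which is closed, makes it uniform. -/
lemma eventually_exists_mem_UT (R : ℝ) {κ : ℝ} (hκ : 0 < κ) :
    ∀ᶠ T in atTop, ∀ v ∈ M.U, ‖v‖ ≤ R → ∃ u ∈ M.UT T, dist v u < κ := by
  have hK : IsCompact (M.U ∩ Metric.closedBall 0 R) :=
    (isCompact_closedBall _ _).inter_left M.isClosed_U
  have key : ∀ᶠ T in atTop, ∀ v ∈ M.U ∩ Metric.closedBall 0 R, ∃ u ∈ M.UT T, dist v u < κ := by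
    refine hK.induction_on (p := fun s => ∀ᶠ T in atTop, ∀ v ∈ s, ∃ u ∈ M.UT T, dist v u < κ)
      (by simp) (fun s t hst ht => ht.mono fun T h v hv => h v (hst hv)) ?_ ?_
    · intro s t hs ht
      filter_upwards [hs, ht] with T h1 h2 v hv
      exact hv.elim (h1 v) (h2 v)
    · intro v hv
      obtain ⟨n, -, hn⟩ := M.mem_U_iff.1 hv.1 (κ / 2) (half_pos hκ)
      refine ⟨Metric.ball v (κ / 2), mem_nhdsWithin_of_mem_nhds (Metric.ball_mem_nhds _ (half_pos hκ)), ?_⟩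
      filter_upwards [M.eventually_le_time n] with T hT v' hv'
      obtain ⟨u, hu, hvu⟩ := Metric.mem_thickening_iff.1 (hn T hT)
      refine ⟨u, hu, (dist_triangle v' v u).trans_lt ?_⟩
      have := Metric.mem_ball.1 hv'
      linarith
  filter_upwards [key] with T h v hv hR
  exact h v ⟨hv, by simpa using hR⟩

end PenalizedModel

/-! ### Consistency -/

lemma tendsto_probFilter_of_tendstoInMeasure {Ω ι : Type*} {mΩ : MeasurableSpace Ω} {P : Measure Ω}
    {l : Filter ι} {f : ι → Ω → ℝ} (h : TendstoInMeasure P f l fun _ => 0) :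
    Tendsto (fun x : ι × Ω => f x.1 x.2) (probFilter P l) (𝓝 0) := by
  rw [Metric.tendsto_nhds]
  intro ε hε
  rw [eventually_probFilter_iff]
  refine (h (ENNReal.ofReal ε) (ENNReal.ofReal_pos.2 hε)).congr fun T => ?_
  congr 1
  ext ω
  simp only [mem_ofPred_eq, not_lt, edist_dist, ENNReal.ofReal_le_ofReal_iff dist_nonneg]

namespace PenalizedModel

variable {Ω : Type*} {mΩ : MeasurableSpace Ω} {P : Measure Ω} {p q : ℕ} (M : PenalizedModel P p q)

/-- The penalized quasi-log likelihood `H_T(·, τhat_T)`, relative to its value at `θ*`. -/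
def gain (T : M.𝕋) (ω : Ω) (θ : Vec p) : ℝ :=
  M.qll T ω θ (M.τhat T ω) - M.qll T ω M.θs (M.τhat T ω) -
    ∑ j ∈ M.J, M.ξ j T ω * (M.pen j (θ j) - M.pen j (M.θs j))

/-- The filter of the events of probability tending to one. -/
abbrev whp : Filter (M.𝕋 × Ω) := probFilter P atTop

lemma gain_θs (T : M.𝕋) (ω : Ω) : M.gain T ω M.θs = 0 := by simp [gain]

lemma eventually_gain_le {ε : ℝ} (hε : 0 < ε) :
    ∀ᶠ x in M.whp, ∀ θ ∈ M.Θ, M.gain x.1 x.2 θ ≤ M.gain x.1 x.2 (M.θhat x.1 x.2) + ε := by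
  rw [eventually_probFilter_iff]
  refine (M.θhat_maximizes ε hε).congr fun T => ?_
  congr 1
  ext ω
  simp only [mem_ofPred_eq, not_forall, not_le, exists_prop, gain, mul_sub, Finset.sum_sub_distrib]
  refine exists_congr fun θ => and_congr_right fun _ => ?_
  constructor <;> intro h <;> linarith

lemma sum_J_eq (f : Fin p → ℝ) : ∑ j ∈ M.J, f j = ∑ i ∈ M.J₁, f i + ∑ k ∈ M.J₀, f k := by
  rw [J₁, J₀, add_comm]
  exact (Finset.sum_filter_add_sum_filter_not M.J (fun j => M.θs j = 0) f).symm

variable {M}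

lemma mem_J₁ {i : Fin p} : i ∈ M.J₁ ↔ i ∈ M.J ∧ M.θs i ≠ 0 := by simp [J₁]

lemma mem_J₀ {i : Fin p} : i ∈ M.J₀ ↔ i ∈ M.J ∧ M.θs i = 0 := by simp [J₀]

variable (M)

lemma inv_𝔟_le [NeZero p] (T : M.𝕋) : 0 < M.𝔟 T ∧ (M.𝔟 T)⁻¹ ≤ ∑ j, M.𝔞 j T ^ 2 := by
  have hpos : 0 < ∑ j, M.𝔞 j T ^ 2 :=
    Finset.sum_pos (fun j _ => pow_pos (M.𝔞_pos j T) 2) Finset.univ_nonempty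
  have h : (∑ j, M.𝔞 j T ^ 2)⁻¹ ≤ M.𝔟 T := le_ciInf fun j => by
    refine inv_anti₀ (pow_pos (M.𝔞_pos j T) 2) ?_
    exact Finset.single_le_sum (f := fun j => M.𝔞 j T ^ 2) (fun j _ => sq_nonneg _)
      (Finset.mem_univ j)
  have h𝔟 : 0 < M.𝔟 T := (inv_pos.2 hpos).trans_le h
  exact ⟨h𝔟, inv_le_of_inv_le₀ hpos h⟩

lemma tendsto_inv_𝔟 [NeZero p] : Tendsto (fun T => (M.𝔟 T)⁻¹) atTop (𝓝 0) := by
  have h : Tendsto (fun T => ∑ j, M.𝔞 j T ^ 2) atTop (𝓝 0) := by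
    simpa using tendsto_finsetSum Finset.univ fun j _ => (M.𝔞_tendsto j).pow 2
  exact squeeze_zero (fun T => (inv_pos.2 (M.inv_𝔟_le T).1).le) (fun T => (M.inv_𝔟_le T).2) h

lemma a_pos (T : M.𝕋) (j : Fin p) : 0 < M.a T j := by
  rw [a]
  split_ifs
  · exact Real.rpow_pos_of_pos (M.𝔞_pos j T) _
  · exact M.𝔞_pos j T

lemma tendsto_a (j : Fin p) : Tendsto (fun T => M.a T j) atTop (𝓝 0) := by
  simp only [a]
  split_ifs with h
  · have hρ : 0 < M.ρ j := one_pos.trans_le (M.one_le_ρ j (mem_J₀.1 h).1 (mem_J₀.1 h).2)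
    have := (M.𝔞_tendsto j).rpow_const (p := M.ρ j) (Or.inr hρ.le)
    rwa [Real.zero_rpow hρ.ne'] at this
  · exact M.𝔞_tendsto j

/-- On `J₀` the ratio is `𝔞 ^ (ρ - 1)`, which vanishes in the limit unless the exponent is zero. -/
lemma tendsto_ratio (j : Fin p) : Tendsto (fun T => M.a T j / M.𝔞 j T) atTop (𝓝 (M.b j)) := by
  have h1 : ∀ T, M.𝔞 j T / M.𝔞 j T = 1 := fun T => div_self (M.𝔞_pos j T).ne'
  simp only [a, b]
  split_ifs with h hρ
  · simp only [hρ, Real.rpow_one, h1, tendsto_const_nhds]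
  · have hρ1 : 0 < M.ρ j - 1 := sub_pos.2 <|
      (M.one_le_ρ j (mem_J₀.1 h).1 (mem_J₀.1 h).2).lt_of_ne (Ne.symm hρ)
    have := (M.𝔞_tendsto j).rpow_const (p := M.ρ j - 1) (Or.inr hρ1.le)
    rw [Real.zero_rpow hρ1.ne'] at this
    refine this.congr fun T => ?_
    rw [Real.rpow_sub_one (M.𝔞_pos j T).ne']
  · simp only [h1, tendsto_const_nhds]

lemma θs_add_uhat (T : M.𝕋) (ω : Ω) : M.θs + diagMul (M.a T) (M.uhat T ω) = M.θhat T ω := by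
  ext j
  simp [uhat, mul_inv_cancel_left₀ (M.a_pos T j).ne']

lemma uhat_mem_UT (T : M.𝕋) (ω : Ω) : M.uhat T ω ∈ M.UT T := by
  change _ ∈ M.Θ
  rw [θs_add_uhat]
  exact M.θhat_mem T ω

lemma measurable_uhat (T : M.𝕋) : Measurable (M.uhat T) :=
  (continuous_diagMul _).measurable.comp ((M.θhat_measurable T).sub_const _)

lemma θs_mem_closure : M.θs ∈ closure M.N := by
  obtain ⟨δ, hδ, h⟩ := M.N_near
  exact h ⟨M.θs_mem, Metric.mem_ball_self hδ⟩

variable {M}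

/-- Consistency of the estimator. -/
lemma C1.eventually_norm_lt [IsProbabilityMeasure P] [NeZero p] (hC1 : M.C1) (hC4 : M.C4) {δ : ℝ}
    (hδ : 0 < δ) : ∀ᶠ x in M.whp, ‖M.θhat x.1 x.2 - M.θs‖ < δ := by
  refine eventually_probFilter_of_forall_pos fun η hη => ?_
  have hK : IsCompact (M.Θ \ Metric.ball M.θs δ) := M.Θ_compact.diff Metric.isOpen_ball
  obtain ⟨κ, hκ, hPκ⟩ := exists_pos_measure_lt_le (P := P) hK (X := fun ω θ => -M.𝒴 ω θ)
    ⟨fun θ hθ => (M.𝒴_field.1 θ hθ.1).neg, fun ω => ((M.𝒴_field.2 ω).mono sdiff_subset).neg⟩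
    (hC1.2.mono fun ω hω θ hθ => neg_pos.2 (hω θ hθ.1 fun h => hθ.2 (by simp [h, hδ]))) hη
  refine ⟨{x | ∀ θ ∈ M.Θ \ Metric.ball M.θs δ, κ ≤ -M.𝒴 x.2 θ}, Eventually.of_forall fun T => hPκ, ?_⟩
  have hlim : Tendsto (fun x : M.𝕋 × Ω => (M.𝔟 x.1)⁻¹ +
      ∑ i ∈ M.J₁, M.ξ i x.1 x.2 * (M.𝔟 x.1)⁻¹ * M.pen i (M.θs i)) M.whp (𝓝 0) := by
    have h1 := M.tendsto_inv_𝔟.comp (tendsto_fst_probFilter (P := P))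
    have h2 := tendsto_finsetSum M.J₁ fun i hi =>
      (tendsto_probFilter_of_tendstoInMeasure (hC4 i hi)).mul_const (M.pen i (M.θs i))
    simpa using h1.add h2
  rw [eventually_inf_principal]
  filter_upwards [hC1.1.eventually (by positivity : 0 < κ / 4),
    hlim.eventually (gt_mem_nhds (by positivity : 0 < κ / 4)), M.eventually_gain_le one_pos]
    with x h1 h2 h3 hS
  by_contra hcon
  have hθ : M.θhat x.1 x.2 ∈ M.Θ \ Metric.ball M.θs δ :=
    ⟨M.θhat_mem _ _, fun h => hcon (by rwa [← dist_eq_norm])⟩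
  have h4 : κ ≤ -M.𝒴 x.2 (M.θhat x.1 x.2) := hS _ hθ
  have h5 := (abs_le.1 (h1 (M.θhat x.1 x.2, M.τhat x.1 x.2) ⟨hθ.1, M.τhat_mem _ _⟩)).2
  have h6 := h3 M.θs M.θs_mem
  rw [gain_θs] at h6
  obtain ⟨h𝔟, -⟩ := M.inv_𝔟_le x.1
  -- Penalties on `J₀` vanish at the true value, so they can only count against the estimator and
  -- are dropped without any control of their weights.
  have h7 : -(∑ i ∈ M.J₁, M.ξ i x.1 x.2 * M.pen i (M.θs i)) ≤
      ∑ j ∈ M.J, M.ξ j x.1 x.2 * (M.pen j (M.θhat x.1 x.2 j) - M.pen j (M.θs j)) := by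
    rw [sum_J_eq, ← Finset.sum_neg_distrib]
    have h8 : 0 ≤ ∑ k ∈ M.J₀, M.ξ k x.1 x.2 * (M.pen k (M.θhat x.1 x.2 k) - M.pen k (M.θs k)) := by
      refine Finset.sum_nonneg fun k hk => mul_nonneg (M.ξ_nonneg k (mem_J₀.1 hk).1 _ _) ?_
      rw [(mem_J₀.1 hk).2, (M.pen_eq_zero_iff k (mem_J₀.1 hk).1 0).2 rfl, sub_zero]
      exact M.pen_nonneg k (mem_J₀.1 hk).1 _
    have h9 : ∑ i ∈ M.J₁, -(M.ξ i x.1 x.2 * M.pen i (M.θs i)) ≤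
        ∑ i ∈ M.J₁, M.ξ i x.1 x.2 * (M.pen i (M.θhat x.1 x.2 i) - M.pen i (M.θs i)) := by
      refine Finset.sum_le_sum fun i hi => ?_
      have := mul_nonneg (M.ξ_nonneg i (mem_J₁.1 hi).1 x.1 x.2)
        (M.pen_nonneg i (mem_J₁.1 hi).1 (M.θhat x.1 x.2 i))
      linarith
    linarith
  have h10 : M.qll x.1 x.2 (M.θhat x.1 x.2) (M.τhat x.1 x.2) -
      M.qll x.1 x.2 M.θs (M.τhat x.1 x.2) =
      M.𝔟 x.1 * M.𝒴T x.1 x.2 (M.θhat x.1 x.2) (M.τhat x.1 x.2) := by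
    rw [𝒴T, mul_inv_cancel_left₀ h𝔟.ne']
  have h11 : M.𝔟 x.1 * ((M.𝔟 x.1)⁻¹ +
      ∑ i ∈ M.J₁, M.ξ i x.1 x.2 * (M.𝔟 x.1)⁻¹ * M.pen i (M.θs i)) =
      1 + ∑ i ∈ M.J₁, M.ξ i x.1 x.2 * M.pen i (M.θs i) := by
    rw [mul_add, mul_inv_cancel₀ h𝔟.ne', Finset.mul_sum]
    congr 1
    refine Finset.sum_congr rfl fun i _ => ?_
    field_simp
  rw [gain, h10] at h6
  have h12 := mul_lt_mul_of_pos_left h2 h𝔟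
  rw [h11] at h12
  have h13 : M.𝔟 x.1 * M.𝒴T x.1 x.2 (M.θhat x.1 x.2) (M.τhat x.1 x.2) ≤ M.𝔟 x.1 * (-(3 * κ / 4)) :=
    mul_le_mul_of_nonneg_left (by simp only at h5; linarith) h𝔟.le
  have h14 : 0 < M.𝔟 x.1 * κ := mul_pos h𝔟 hκ
  linarith

end PenalizedModel

/-! ### Random coefficients and local expansion of the gain -/

namespace PenalizedModel

variable {Ω : Type*} {mΩ : MeasurableSpace Ω} {P : Measure Ω} {p q : ℕ} (M : PenalizedModel P p q)

/-- The values of the random coefficients of the limit field `ℤ`, other than `Γ(θ*)`. -/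
abbrev Coeff : Type := Vec p × (M.J₁ → ℝ) × (M.J₀ → ℝ)

/-- The random coefficients of the field `𝕍_T`, with the score taken at `τ`. -/
noncomputable def coeffT (τ : Vec q) (T : M.𝕋) (ω : Ω) : M.Coeff :=
  (M.ΔT T ω τ, fun i => M.𝔞 i T * M.ξ i T ω, fun k => (M.𝔞 k T) ^ (M.qexp k * M.ρ k) * M.ξ k T ω)

/-- The random coefficients of the field `ℤ`. -/
def coeffLim (ω : Ω) : M.Coeff := (M.Δ ω, fun i => M.c i ω, fun k => M.d k ω)

/-- The random matrix `Γ(θ*)`, as a function of two indices. -/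
def Γfun (ω : Ω) : Fin p → Fin p → ℝ := fun i j => M.Γ ω i j

/-- The logarithm of `ℤ(u)` as a function of the coefficients. -/
noncomputable def logZ (x : M.Coeff) (γ : Fin p → Fin p → ℝ) (u : Vec p) : ℝ :=
  inner ℝ x.1 (diagMul M.b u) - (1 / 2) * quadForm (Matrix.of γ) (diagMul M.b u)
    - ∑ i : M.J₁, x.2.1 i * deriv (M.pen i) (M.θs i) * u i
    - ∑ k : M.J₀, x.2.2 k * |u k| ^ M.qexp k

lemma Z_eq (ω : Ω) (u : Vec p) : M.Z ω u = Real.exp (M.logZ (M.coeffLim ω) (M.Γfun ω) u) := by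
  rw [Z, logZ, ← Finset.sum_coe_sort M.J₁, ← Finset.sum_coe_sort M.J₀]
  rfl

lemma V_eq (T : M.𝕋) (ω : Ω) (u : Vec p) :
    M.V T ω u = Real.exp (M.logZ (M.coeffT (M.τhat T ω) T ω) (M.Γfun ω) u) := by
  rw [V, logZ, ← Finset.sum_coe_sort M.J₁, ← Finset.sum_coe_sort M.J₀]
  rfl

variable {M} in
lemma continuous_logZ {α : Type*} [TopologicalSpace α] {x : α → M.Coeff}
    {γ : α → Fin p → Fin p → ℝ} {u : α → Vec p} (hx : Continuous x) (hγ : Continuous γ)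
    (hu : Continuous u) : Continuous fun z => M.logZ (x z) (γ z) (u z) := by
  have hb : Continuous fun z => diagMul M.b (u z) := (continuous_diagMul _).comp hu
  have hq : Continuous fun z => quadForm (Matrix.of (γ z)) (diagMul M.b (u z)) := by
    simp only [quadForm, Matrix.of_apply, diagMul_apply]
    fun_prop
  unfold logZ
  refine (((hx.fst.inner hb).sub (continuous_const.mul hq)).sub (by fun_prop)).sub ?_
  refine continuous_finsetSum _ fun k _ => Continuous.mul (by fun_prop) ?_
  refine Continuous.rpow_const (by fun_prop) fun z => Or.inr ?_
  exact (M.qexp_pos k (mem_J₀.1 k.2).1).le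

/-- The quadratic approximation of the gain at `θ* + a_T u`. -/
noncomputable def localGain (T : M.𝕋) (ω : Ω) (u : Vec p) : ℝ :=
  inner ℝ (M.ΔT T ω (M.τhat T ω)) (diagMul (fun j => M.a T j / M.𝔞 j T) u)
    - (1 / 2) * quadForm (M.Γ ω) (diagMul (fun j => M.a T j / M.𝔞 j T) u)
    - ∑ i ∈ M.J₁, M.𝔞 i T * M.ξ i T ω * deriv (M.pen i) (M.θs i) * u i
    - ∑ k ∈ M.J₀, (M.𝔞 k T) ^ (M.qexp k * M.ρ k) * M.ξ k T ω * |u k| ^ M.qexp k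

lemma a_eq_of_mem_J₁ {i : Fin p} (hi : i ∈ M.J₁) (T : M.𝕋) : M.a T i = M.𝔞 i T :=
  if_neg fun h => (mem_J₁.1 hi).2 (mem_J₀.1 h).2

lemma eventually_abs_pen_sub_le {i : Fin p} (hi : i ∈ M.J₁) {δ : M.𝕋 → ℝ}
    (hδ : Tendsto δ atTop (𝓝 0)) {κ : ℝ} (hκ : 0 < κ) :
    ∀ᶠ T in atTop, ∀ h : ℝ, |h| < δ T →
      |M.pen i (M.θs i + h) - M.pen i (M.θs i) - deriv (M.pen i) (M.θs i) * h| ≤ κ * |h| := by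
  have hd : HasDerivAt (M.pen i) (deriv (M.pen i) (M.θs i)) (M.θs i) :=
    ((((M.pen_C1 i (mem_J₁.1 hi).1).contDiffAt
      (isOpen_compl_singleton.mem_nhds (mem_J₁.1 hi).2)).differentiableAt (by norm_num)).hasDerivAt)
  have hlo := (hasDerivAt_iff_isLittleO_nhds_zero.1 hd).def hκ
  obtain ⟨δ₀, hδ₀, hball⟩ := Metric.eventually_nhds_iff.1 hlo
  filter_upwards [hδ.eventually (gt_mem_nhds hδ₀)] with T hT h hh
  have := hball (y := h) (by simpa using hh.trans hT)
  simpa [mul_comm] using this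

lemma eventually_pen_eq {k : Fin p} (hk : k ∈ M.J₀) {δ : M.𝕋 → ℝ}
    (hδ : Tendsto δ atTop (𝓝 0)) :
    ∀ᶠ T in atTop, ∀ h : ℝ, |h| < δ T → M.pen k h = |h| ^ M.qexp k := by
  obtain ⟨δ₀, hδ₀, h₀⟩ := M.pen_near_zero k (mem_J₀.1 hk).1
  filter_upwards [hδ.eventually (gt_mem_nhds hδ₀)] with T hT h hh
  exact h₀ h (abs_le.1 (hh.trans hT).le)

variable {M}

/-- The likelihood contributes the Taylor remainder in `w`, and the `J₁` penalties the linearization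
error of functions differentiable at a nonzero point. The `J₀` penalties are exact powers near zero
and contribute no error. -/
lemma C2.eventually_abs_gain_sub_le (hC2 : M.C2) {δ : M.𝕋 → ℝ} (hδ0 : ∀ T, 0 < δ T)
    (hδ : Tendsto δ atTop (𝓝 0)) {κ : ℝ} (hκ : 0 < κ) :
    ∀ᶠ x in M.whp, ∀ u ∈ M.UT x.1, ‖diagMul (M.a x.1) u‖ < δ x.1 →
      |M.gain x.1 x.2 (M.θs + diagMul (M.a x.1) u) - M.localGain x.1 x.2 u| ≤
        κ * ‖diagMul (fun j => M.a x.1 j / M.𝔞 j x.1) u‖ ^ 2 +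
          κ * ∑ i ∈ M.J₁, M.𝔞 i x.1 * M.ξ i x.1 x.2 * |u i| := by
  obtain ⟨δ₀, hδ₀, hnear⟩ := M.N_near
  have hfst : Tendsto Prod.fst M.whp atTop := tendsto_fst_probFilter
  filter_upwards [(hC2.2 δ hδ0 hδ).eventually hκ,
    hfst.eventually (hδ.eventually (gt_mem_nhds hδ₀)),
    hfst.eventually ((Finset.eventually_all M.J₁).2 fun i hi => M.eventually_abs_pen_sub_le hi hδ hκ),
    hfst.eventually ((Finset.eventually_all M.J₀).2 fun k hk => M.eventually_pen_eq hk hδ)]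
    with x hhess hTδ hJ₁ hJ₀ u hu hlt
  obtain ⟨T, ω⟩ := x
  set w := diagMul (fun j => M.a T j / M.𝔞 j T) u with hw
  have haw : diagMul (fun j => M.𝔞 j T) w = diagMul (M.a T) u := by
    ext j
    simp only [hw, diagMul_apply, ← mul_assoc, mul_div_cancel₀ _ (M.𝔞_pos j T).ne']
  have hcl : M.θs + diagMul (M.a T) u ∈ closure M.N := by
    refine hnear ⟨hu, ?_⟩
    rw [Metric.mem_ball, dist_eq_norm, add_sub_cancel_left]
    exact hlt.trans hTδ
  have htaylor := (M.qll_C2 T ω _ (M.τhat_mem T ω)).abs_taylor_le_of_mem_closure M.N_open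
    M.θs_mem_closure M.N_star (fun j => (M.𝔞_pos j T).ne') (G := M.Γ ω) (δ := δ T) (ε := κ)
    (fun y hy hyδ => by
      have := hhess (y, M.τhat T ω) ⟨subset_closure hy, M.τhat_mem T ω, hyδ⟩
      rwa [abs_of_nonneg (matNorm_nonneg _)] at this)
    (w := w) (by rw [haw]; exact hcl) (by rw [haw]; exact hlt)
  rw [haw] at htaylor
  have hcoord : ∀ j, |M.a T j * u j| < δ T := fun j =>
    (abs_coord_le_norm (diagMul (M.a T) u) j).trans_lt hlt
  have h1 : |∑ i ∈ M.J₁, M.ξ i T ω * (M.pen i (M.θs i + M.a T i * u i) - M.pen i (M.θs i)) -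
      ∑ i ∈ M.J₁, M.𝔞 i T * M.ξ i T ω * deriv (M.pen i) (M.θs i) * u i| ≤
      κ * ∑ i ∈ M.J₁, M.𝔞 i T * M.ξ i T ω * |u i| := by
    rw [← Finset.sum_sub_distrib, Finset.mul_sum]
    refine (Finset.abs_sum_le_sum_abs _ _).trans (Finset.sum_le_sum fun i hi => ?_)
    have h2 := mul_le_mul_of_nonneg_left (hJ₁ i hi _ (hcoord i))
      (M.ξ_nonneg i (mem_J₁.1 hi).1 T ω)
    rw [M.a_eq_of_mem_J₁ hi, abs_mul, abs_of_pos (M.𝔞_pos i T)] at h2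
    rw [← abs_of_nonneg (M.ξ_nonneg i (mem_J₁.1 hi).1 T ω), ← abs_mul,
      abs_of_nonneg (M.ξ_nonneg i (mem_J₁.1 hi).1 T ω)] at h2
    rw [M.a_eq_of_mem_J₁ hi]
    convert h2 using 1
    · congr 1; ring
    · ring
  have h2 : ∑ k ∈ M.J₀, M.ξ k T ω * (M.pen k (M.θs k + M.a T k * u k) - M.pen k (M.θs k)) =
      ∑ k ∈ M.J₀, (M.𝔞 k T) ^ (M.qexp k * M.ρ k) * M.ξ k T ω * |u k| ^ M.qexp k := by
    refine Finset.sum_congr rfl fun k hk => ?_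
    rw [(mem_J₀.1 hk).2, (M.pen_eq_zero_iff k (mem_J₀.1 hk).1 0).2 rfl, zero_add, sub_zero,
      hJ₀ k hk _ (hcoord k), abs_mul, abs_of_pos (M.a_pos T k),
      Real.mul_rpow (M.a_pos T k).le (abs_nonneg _), a, if_pos hk,
      ← Real.rpow_mul (M.𝔞_pos k T).le, mul_comm (M.ρ k)]
    ring
  have h3 : M.gain T ω (M.θs + diagMul (M.a T) u) - M.localGain T ω u =
      (M.qll T ω (M.θs + diagMul (M.a T) u) (M.τhat T ω) - M.qll T ω M.θs (M.τhat T ω) -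
        inner ℝ (M.ΔT T ω (M.τhat T ω)) w + 1 / 2 * quadForm (M.Γ ω) w) -
      (∑ i ∈ M.J₁, M.ξ i T ω * (M.pen i (M.θs i + M.a T i * u i) - M.pen i (M.θs i)) -
      ∑ i ∈ M.J₁, M.𝔞 i T * M.ξ i T ω * deriv (M.pen i) (M.θs i) * u i) := by
    simp only [gain, localGain, sum_J_eq, PiLp.add_apply, diagMul_apply, h2]
    ring
  rw [h3]
  exact (abs_sub _ _).trans (add_le_add htaylor h1)

/-- The event that the random coefficients are bounded, and that those which have to be positive
are bounded away from zero. -/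
def good (M : PenalizedModel P p q) (τ₀ : Vec q) (m R : ℝ) : Set (M.𝕋 × Ω) :=
  {x | ‖M.coeffT τ₀ x.1 x.2‖ ≤ R ∧
    (∀ k ∈ M.J₀, 1 < M.ρ k → m ≤ (M.𝔞 k x.1) ^ (M.qexp k * M.ρ k) * M.ξ k x.1 x.2) ∧
    (∀ w, m * ‖w‖ ^ 2 ≤ quadForm (M.Γ x.2) w) ∧ ‖M.Γfun x.2‖ ≤ R}

lemma quadForm_pos {n : ℕ} {A : Matrix (Fin n) (Fin n) ℝ} (hA : A.PosDef) {u : Vec n}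
    (hu : u ≠ 0) : 0 < quadForm A u := by
  have h : quadForm A u = star u.ofLp ⬝ᵥ (A *ᵥ u.ofLp) := by
    simp only [quadForm, dotProduct, Matrix.mulVec, Finset.mul_sum, Pi.star_apply, star_trivial]
    exact Finset.sum_congr rfl fun i _ => Finset.sum_congr rfl fun j _ => by ring
  rw [h]
  exact hA.dotProduct_mulVec_pos (by simpa using hu)

lemma measurable_Γfun : Measurable[M.𝒢] M.Γfun :=
  @measurable_pi_lambda _ _ _ M.𝒢 _ _ fun i => @measurable_pi_lambda _ _ _ M.𝒢 _ _ fun j =>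
    M.Γ_measurable i j

/-- Each requirement is almost surely met by the limiting coefficients or by `Γ`. Stable convergence
carries the former over to `coeffT`; the latter does not depend on `T`. -/
lemma exists_good [IsProbabilityMeasure P] (hC3 : M.C3) (hC5 : M.C5) {τ₀ : Vec q}
    (hstab : StablyConverges P M.𝒢 atTop (M.coeffT τ₀) M.coeffLim) {η : ℝ} (hη : 0 < η) :
    ∃ m R : ℝ, 0 < m ∧ 0 < R ∧ ∀ᶠ T in atTop, P {ω | (T, ω) ∉ M.good τ₀ m R} ≤ ENNReal.ofReal η := by
  have hη4 : 0 < η / 4 := by positivity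
  obtain ⟨κ₁, hκ₁, h₁⟩ := hstab.exists_pos_measure_lt_le (G := fun x => (1 + ‖x‖)⁻¹)
    (Continuous.inv₀ (by fun_prop) fun x => by positivity)
    (ae_of_all _ fun ω => by positivity) hη4
  -- Truncating the factors at one makes a lower bound for the product a lower bound for every
  -- factor, so all positivity requirements form one continuous functional.
  let G : M.Coeff → ℝ := fun x => ∏ k : M.J₀, if 1 < M.ρ k then min (x.2.2 k) 1 else 1
  have hG : Continuous G := by
    refine continuous_finsetProd _ fun k _ => ?_
    split_ifs <;> fun_prop
  have hGpos : ∀ᵐ ω ∂P, 0 < G (M.coeffLim ω) := by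
    have : ∀ᵐ ω ∂P, ∀ k ∈ M.J₀, 1 < M.ρ k → 0 < M.d k ω := by
      rw [Finset.eventually_all]
      intro k hk
      by_cases hρ : 1 < M.ρ k
      · filter_upwards [hC5 k hk hρ] with ω hω _ using hω
      · exact ae_of_all _ fun ω h => absurd h hρ
    filter_upwards [this] with ω hω
    refine Finset.prod_pos fun k _ => ?_
    split_ifs with hρ
    · exact lt_min (hω k k.2 hρ) one_pos
    · exact one_pos
  obtain ⟨κ₂, hκ₂, h₂⟩ := hstab.exists_pos_measure_lt_le hG hGpos hη4
  have hΓm : ∀ i j, Measurable fun ω => M.Γ ω i j := fun i j => (M.Γ_measurable i j).mono M.𝒢_le le_rfl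
  -- Positivity on the unit sphere, made uniform by compactness, gives the ellipticity constant by
  -- homogeneity.
  obtain ⟨κ₃, hκ₃, h₃⟩ := exists_pos_measure_lt_le (P := P) (isCompact_sphere (0 : Vec p) 1)
    (X := fun ω w => quadForm (M.Γ ω) w)
    ⟨fun w _ => Finset.measurable_sum _ fun i _ => Finset.measurable_sum _ fun j _ =>
      ((hΓm i j).mul_const _).mul_const _, fun ω => (continuous_quadForm _).continuousOn⟩
    (hC3.mono fun ω hω w hw => quadForm_pos hω (ne_zero_of_mem_unit_sphere ⟨w, hw⟩)) hη4
  obtain ⟨R₄, hR₄, h₄⟩ := exists_measure_norm_gt_le (P := P)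
    (M.measurable_Γfun.mono M.𝒢_le le_rfl) hη4
  refine ⟨min κ₂ κ₃, max κ₁⁻¹ R₄, lt_min hκ₂ hκ₃, lt_max_of_lt_right hR₄, ?_⟩
  filter_upwards [h₁, h₂] with T h₁ h₂
  have hsum : ENNReal.ofReal η = ENNReal.ofReal (η / 4) + ENNReal.ofReal (η / 4) +
      ENNReal.ofReal (η / 4) + ENNReal.ofReal (η / 4) := by
    rw [← ENNReal.ofReal_add hη4.le hη4.le, ← ENNReal.ofReal_add (by positivity) hη4.le,
      ← ENNReal.ofReal_add (by positivity) hη4.le]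
    congr 1; ring
  rw [hsum]
  refine (measure_mono ?_).trans ((measure_union_le _ _).trans (add_le_add
    ((measure_union_le _ _).trans (add_le_add ((measure_union_le _ _).trans
      (add_le_add h₁ h₂)) h₃)) h₄))
  intro ω hω
  by_contra hcon
  simp only [mem_union, mem_ofPred_eq, not_or, not_not] at hcon
  obtain ⟨⟨⟨c₁, c₂⟩, c₃⟩, c₄⟩ := hcon
  refine hω ⟨?_, fun k hk hρ => ?_, fun w => ?_, c₄.trans (le_max_right _ _)⟩
  · have := (le_inv_comm₀ hκ₁ (by positivity)).1 c₁
    refine le_trans ?_ (le_max_left _ _)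
    linarith
  · have hf : ∀ k : M.J₀, 0 ≤ (if 1 < M.ρ k then min ((M.coeffT τ₀ T ω).2.2 k) 1 else 1) ∧
        (if 1 < M.ρ k then min ((M.coeffT τ₀ T ω).2.2 k) 1 else 1) ≤ 1 := by
      intro k
      split_ifs
      · exact ⟨le_min (mul_nonneg (Real.rpow_nonneg (M.𝔞_pos k T).le _)
          (M.ξ_nonneg k (mem_J₀.1 k.2).1 T ω)) zero_le_one, min_le_right _ _⟩
      · exact ⟨zero_le_one, le_rfl⟩
    have hle : G (M.coeffT τ₀ T ω) ≤ min ((M.coeffT τ₀ T ω).2.2 ⟨k, hk⟩) 1 := by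
      change ∏ k : M.J₀, _ ≤ _
      rw [← Finset.mul_prod_erase _ _ (Finset.mem_univ (⟨k, hk⟩ : M.J₀)), if_pos hρ]
      refine mul_le_of_le_one_right ?_
        (Finset.prod_le_one (fun k _ => (hf k).1) fun k _ => (hf k).2)
      have := (hf ⟨k, hk⟩).1
      rwa [if_pos hρ] at this
    exact (min_le_left _ _).trans (c₂.trans (hle.trans (min_le_left _ _)))
  · rcases eq_or_ne w 0 with rfl | hw
    · simp [quadForm]
    · have hw' : 0 < ‖w‖ := norm_pos_iff.2 hw
      have h5 := c₃ (‖w‖⁻¹ • w) (by simp [norm_smul, hw'.ne'])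
      rw [quadForm_smul, inv_pow, ← div_eq_inv_mul, le_div_iff₀ (by positivity)] at h5
      exact (mul_le_mul_of_nonneg_right (min_le_right _ _) (by positivity)).trans h5

end PenalizedModel

/-! ### Boundedness of the normalized error and approximation of the gain -/

namespace PenalizedModel

variable {Ω : Type*} {mΩ : MeasurableSpace Ω} {P : Measure Ω} {p q : ℕ} {M : PenalizedModel P p q}
  {τ₀ : Vec q} {m R : ℝ}

lemma ratio_eq_one (T : M.𝕋) {j : Fin p} (hj : j ∈ M.J₀ → ¬ 1 < M.ρ j) :
    M.a T j / M.𝔞 j T = 1 := by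
  rw [a]
  split_ifs with h
  · have : M.ρ j = 1 := le_antisymm (not_lt.1 (hj h))
      (M.one_le_ρ j (mem_J₀.1 h).1 (mem_J₀.1 h).2)
    rw [this, Real.rpow_one, div_self (M.𝔞_pos j T).ne']
  · exact div_self (M.𝔞_pos j T).ne'

lemma sum_a_pos [NeZero p] (T : M.𝕋) : 0 < ∑ j, M.a T j :=
  Finset.sum_pos (fun j _ => M.a_pos T j) Finset.univ_nonempty

lemma tendsto_sum_a : Tendsto (fun T => ∑ j, M.a T j) atTop (𝓝 0) := by
  simpa using tendsto_finsetSum Finset.univ fun j _ => M.tendsto_a j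

lemma score_weight_le_of_mem_good {x : M.𝕋 × Ω} (hx : x ∈ M.good τ₀ m R) {i : Fin p}
    (hi : i ∈ M.J₁) : M.𝔞 i x.1 * M.ξ i x.1 x.2 ≤ R := by
  have h1 : ‖(M.coeffT τ₀ x.1 x.2).2.1 ⟨i, hi⟩‖ ≤ R :=
    (norm_le_pi_norm _ _).trans ((norm_fst_le _).trans ((norm_snd_le _).trans hx.1))
  exact (le_abs_self _).trans h1

lemma weight_nonneg {i : Fin p} (hi : i ∈ M.J) (T : M.𝕋) (ω : Ω) : 0 ≤ M.𝔞 i T * M.ξ i T ω :=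
  mul_nonneg (M.𝔞_pos i T).le (M.ξ_nonneg i hi T ω)

lemma weight_rpow_nonneg {k : Fin p} (hk : k ∈ M.J) (T : M.𝕋) (ω : Ω) (r : ℝ) :
    0 ≤ (M.𝔞 k T) ^ r * M.ξ k T ω :=
  mul_nonneg (Real.rpow_nonneg (M.𝔞_pos k T).le _) (M.ξ_nonneg k hk T ω)

lemma norm_ΔT_le_of_mem_good {x : M.𝕋 × Ω} (hx : x ∈ M.good τ₀ m R) : ‖M.ΔT x.1 x.2 τ₀‖ ≤ R :=
  (norm_fst_le (M.coeffT τ₀ x.1 x.2)).trans hx.1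

lemma sum_weight_mul_abs_le {x : M.𝕋 × Ω} (hx : x ∈ M.good τ₀ m R) (u : Vec p) {B : ℝ}
    (hR : 0 ≤ R) (hu : ∀ i ∈ M.J₁, |u i| ≤ B) :
    ∑ i ∈ M.J₁, M.𝔞 i x.1 * M.ξ i x.1 x.2 * |u i| ≤ M.J₁.card * (R * B) := by
  rw [← nsmul_eq_mul]
  exact Finset.sum_le_card_nsmul _ _ _ fun i hi =>
    mul_le_mul (score_weight_le_of_mem_good hx hi) (hu i hi) (abs_nonneg _) hR

/-- A near maximizer of the gain is bounded in terms of bounds for the random coefficients. -/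
lemma norm_le_of_localGain_ge {x : M.𝕋 × Ω} (hx : x ∈ M.good τ₀ m R) (hm : 0 < m) (hR : 0 < R)
    (hΔ : ‖M.ΔT x.1 x.2 (M.τhat x.1 x.2) - M.ΔT x.1 x.2 τ₀‖ ≤ 1) {u : Vec p} {κ : ℝ}
    (hκ1 : κ ≤ 1) (hκm : κ ≤ m / 4)
    (h : -1 ≤ M.localGain x.1 x.2 u +
      (κ * ‖diagMul (fun j => M.a x.1 j / M.𝔞 j x.1) u‖ ^ 2 +
          κ * ∑ i ∈ M.J₁, M.𝔞 i x.1 * M.ξ i x.1 x.2 * |u i|)) {A W : ℝ}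
    (hA : A = R + 1 + R * ∑ i ∈ M.J₁, |deriv (M.pen i) (M.θs i)| + M.J₁.card * R)
    (hW : W = 4 * (A + 1) / m + 1) :
    ‖u‖ ≤ ∑ j, (W + ((1 + A * W) / m) ^ (M.qexp j)⁻¹) := by
  have hΔ₀ := norm_ΔT_le_of_mem_good hx
  obtain ⟨T, ω⟩ := x
  set w := diagMul (fun j => M.a T j / M.𝔞 j T) u with hw
  have huw : ∀ j, (j ∈ M.J₀ → ¬ 1 < M.ρ j) → u j = w j := fun j hj => by
    rw [hw, diagMul_apply, ratio_eq_one T hj, one_mul]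
  have huw₁ : ∀ i ∈ M.J₁, |u i| ≤ ‖w‖ := fun i hi => by
    rw [huw i fun h => absurd (mem_J₀.1 h).2 (mem_J₁.1 hi).2]
    exact abs_coord_le_norm w i
  have hA0 : 0 ≤ A := by rw [hA]; positivity
  have hW1 : 1 ≤ W := by rw [hW]; have : 0 ≤ 4 * (A + 1) / m := by positivity
                         linarith
  have h1 : inner ℝ (M.ΔT T ω (M.τhat T ω)) w ≤ (R + 1) * ‖w‖ := by
    refine (real_inner_le_norm _ _).trans (mul_le_mul_of_nonneg_right ?_ (norm_nonneg _))
    have := norm_le_norm_add_norm_sub' (M.ΔT T ω (M.τhat T ω)) (M.ΔT T ω τ₀)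
    simp only at hΔ₀ hΔ
    linarith
  have h2 : m * ‖w‖ ^ 2 ≤ quadForm (M.Γ ω) w := hx.2.2.1 w
  have h3 : -(∑ i ∈ M.J₁, M.𝔞 i T * M.ξ i T ω * deriv (M.pen i) (M.θs i) * u i) ≤
      R * (∑ i ∈ M.J₁, |deriv (M.pen i) (M.θs i)|) * ‖w‖ := by
    rw [← Finset.sum_neg_distrib, Finset.mul_sum, Finset.sum_mul]
    refine Finset.sum_le_sum fun i hi => ?_
    refine (neg_le_abs _).trans ?_
    rw [abs_mul, abs_mul, abs_of_nonneg (weight_nonneg (mem_J₁.1 hi).1 T ω)]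
    exact mul_le_mul (mul_le_mul_of_nonneg_right (score_weight_le_of_mem_good hx hi)
      (abs_nonneg _)) (huw₁ i hi) (abs_nonneg _) (by positivity)
  have h4 := sum_weight_mul_abs_le hx u hR.le huw₁
  have h5 : κ * ∑ i ∈ M.J₁, M.𝔞 i T * M.ξ i T ω * |u i| ≤ M.J₁.card * (R * ‖w‖) :=
    (mul_le_of_le_one_left (Finset.sum_nonneg fun i hi =>
      mul_nonneg (weight_nonneg (mem_J₁.1 hi).1 T ω) (abs_nonneg _)) hκ1).trans h4
  have h6 : κ * ‖w‖ ^ 2 ≤ m / 4 * ‖w‖ ^ 2 := mul_le_mul_of_nonneg_right hκm (by positivity)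
  have hD0 : ∀ k ∈ M.J₀, 0 ≤ (M.𝔞 k T) ^ (M.qexp k * M.ρ k) * M.ξ k T ω * |u k| ^ M.qexp k :=
    fun k hk => mul_nonneg (weight_rpow_nonneg (mem_J₀.1 hk).1 T ω _)
      (Real.rpow_nonneg (abs_nonneg _) _)
  -- Half of the curvature `m / 2` absorbs the quadratic error, as `κ ≤ m / 4`; the terms linear in
  -- `‖w‖` are collected in `A`. The penalty is kept on the left for the coordinates that `w` does
  -- not control.
  have h7 : m / 4 * ‖w‖ ^ 2 +
      ∑ k ∈ M.J₀, (M.𝔞 k T) ^ (M.qexp k * M.ρ k) * M.ξ k T ω * |u k| ^ M.qexp k ≤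
      1 + A * ‖w‖ := by
    simp only [localGain, ← hw] at h
    rw [hA]
    nlinarith
  have hwW : ‖w‖ ≤ W := by
    rcases le_total ‖w‖ 1 with hle | hge
    · exact hle.trans hW1
    · have h8 : m / 4 * ‖w‖ ^ 2 ≤ (A + 1) * ‖w‖ := by
        have := Finset.sum_nonneg hD0
        nlinarith
      have h9 : m / 4 * ‖w‖ ≤ A + 1 := by
        refine le_of_mul_le_mul_right ?_ (one_pos.trans_le hge)
        linarith
      have h10 : ‖w‖ ≤ 4 * (A + 1) / m := by
        rw [le_div_iff₀ hm]
        linarith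
      rw [hW]
      linarith
  refine (norm_le_sum_abs u).trans (Finset.sum_le_sum fun j _ => ?_)
  have hAW : 0 ≤ (1 + A * W) / m := by positivity
  -- In the remaining case the scaling ratio is one and `u j = w j`.
  by_cases hj : j ∈ M.J₀ ∧ 1 < M.ρ j
  · obtain ⟨hjJ, hρ⟩ := hj
    have hq := M.qexp_pos j (mem_J₀.1 hjJ).1
    have h8 : m * |u j| ^ M.qexp j ≤ 1 + A * W := by
      have h9 := Finset.single_le_sum hD0 hjJ
      have h10 := mul_le_mul_of_nonneg_right (hx.2.1 j hjJ hρ)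
        (Real.rpow_nonneg (abs_nonneg (u j)) (M.qexp j))
      have h11 : 0 ≤ m / 4 * ‖w‖ ^ 2 := by positivity
      have h12 := mul_le_mul_of_nonneg_left hwW hA0
      simp only at h9 h10
      linarith
    have h9 : |u j| ≤ ((1 + A * W) / m) ^ (M.qexp j)⁻¹ := by
      rw [Real.le_rpow_inv_iff_of_pos (abs_nonneg _) hAW hq, le_div_iff₀ hm]
      linarith
    linarith
  · rw [huw j fun h => fun h' => hj ⟨h, h'⟩]
    have := Real.rpow_nonneg hAW (M.qexp j)⁻¹
    linarith [abs_coord_le_norm w j]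

lemma exists_eventually_norm_uhat_le [IsProbabilityMeasure P] [NeZero p] (hC1 : M.C1) (hC2 : M.C2)
    (hC4 : M.C4)
    (hτ : SupTendstoZero P atTop (fun _ => M.𝒯) fun T ω τ => ‖M.ΔT T ω τ - M.ΔT T ω τ₀‖)
    (hm : 0 < m) (hR : 0 < R) :
    ∃ B : ℝ, ∀ᶠ x in M.whp ⊓ 𝓟 (M.good τ₀ m R), ‖M.uhat x.1 x.2‖ ≤ B := by
  set A : ℝ := R + 1 + R * ∑ i ∈ M.J₁, |deriv (M.pen i) (M.θs i)| + M.J₁.card * R with hA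
  set W : ℝ := 4 * (A + 1) / m + 1 with hW
  refine ⟨∑ j, (W + ((1 + A * W) / m) ^ (M.qexp j)⁻¹), ?_⟩
  rw [eventually_inf_principal]
  -- The sum of the rates serves merely as a positive deterministic null sequence.
  obtain ⟨δ, hδ0, hδ, hlt⟩ := exists_rate_of_probFilter (P := P) (l := atTop)
    (X := fun T ω => ‖M.θhat T ω - M.θs‖) (fun δ hδ => hC1.eventually_norm_lt hC4 hδ)
    sum_a_pos tendsto_sum_a
  have hκ : 0 < min (m / 4) 1 := lt_min (by positivity) one_pos
  filter_upwards [hlt, hC2.eventually_abs_gain_sub_le hδ0 hδ hκ, M.eventually_gain_le one_pos,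
    hτ.eventually one_pos] with x h1 h2 h3 h4 hx
  have h5 := h2 _ (M.uhat_mem_UT x.1 x.2)
  rw [θs_add_uhat] at h5
  have h6 : diagMul (M.a x.1) (M.uhat x.1 x.2) = M.θhat x.1 x.2 - M.θs := by
    rw [← M.θs_add_uhat x.1 x.2]; abel
  rw [h6] at h5
  have h7 := (abs_le.1 (h5 h1)).2
  have h8 := h3 _ M.θs_mem
  rw [gain_θs] at h8
  refine norm_le_of_localGain_ge hx hm hR ?_ (min_le_right _ _) (min_le_left _ _) ?_ hA hW
  · have := h4 _ (M.τhat_mem x.1 x.2)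
    rwa [abs_norm] at this
  · linarith

lemma abs_quadForm_diagMul_sub_le {n : ℕ} (A : Matrix (Fin n) (Fin n) ℝ) (r b : Fin n → ℝ)
    (u : Vec n) {C B : ℝ} (hC : ∀ i j, |A i j| ≤ C) (hC0 : 0 ≤ C) (hB : ‖u‖ ≤ B) :
    |quadForm A (diagMul r u) - quadForm A (diagMul b u)| ≤
      C * (∑ i, ∑ j, |r i * r j - b i * b j|) * B ^ 2 := by
  have hB0 : 0 ≤ B := (norm_nonneg u).trans hB
  simp only [quadForm, diagMul_apply, ← Finset.sum_sub_distrib, Finset.mul_sum, Finset.sum_mul]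
  refine (Finset.abs_sum_le_sum_abs _ _).trans (Finset.sum_le_sum fun i _ => ?_)
  refine (Finset.abs_sum_le_sum_abs _ _).trans (Finset.sum_le_sum fun j _ => ?_)
  have h1 : A i j * (r i * u i) * (r j * u j) - A i j * (b i * u i) * (b j * u j) =
      A i j * (r i * r j - b i * b j) * (u i * u j) := by ring
  rw [h1, abs_mul, abs_mul, abs_mul, sq]
  exact mul_le_mul (mul_le_mul_of_nonneg_right (hC i j) (abs_nonneg _))
    (mul_le_mul ((abs_coord_le_norm u i).trans hB) ((abs_coord_le_norm u j).trans hB)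
      (abs_nonneg _) hB0) (by positivity) (by positivity)

lemma norm_diagMul_le {n : ℕ} (r : Fin n → ℝ) {u : Vec n} {B : ℝ} (hB : ‖u‖ ≤ B) :
    ‖diagMul r u‖ ≤ (∑ j, |r j|) * B := by
  rw [Finset.sum_mul]
  refine (norm_le_sum_abs _).trans (Finset.sum_le_sum fun j _ => ?_)
  rw [diagMul_apply, abs_mul]
  exact mul_le_mul_of_nonneg_left ((abs_coord_le_norm u j).trans hB) (abs_nonneg _)

lemma norm_diagMul_sub_le {n : ℕ} (r b : Fin n → ℝ) {u : Vec n} {B : ℝ} (hB : ‖u‖ ≤ B) :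
    ‖diagMul r u - diagMul b u‖ ≤ (∑ j, |r j - b j|) * B := by
  have : diagMul r u - diagMul b u = diagMul (fun j => r j - b j) u := by
    ext j; simp [sub_mul]
  rw [this]
  exact norm_diagMul_le _ hB

/-- Approximation of the gain by the limit field with the coefficients of `𝕍_T`, uniformly on
bounded sets. -/
lemma eventually_abs_gain_sub_logZ_le [NeZero p] (hC2 : M.C2)
    (hτ : SupTendstoZero P atTop (fun _ => M.𝒯) fun T ω τ => ‖M.ΔT T ω τ - M.ΔT T ω τ₀‖)
    (hR : 0 < R) {B : ℝ} (hB : 0 < B) {κ : ℝ} (hκ : 0 < κ) :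
    ∀ᶠ x in M.whp ⊓ 𝓟 (M.good τ₀ m R), ∀ u ∈ M.UT x.1, ‖u‖ ≤ B →
      |M.gain x.1 x.2 (M.θs + diagMul (M.a x.1) u) -
        M.logZ (M.coeffT τ₀ x.1 x.2) (M.Γfun x.2) u| ≤ κ := by
  rw [eventually_inf_principal]
  have hfst : Tendsto Prod.fst M.whp atTop := tendsto_fst_probFilter
  let r : M.𝕋 → Fin p → ℝ := fun T j => M.a T j / M.𝔞 j T
  set S : ℝ := ∑ j, |M.b j| + 1 with hS
  have hS0 : 0 < S := by positivity
  have hr : ∀ j, Tendsto (fun T => r T j) atTop (𝓝 (M.b j)) := M.tendsto_ratio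
  have hr0 : Tendsto (fun T => ∑ j, |r T j|) atTop (𝓝 (∑ j, |M.b j|)) :=
    tendsto_finsetSum _ fun j _ => (hr j).abs
  have hr1 : Tendsto (fun T => ∑ j, |r T j - M.b j|) atTop (𝓝 0) := by
    simpa using tendsto_finsetSum Finset.univ fun j _ => ((hr j).sub_const (M.b j)).abs
  have hr2 : Tendsto (fun T => ∑ i, ∑ j, |r T i * r T j - M.b i * M.b j|) atTop (𝓝 0) := by
    simpa using tendsto_finsetSum Finset.univ fun i _ => tendsto_finsetSum Finset.univ fun j _ =>
      (((hr i).mul (hr j)).sub_const (M.b i * M.b j)).abs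
  -- `K` adds up the factors multiplying `κ / K` in the error bounds; the final one makes it
  -- positive.
  set K : ℝ := (S * B) ^ 2 + M.J₁.card * (R * B) + S * B + R * B + R * B ^ 2 + 1 with hK
  have hK0 : 0 < K := by positivity
  have hε : 0 < κ / K := div_pos hκ hK0
  -- This radius covers the image under the scaling of every `u` with `‖u‖ ≤ B`; `B + 1` makes the
  -- inequality strict.
  have hδ : Tendsto (fun T => (B + 1) * ∑ j, M.a T j) atTop (𝓝 0) := by
    simpa using tendsto_sum_a.const_mul (B + 1)
  filter_upwards [hfst.eventually (hr0.eventually (gt_mem_nhds (lt_add_one _))),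
    hfst.eventually (hr1.eventually (ge_mem_nhds hε)),
    hfst.eventually (hr2.eventually (ge_mem_nhds hε)), hτ.eventually hε,
    hC2.eventually_abs_gain_sub_le
      (fun T => mul_pos (by positivity : 0 < B + 1) (sum_a_pos T)) hδ hε]
    with x e0 e1 e2 e3 e4 hx u hu huB
  have hΔ₀ := norm_ΔT_le_of_mem_good hx
  obtain ⟨T, ω⟩ := x
  have hau : ‖diagMul (M.a T) u‖ < (B + 1) * ∑ j, M.a T j := by
    refine (norm_diagMul_le _ huB).trans_lt ?_
    simp only [abs_of_pos (M.a_pos T _)]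
    nlinarith [sum_a_pos T]
  have hgain := e4 u hu hau
  set w := diagMul (r T) u with hw
  have hwB : ‖w‖ ≤ S * B :=
    (norm_diagMul_le _ huB).trans (mul_le_mul_of_nonneg_right e0.le hB.le)
  have hw2 : ‖w‖ ^ 2 ≤ (S * B) ^ 2 := pow_le_pow_left₀ (norm_nonneg _) hwB 2
  have hC := sum_weight_mul_abs_le hx u hR.le fun i _ => (abs_coord_le_norm u i).trans huB
  have f1 : |inner ℝ (M.ΔT T ω (M.τhat T ω) - M.ΔT T ω τ₀) w| ≤ κ / K * (S * B) := by
    have := e3 _ (M.τhat_mem T ω)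
    rw [abs_norm] at this
    exact (abs_real_inner_le_norm _ _).trans (mul_le_mul this hwB (norm_nonneg _) hε.le)
  have f2 : |inner ℝ (M.ΔT T ω τ₀) (w - diagMul M.b u)| ≤ R * (κ / K * B) := by
    refine (abs_real_inner_le_norm _ _).trans (mul_le_mul hΔ₀ ?_
      (norm_nonneg _) hR.le)
    exact (norm_diagMul_sub_le _ _ huB).trans (mul_le_mul_of_nonneg_right e1 hB.le)
  have f3 : |quadForm (M.Γ ω) w - quadForm (M.Γ ω) (diagMul M.b u)| ≤ R * (κ / K) * B ^ 2 := by
    refine (abs_quadForm_diagMul_sub_le _ _ _ u (C := R) (fun i j => ?_) hR.le huB).trans ?_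
    · exact (norm_le_pi_norm (M.Γfun ω i) j).trans ((norm_le_pi_norm (M.Γfun ω) i).trans hx.2.2.2)
    · exact mul_le_mul_of_nonneg_right (mul_le_mul_of_nonneg_left e2 hR.le) (by positivity)
  have hdiff : M.localGain T ω u - M.logZ (M.coeffT τ₀ T ω) (M.Γfun ω) u =
      inner ℝ (M.ΔT T ω (M.τhat T ω) - M.ΔT T ω τ₀) w +
      inner ℝ (M.ΔT T ω τ₀) (w - diagMul M.b u) -
      1 / 2 * (quadForm (M.Γ ω) w - quadForm (M.Γ ω) (diagMul M.b u)) := by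
    rw [localGain, logZ, ← Finset.sum_coe_sort M.J₁, ← Finset.sum_coe_sort M.J₀, inner_sub_left,
      inner_sub_right]
    change inner ℝ (M.ΔT T ω (M.τhat T ω)) w - 1 / 2 * quadForm (M.Γ ω) w - _ - _ -
      (inner ℝ (M.ΔT T ω τ₀) (diagMul M.b u) - 1 / 2 * quadForm (M.Γ ω) (diagMul M.b u) - _ - _) = _
    simp only [coeffT]
    ring
  have hκK : κ / K * K = κ := div_mul_cancel₀ _ hK0.ne'
  have hfin : κ / K * ‖w‖ ^ 2 + κ / K * ∑ i ∈ M.J₁, M.𝔞 i T * M.ξ i T ω * |u i| +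
      κ / K * (S * B) + R * (κ / K * B) + R * (κ / K) * B ^ 2 ≤ κ := by
    have g1 := mul_le_mul_of_nonneg_left hw2 hε.le
    have g2 := mul_le_mul_of_nonneg_left hC hε.le
    have g3 : κ / K * K = κ / K * (S * B) ^ 2 + κ / K * (M.J₁.card * (R * B)) + κ / K * (S * B) +
      R * (κ / K * B) + R * (κ / K) * B ^ 2 + κ / K := by rw [hK]; ring
    simp only at g2
    linarith
  have hgain' := abs_le.1 hgain
  have f1' := abs_le.1 f1
  have f2' := abs_le.1 f2
  have f3' := abs_le.1 f3
  have f3nn : 0 ≤ R * (κ / K) * B ^ 2 := by positivity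
  change -(κ / K * ‖w‖ ^ 2 + _) ≤ _ ∧ _ ≤ κ / K * ‖w‖ ^ 2 + _ at hgain'
  simp only at hgain' hfin
  change |M.gain T ω (M.θs + diagMul (M.a T) u) - M.logZ (M.coeffT τ₀ T ω) (M.Γfun ω) u| ≤ κ
  rw [abs_le]
  constructor <;> linarith [hgain'.1, hgain'.2, f1'.1, f1'.2, f2'.1, f2'.2, f3'.1, f3'.2]

end PenalizedModel

/-! ### Near maximizers of the limit field -/

namespace PenalizedModel

variable {Ω : Type*} {mΩ : MeasurableSpace Ω} {P : Measure Ω} {p q : ℕ} {M : PenalizedModel P p q}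
  {τ₀ : Vec q} {m R : ℝ}

lemma exists_abs_logZ_sub_le (M : PenalizedModel P p q) (R B : ℝ) {κ : ℝ} (hκ : 0 < κ) :
    ∃ r : ℝ, 0 < r ∧ ∀ (x : M.Coeff) (γ : Fin p → Fin p → ℝ) (u v : Vec p), ‖x‖ ≤ R → ‖γ‖ ≤ R →
      ‖u‖ ≤ B → ‖v‖ ≤ B → dist u v < r → |M.logZ x γ u - M.logZ x γ v| ≤ κ := by
  have hK : IsCompact (((Metric.closedBall (0 : M.Coeff) R) ×ˢ
      (Metric.closedBall (0 : Fin p → Fin p → ℝ) R)) ×ˢ (Metric.closedBall (0 : Vec p) B)) :=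
    ((isCompact_closedBall _ _).prod (isCompact_closedBall _ _)).prod (isCompact_closedBall _ _)
  obtain ⟨r, hr, h⟩ := Metric.uniformContinuousOn_iff.1
    (hK.uniformContinuousOn_of_continuous (continuous_logZ continuous_fst.fst continuous_fst.snd
      continuous_snd).continuousOn) κ hκ
  refine ⟨r, hr, fun x γ u v hx hγ hu hv huv => ?_⟩
  have := h ((x, γ), u) ⟨⟨by simpa using hx, by simpa using hγ⟩, by simpa using hu⟩
    ((x, γ), v) ⟨⟨by simpa using hx, by simpa using hγ⟩, by simpa using hv⟩
    (by rw [Prod.dist_eq, dist_self, max_eq_right dist_nonneg]; exact huv)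
  rw [Real.dist_eq] at this
  exact this.le

/-- The compact sets on which the fields are maximized. -/
def ballU (M : PenalizedModel P p q) (B : ℝ) : Set (Vec p) := M.U ∩ Metric.closedBall 0 B

lemma isCompact_ballU (B : ℝ) : IsCompact (M.ballU B) :=
  (isCompact_closedBall _ _).inter_left M.isClosed_U

lemma ballU_nonempty {B : ℝ} (hB : 0 ≤ B) : (M.ballU B).Nonempty :=
  ⟨0, M.zero_mem_U, by simpa using hB⟩

lemma mem_ballU {B : ℝ} {u : Vec p} : u ∈ M.ballU B ↔ u ∈ M.U ∧ ‖u‖ ≤ B := by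
  simp [ballU]

/-- `logZ` is affine in `γ`, with a linear part not involving `x`; hence one constant serves for all
coefficients, bounded or not. -/
lemma exists_abs_logZ_sub_le_dist (M : PenalizedModel P p q) (B : ℝ) :
    ∃ L : ℝ, ∀ (x : M.Coeff) (γ γ' : Fin p → Fin p → ℝ) (u : Vec p), ‖u‖ ≤ B →
      |M.logZ x γ u - M.logZ x γ' u| ≤ L * dist γ γ' := by
  refine ⟨1 / 2 * (∑ _i : Fin p, ∑ _j : Fin p,
    ((∑ j, |M.b j|) * B) * ((∑ j, |M.b j|) * B)), fun x γ γ' u hu => ?_⟩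
  have h1 : M.logZ x γ u - M.logZ x γ' u = -(1 / 2 * (quadForm (Matrix.of γ) (diagMul M.b u) -
      quadForm (Matrix.of γ') (diagMul M.b u))) := by
    rw [logZ, logZ]; ring
  rw [h1, abs_neg, abs_mul, abs_of_pos (by norm_num : (0 : ℝ) < 1 / 2), mul_assoc]
  refine mul_le_mul_of_nonneg_left ?_ (by norm_num)
  have hw : ∀ j, |diagMul M.b u j| ≤ (∑ j, |M.b j|) * B := fun j =>
    (abs_coord_le_norm _ j).trans (norm_diagMul_le _ hu)
  generalize (∑ j, |M.b j|) * B = S at hw ⊢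
  simp only [quadForm, ← Finset.sum_sub_distrib, Finset.sum_mul]
  refine (Finset.abs_sum_le_sum_abs _ _).trans (Finset.sum_le_sum fun i _ => ?_)
  refine (Finset.abs_sum_le_sum_abs _ _).trans (Finset.sum_le_sum fun j _ => ?_)
  have h2 : |γ i j - γ' i j| ≤ dist γ γ' :=
    (dist_le_pi_dist (γ i) (γ' i) j).trans (dist_le_pi_dist γ γ' i)
  have h3 : (Matrix.of γ i j) * diagMul M.b u i * diagMul M.b u j -
      Matrix.of γ' i j * diagMul M.b u i * diagMul M.b u j =
      (diagMul M.b u i * diagMul M.b u j) * (γ i j - γ' i j) := by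
    simp only [Matrix.of_apply]; ring
  rw [h3, abs_mul, abs_mul]
  have h4 := (abs_nonneg _).trans (hw i)
  exact mul_le_mul (mul_le_mul (hw i) (hw j) (abs_nonneg _) h4) h2 (abs_nonneg _)
    (mul_nonneg h4 h4)

/-- The normalized error is a near maximizer of the limit field with the coefficients of `𝕍_T`. -/
lemma eventually_exists_near_max [NeZero p] (hC2 : M.C2) (hA3 : M.A3)
    (hτ : SupTendstoZero P atTop (fun _ => M.𝒯) fun T ω τ => ‖M.ΔT T ω τ - M.ΔT T ω τ₀‖)
    (hR : 0 < R) {B : ℝ} (hB : 0 < B)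
    (hu : ∀ᶠ x in M.whp ⊓ 𝓟 (M.good τ₀ m R), ‖M.uhat x.1 x.2‖ ≤ B) {κ : ℝ} (hκ : 0 < κ) :
    ∀ᶠ x in M.whp ⊓ 𝓟 (M.good τ₀ m R), ∃ w ∈ M.ballU (B + 1), dist (M.uhat x.1 x.2) w ≤ κ ∧
      ∀ v ∈ M.ballU (B + 1), M.logZ (M.coeffT τ₀ x.1 x.2) (M.Γfun x.2) v ≤
        M.logZ (M.coeffT τ₀ x.1 x.2) (M.Γfun x.2) w + κ := by
  -- Five errors occur between `logZ` at `v` and at `w`: moving `v` to a point of `UT`, passing to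
  -- the gain, near maximality of the estimator, passing back, and moving the error into `U`.
  have hκ5 : 0 < κ / 5 := by positivity
  obtain ⟨r, hr, hcont⟩ := M.exists_abs_logZ_sub_le R (B + 2) hκ5
  -- The bound by one explains the radii: the projected error has norm at most `B + 1`, and a
  -- competitor moved back into `UT` at most `B + 2`.
  set ρ := min (min r κ) 1 with hρ
  have hρ0 : 0 < ρ := lt_min (lt_min hr hκ) one_pos
  have hρr : ρ ≤ r := (min_le_left _ _).trans (min_le_left _ _)
  have hρκ : ρ ≤ κ := (min_le_left _ _).trans (min_le_right _ _)
  have hρ1 : ρ ≤ 1 := min_le_right _ _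
  have hfst : Tendsto Prod.fst (M.whp ⊓ 𝓟 (M.good τ₀ m R)) atTop :=
    (tendsto_fst_probFilter (P := P)).mono_left inf_le_left
  filter_upwards [hu, eventually_abs_gain_sub_logZ_le (m := m) hC2 hτ hR
      (by linarith : 0 < B + 2) hκ5,
    (M.eventually_gain_le hκ5).filter_mono inf_le_left,
    hfst.eventually (hA3.eventually_exists_mem_U B hρ0),
    hfst.eventually (M.eventually_exists_mem_UT (B + 1) hρ0),
    mem_inf_of_right (mem_principal_self _)] with x h1 h2 h3 h4 h5 hx
  obtain ⟨w, hwU, hdist⟩ := h4 _ (M.uhat_mem_UT x.1 x.2) h1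
  have hwB : ‖w‖ ≤ B + 1 := by
    have := norm_le_norm_add_norm_sub (M.uhat x.1 x.2) w
    rw [← dist_eq_norm] at this
    linarith
  refine ⟨w, mem_ballU.2 ⟨hwU, hwB⟩, hdist.le.trans hρκ, fun v hv => ?_⟩
  obtain ⟨hvU, hvB⟩ := mem_ballU.1 hv
  obtain ⟨v', hv'U, hdist'⟩ := h5 v hvU hvB
  have hv'B : ‖v'‖ ≤ B + 2 := by
    have := norm_le_norm_add_norm_sub v v'
    rw [← dist_eq_norm] at this
    linarith
  have g1 := abs_le.1 (hcont _ _ _ _ hx.1 hx.2.2.2 (by linarith) (by linarith)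
    (hdist.trans_le hρr))
  have g2 := abs_le.1 (hcont _ _ _ _ hx.1 hx.2.2.2 (by linarith) hv'B (hdist'.trans_le hρr))
  have g3 := abs_le.1 (h2 v' hv'U hv'B)
  have g4 := abs_le.1 (h2 _ (M.uhat_mem_UT x.1 x.2) (by linarith))
  rw [θs_add_uhat] at g4
  have g5 := h3 _ hv'U
  linarith [g1.2, g2.2, g3.1, g4.2]

lemma abs_logZ_coeffT_sub_le {x : M.𝕋 × Ω} {κ : ℝ}
    (h : ‖M.ΔT x.1 x.2 (M.τhat x.1 x.2) - M.ΔT x.1 x.2 τ₀‖ ≤ κ) {u : Vec p} {B : ℝ}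
    (hu : ‖u‖ ≤ B) (γ : Fin p → Fin p → ℝ) :
    |M.logZ (M.coeffT (M.τhat x.1 x.2) x.1 x.2) γ u - M.logZ (M.coeffT τ₀ x.1 x.2) γ u| ≤
      κ * ((∑ j, |M.b j|) * B) := by
  have h1 : M.logZ (M.coeffT (M.τhat x.1 x.2) x.1 x.2) γ u - M.logZ (M.coeffT τ₀ x.1 x.2) γ u =
      inner ℝ (M.ΔT x.1 x.2 (M.τhat x.1 x.2) - M.ΔT x.1 x.2 τ₀) (diagMul M.b u) := by
    rw [inner_sub_left]
    simp only [logZ, coeffT]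
    ring
  rw [h1]
  exact (abs_real_inner_le_norm _ _).trans (mul_le_mul h (norm_diagMul_le _ hu) (norm_nonneg _)
    ((norm_nonneg _).trans h))

/-- Maximizers of `𝕍_T` are near maximizers of the limit field with the score taken at `τ₀`. -/
lemma A5.eventually_near_max {T₀ : M.𝕋} {v : M.𝕋 → Ω → Vec p} (h : M.A5 T₀ v)
    (hτ : SupTendstoZero P atTop (fun _ => M.𝒯) fun T ω τ => ‖M.ΔT T ω τ - M.ΔT T ω τ₀‖)
    {B : ℝ} (hB : 0 < B) {κ : ℝ} (hκ : 0 < κ) :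
    ∀ᶠ x in M.whp, ‖v x.1 x.2‖ ≤ B → v x.1 x.2 ∈ M.ballU B ∧
      ∀ w ∈ M.ballU B, M.logZ (M.coeffT τ₀ x.1 x.2) (M.Γfun x.2) w ≤
        M.logZ (M.coeffT τ₀ x.1 x.2) (M.Γfun x.2) (v x.1 x.2) + κ := by
  set S : ℝ := (∑ j, |M.b j|) * B with hS
  have hS0 : 0 ≤ S := by positivity
  have hε : 0 < κ / (2 * (S + 1)) := by positivity
  have hmax : ∀ᶠ x in M.whp, v x.1 x.2 ∈ M.U ∧
      IsLUB (M.V x.1 x.2 '' M.U) (M.V x.1 x.2 (v x.1 x.2)) := by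
    rw [eventually_probFilter_iff]
    refine tendsto_const_nhds.congr' ?_
    filter_upwards [eventually_ge_atTop T₀] with T hT
    refine Eq.symm ?_
    have : ∀ᵐ ω ∂P, v T ω ∈ M.U ∧ IsLUB (M.V T ω '' M.U) (M.V T ω (v T ω)) :=
      (h.1 T hT).2.2.mono fun ω hω => ⟨(h.1 T hT).2.1 ω, hω⟩
    exact this
  filter_upwards [hmax, hτ.eventually hε] with x h1 h2 hvB
  refine ⟨mem_ballU.2 ⟨h1.1, hvB⟩, fun w hw => ?_⟩
  obtain ⟨hwU, hwB⟩ := mem_ballU.1 hw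
  have h3 := h1.2.1 (mem_image_of_mem _ hwU)
  rw [V_eq, V_eq, Real.exp_le_exp] at h3
  have h4 := h2 _ (M.τhat_mem x.1 x.2)
  rw [abs_norm] at h4
  have h5 := abs_le.1 (abs_logZ_coeffT_sub_le h4 hwB (M.Γfun x.2))
  have h6 := abs_le.1 (abs_logZ_coeffT_sub_le h4 hvB (M.Γfun x.2))
  have h7 : κ / (2 * (S + 1)) * S ≤ κ / 2 := by
    rw [div_mul_eq_mul_div, div_le_div_iff₀ (by positivity) (by positivity)]
    nlinarith
  linarith [h5.1, h6.2]

/-- Events on which the estimator and its limit are bounded. -/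
lemma exists_good_bound [IsProbabilityMeasure P] [NeZero p] (hC1 : M.C1) (hC2 : M.C2) (hC3 : M.C3)
    (hC4 : M.C4) (hC5 : M.C5) (hstab : StablyConverges P M.𝒢 atTop (M.coeffT τ₀) M.coeffLim)
    (hτ : SupTendstoZero P atTop (fun _ => M.𝒯) fun T ω τ => ‖M.ΔT T ω τ - M.ΔT T ω τ₀‖)
    {u : Ω → Vec p} (hu : Measurable u) {η : ℝ} (hη : 0 < η) :
    ∃ m R B : ℝ, 0 < R ∧ 0 < B ∧
      (∀ᶠ T in atTop, P {ω | (T, ω) ∉ M.good τ₀ m R} ≤ ENNReal.ofReal η) ∧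
      P {ω | ¬ ‖u ω‖ ≤ B} ≤ ENNReal.ofReal η ∧
      ∀ᶠ x in M.whp ⊓ 𝓟 (M.good τ₀ m R), ‖M.uhat x.1 x.2‖ ≤ B := by
  obtain ⟨m, R, hm, hR, hgood⟩ := exists_good hC3 hC5 hstab hη
  obtain ⟨B₁, hB₁⟩ := exists_eventually_norm_uhat_le hC1 hC2 hC4 hτ hm hR
  obtain ⟨B₂, hB₂, hPu⟩ := exists_measure_norm_gt_le (P := P) hu hη
  refine ⟨m, R, max B₁ B₂, hR, lt_max_of_lt_right hB₂, hgood, (measure_mono ?_).trans hPu,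
    hB₁.mono fun x hx => hx.trans (le_max_left _ _)⟩
  exact fun ω hω h => hω (h.trans (le_max_right _ _))

/-- Unique maximality on `U` passes to any subset containing `u ω`, so only the norm of `u` matters.
-/
lemma A4.measure_not_unique_max_le {u : Ω → Vec p} (hA4 : M.A4 u) {B : ℝ} {η : ℝ≥0∞}
    (hu : P {ω | ¬ ‖u ω‖ ≤ B} ≤ η) :
    P {ω | ¬ (u ω ∈ M.ballU (B + 1) ∧ ∀ v ∈ M.ballU (B + 1), v ≠ u ω →
      M.logZ (M.coeffLim ω) (M.Γfun ω) v < M.logZ (M.coeffLim ω) (M.Γfun ω) (u ω))} ≤ η := by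
  refine (measure_mono_ae ?_).trans hu
  filter_upwards [hA4.2.2.2] with ω hω hbad hB
  refine hbad ⟨mem_ballU.2 ⟨hA4.2.1 ω, by linarith⟩, fun v hv hne => ?_⟩
  have := hω v (mem_ballU.1 hv).1 hne
  rwa [Z_eq, Z_eq, Real.exp_lt_exp] at this

/-! ### Stable convergence and asymptotic equivalence -/

lemma eventually_integral_uhat_le [IsProbabilityMeasure P] [NeZero p] (hC1 : M.C1) (hC2 : M.C2)
    (hC3 : M.C3) (hC4 : M.C4) (hC5 : M.C5) (hA3 : M.A3) {u : Ω → Vec p} (hA4 : M.A4 u)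
    {Z : Ω → ℝ} (hZ : Measurable[M.𝒢] Z) {C : ℝ} (hC : 0 < C) (hZ0 : ∀ ω, 0 ≤ Z ω)
    (hZC : ∀ ω, Z ω ≤ C) {g : Vec p → ℝ} (hg : Continuous g) {B : ℝ} (hB : ∀ w, |g w| ≤ B)
    {e : ℝ} (he : 0 < e) :
    ∀ᶠ T in atTop, ∫ ω, g (M.uhat T ω) * Z ω ∂P ≤ ∫ ω, g (u ω) * Z ω ∂P + e := by
  obtain ⟨τ₀, -, hτ, hstab⟩ := hC2.1
  have hB0 : 0 ≤ B := (abs_nonneg _).trans (hB 0)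
  -- Chosen so that the term `4 * B * C * η` of the argmax bound is at most `e / 2`.
  set η : ℝ := e / (8 * (B + 1) * C) with hη
  have hη0 : 0 < η := by positivity
  obtain ⟨m, R, A, hR, hA, hgood, hPu, hA'⟩ :=
    exists_good_bound hC1 hC2 hC3 hC4 hC5 hstab hτ hA4.1 (half_pos hη0)
  have hη2 : ENNReal.ofReal (η / 2) + ENNReal.ofReal (η / 2) = ENNReal.ofReal η := by
    rw [← ENNReal.ofReal_add (by positivity) (by positivity), add_halves]
  obtain ⟨L, hL⟩ := M.exists_abs_logZ_sub_le_dist (A + 1)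
  have key := StablyConverges.eventually_integral_argmax_le M.𝒢_le hstab M.measurable_Γfun
    (isCompact_ballU (M := M) (A + 1)) (ballU_nonempty (by positivity)) (Ψ := M.logZ)
    (fun γ => continuous_logZ continuous_fst continuous_const continuous_snd)
    (fun x γ γ' w hw => hL x γ γ' w (mem_ballU.1 hw).2) hZ hC hZ0 hZC hg hB
    (w := M.uhat) (w₀ := u) (Eventually.of_forall M.measurable_uhat) hA4.1 hη0.le
    (fun κ hκ => by
      rw [← hη2]
      exact eventually_measure_le_of_probFilter_inf hgood (ENNReal.ofReal_pos.2 (half_pos hη0))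
        (eventually_exists_near_max hC2 hA3 hτ hR hA hA' hκ))
    ((hA4.measure_not_unique_max_le hPu).trans
      (ENNReal.ofReal_le_ofReal (half_le_self hη0.le))) (half_pos he)
  filter_upwards [key] with T hT
  have : 4 * B * C * η ≤ e / 2 := by
    rw [hη, mul_div_assoc', div_le_div_iff₀ (by positivity) (by positivity)]
    nlinarith [mul_pos hC he]
  linarith

lemma tendsto_integral_uhat [IsProbabilityMeasure P] [NeZero p] (hC1 : M.C1) (hC2 : M.C2)
    (hC3 : M.C3) (hC4 : M.C4) (hC5 : M.C5) (hA3 : M.A3) {u : Ω → Vec p} (hA4 : M.A4 u)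
    {Z : Ω → ℝ} (hZ : Measurable[M.𝒢] Z) {C : ℝ} (hC : 0 < C) (hZ0 : ∀ ω, 0 ≤ Z ω)
    (hZC : ∀ ω, Z ω ≤ C) (f : Vec p →ᵇ ℝ) :
    Tendsto (fun T => ∫ ω, f (M.uhat T ω) * Z ω ∂P) atTop (𝓝 (∫ ω, f (u ω) * Z ω ∂P)) := by
  have hf : ∀ w, |f w| ≤ ‖f‖ := f.norm_coe_le_norm
  rw [Metric.tendsto_nhds]
  intro e he
  filter_upwards [eventually_integral_uhat_le hC1 hC2 hC3 hC4 hC5 hA3 hA4 hZ hC hZ0 hZC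
      f.continuous hf (half_pos he),
    eventually_integral_uhat_le hC1 hC2 hC3 hC4 hC5 hA3 hA4 hZ hC hZ0 hZC
      f.continuous.neg (fun w => by rw [Pi.neg_apply, abs_neg]; exact hf w) (half_pos he)] with T h1 h2
  simp only [Pi.neg_apply, neg_mul, integral_neg] at h2
  rw [Real.dist_eq, abs_lt]
  constructor <;> linarith

/-- The normalized estimation error converges stably. -/
lemma stablyConverges_uhat [IsProbabilityMeasure P] [NeZero p] (hC1 : M.C1) (hC2 : M.C2)
    (hC3 : M.C3) (hC4 : M.C4) (hC5 : M.C5) (hA3 : M.A3) {u : Ω → Vec p} (hA4 : M.A4 u) :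
    StablyConverges P M.𝒢 (atTop : Filter M.𝕋) M.uhat u := by
  refine ⟨M.measurable_uhat, hA4.1, fun f Z hZ ⟨C, hC⟩ => ?_⟩
  have hC0 : 0 < |C| + 1 := by positivity
  have hCZ : ∀ ω, |Z ω| ≤ |C| + 1 := fun ω => (hC ω).trans ((le_abs_self C).trans (by linarith))
  -- The argmax bound needs a nonnegative multiplier; a signed `Z` is the difference of a shifted
  -- one and a constant.
  have h1 := tendsto_integral_uhat hC1 hC2 hC3 hC4 hC5 hA3 hA4
    (Z := fun ω => Z ω + (|C| + 1)) (C := 2 * (|C| + 1))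
    ((measurable_id.add_const _).comp hZ) (by positivity)
    (fun ω => by linarith [(abs_le.1 (hCZ ω)).1]) (fun ω => by linarith [(abs_le.1 (hCZ ω)).2]) f
  have h2 := tendsto_integral_uhat hC1 hC2 hC3 hC4 hC5 hA3 hA4
    (Z := fun _ => |C| + 1) (C := |C| + 1) measurable_const hC0 (fun _ => hC0.le) (fun _ => le_rfl) f
  have hint : ∀ X : Ω → Vec p, Measurable X →
      ∫ ω, f (X ω) * Z ω ∂P = ∫ ω, f (X ω) * (Z ω + (|C| + 1)) ∂P - ∫ ω, f (X ω) * (|C| + 1) ∂P := by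
    intro X hX
    have hfX : Measurable fun ω => f (X ω) := f.continuous.measurable.comp hX
    have i1 : Integrable (fun ω => f (X ω) * Z ω) P := by
      refine Integrable.of_bound (hfX.mul (hZ.mono M.𝒢_le le_rfl)).aestronglyMeasurable
        (‖f‖ * (|C| + 1)) (ae_of_all _ fun ω => ?_)
      rw [norm_mul]
      exact mul_le_mul (f.norm_coe_le_norm _) (hCZ ω) (norm_nonneg _) (norm_nonneg _)
    have i2 : Integrable (fun ω => f (X ω) * (|C| + 1)) P :=
      (Integrable.of_bound hfX.aestronglyMeasurable ‖f‖
        (ae_of_all _ fun ω => f.norm_coe_le_norm _)).mul_const _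
    simp only [mul_add] at i2 ⊢
    rw [integral_add i1 i2]
    ring
  rw [hint u hA4.1]
  exact (h1.sub h2).congr fun T => (hint _ (M.measurable_uhat T)).symm

lemma A5.exists_bound {T₀ : M.𝕋} {v : M.𝕋 → Ω → Vec p} (h : M.A5 T₀ v) {η : ℝ} (hη : 0 < η) :
    ∃ B : ℝ, 0 < B ∧ ∀ᶠ T in atTop, P {ω | ¬ ‖v T ω‖ ≤ B} ≤ ENNReal.ofReal η := by
  have ht := tendsto_measure_norm_gt_of_isTightMeasureSet h.2
  obtain ⟨B, hB, hB0⟩ := ((ht.eventually (ge_mem_nhds (ENNReal.ofReal_pos.2 hη))).and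
    (eventually_gt_atTop 0)).exists
  refine ⟨B, hB0, ?_⟩
  filter_upwards [eventually_ge_atTop T₀] with T hT
  have h1 := (le_iSup₂ (f := fun (μ : Measure (Vec p)) (_ : μ ∈ (fun T => P.map (v T)) '' Ici T₀) =>
    μ {x | B < ‖x‖}) _ (mem_image_of_mem _ hT)).trans hB
  rw [Measure.map_apply (h.1 T hT).1 (measurableSet_lt measurable_const measurable_norm)] at h1
  refine (measure_mono fun ω hω => ?_).trans h1
  exact not_le.1 hω

/-- The normalized estimation error is asymptotically equivalent to the maximizers of `𝕍_T`. -/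
lemma A5.tendstoInMeasure_uhat_sub [IsProbabilityMeasure P] [NeZero p] (hC1 : M.C1) (hC2 : M.C2)
    (hC3 : M.C3) (hC4 : M.C4) (hC5 : M.C5) (hA3 : M.A3) {u : Ω → Vec p} (hA4 : M.A4 u)
    {T₀ : M.𝕋} {v : M.𝕋 → Ω → Vec p} (h : M.A5 T₀ v) :
    TendstoInMeasure P (fun T ω => M.uhat T ω - v T ω) atTop (fun _ => 0) := by
  have hmeas : ∀ᶠ T in atTop, Measurable fun ω => (M.uhat T ω, v T ω) := by
    filter_upwards [eventually_ge_atTop T₀] with T hT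
    exact (M.measurable_uhat T).prodMk (h.1 T hT).1
  -- This test function vanishes on the diagonal, so the limiting integral is zero and a one-sided
  -- bound is enough.
  let g : Vec p × Vec p → ℝ := fun z => min ‖z.1 - z.2‖ 1
  have hg : Continuous g := by fun_prop
  have hg0 : ∀ z, 0 ≤ g z := fun z => le_min (norm_nonneg _) zero_le_one
  have hg1 : ∀ z, |g z| ≤ 1 := fun z => by
    rw [abs_of_nonneg (hg0 z)]; exact min_le_right _ _
  have hint : ∀ e : ℝ, 0 < e → ∀ᶠ T in atTop, ∫ ω, g (M.uhat T ω, v T ω) ∂P ≤ e := by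
    intro e he
    obtain ⟨τ₀, -, hτ, hstab'⟩ := hC2.1
    have hstab : StablyConverges P M.𝒢 atTop (M.coeffT τ₀) M.coeffLim := hstab'
    set η : ℝ := e / 8 with hη
    have hη0 : 0 < η := by positivity
    have hη3 : 0 < η / 3 := by positivity
    obtain ⟨m, R, A₁, hR, hA₁, hgood, hPu, hu⟩ :=
      exists_good_bound hC1 hC2 hC3 hC4 hC5 hstab hτ hA4.1 hη3
    obtain ⟨A₂, hA₂, hv⟩ := h.exists_bound hη3
    set A := max A₁ A₂ with hA
    have hA0 : 0 < A := lt_max_of_lt_left hA₁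
    have hηsum : ENNReal.ofReal (η / 3) + ENNReal.ofReal (η / 3) + ENNReal.ofReal (η / 3) =
        ENNReal.ofReal η := by
      rw [← ENNReal.ofReal_add hη3.le hη3.le, ← ENNReal.ofReal_add (by positivity) hη3.le]
      congr 1; ring
    have hS : ∀ᶠ T in atTop, P {ω | (T, ω) ∉ M.good τ₀ m R ∩ {x | ‖v x.1 x.2‖ ≤ A + 1}} ≤
        ENNReal.ofReal (η / 3) + ENNReal.ofReal (η / 3) := by
      filter_upwards [hgood, hv] with T h1 h2
      refine (measure_mono ?_).trans ((measure_union_le _ _).trans (add_le_add h1 h2))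
      intro ω hω
      by_cases hx : (T, ω) ∈ M.good τ₀ m R
      · refine Or.inr fun hle => hω ⟨hx, ?_⟩
        exact hle.trans ((le_max_right A₁ A₂).trans (by linarith))
      · exact Or.inl hx
    have hPu' : P {ω | ¬ ‖u ω‖ ≤ A} ≤ ENNReal.ofReal η := by
      refine (measure_mono ?_).trans (hPu.trans (ENNReal.ofReal_le_ofReal (by linarith)))
      exact fun ω hω hle => hω (hle.trans (le_max_left _ _))
    have hnear : ∀ {κ : ℝ}, 0 < κ →
        ∀ᶠ x in M.whp ⊓ 𝓟 (M.good τ₀ m R ∩ {x | ‖v x.1 x.2‖ ≤ A + 1}),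
          ∃ w ∈ M.ballU (A + 1) ×ˢ M.ballU (A + 1), dist (M.uhat x.1 x.2, v x.1 x.2) w ≤ κ ∧
            ∀ z ∈ M.ballU (A + 1) ×ˢ M.ballU (A + 1),
              M.logZ (M.coeffT τ₀ x.1 x.2) (M.Γfun x.2) z.1 +
                M.logZ (M.coeffT τ₀ x.1 x.2) (M.Γfun x.2) z.2 ≤
              M.logZ (M.coeffT τ₀ x.1 x.2) (M.Γfun x.2) w.1 +
                M.logZ (M.coeffT τ₀ x.1 x.2) (M.Γfun x.2) w.2 + κ := by
      intro κ hκ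
      have hF : M.whp ⊓ 𝓟 (M.good τ₀ m R ∩ {x | ‖v x.1 x.2‖ ≤ A + 1}) ≤
          M.whp ⊓ 𝓟 (M.good τ₀ m R) :=
        inf_le_inf_left _ (principal_mono.2 inter_subset_left)
      have hu' : ∀ᶠ x in M.whp ⊓ 𝓟 (M.good τ₀ m R), ‖M.uhat x.1 x.2‖ ≤ A :=
        hu.mono fun x hx => hx.trans (le_max_left _ _)
      filter_upwards [(eventually_exists_near_max hC2 hA3 hτ hR hA0 hu'
          (half_pos hκ)).filter_mono hF,
        (h.eventually_near_max hτ (by linarith : 0 < A + 1) (half_pos hκ)).filter_mono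
          inf_le_left,
        mem_inf_of_right (mem_principal_self _)] with x h1 h2 h3
      obtain ⟨w, hw, hdist, hwmax⟩ := h1
      obtain ⟨hvK, hvmax⟩ := h2 h3.2
      refine ⟨(w, v x.1 x.2), ⟨hw, hvK⟩, ?_, fun z hz => ?_⟩
      · rw [Prod.dist_eq, dist_self, max_eq_left dist_nonneg]
        linarith
      · have := hwmax z.1 hz.1
        have := hvmax z.2 hz.2
        simp only
        linarith
    obtain ⟨L, hL⟩ := M.exists_abs_logZ_sub_le_dist (A + 1)
    have hcpt := isCompact_ballU (M := M) (A + 1)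
    have key := StablyConverges.eventually_integral_argmax_le (Z := fun _ => 1) (C := 1)
      M.𝒢_le hstab M.measurable_Γfun
      (hcpt.prod hcpt)
      ((ballU_nonempty (by positivity)).prod (ballU_nonempty (by positivity)))
      (Ψ := fun x γ z => M.logZ x γ z.1 + M.logZ x γ z.2)
      (fun γ => (continuous_logZ continuous_fst continuous_const continuous_snd.fst).add
        (continuous_logZ continuous_fst continuous_const continuous_snd.snd))
      (L := L + L)
      (fun x γ γ' w hw => by
        have h3 := (abs_add_le _ _).trans (add_le_add (hL x γ γ' w.1 (mem_ballU.1 hw.1).2)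
          (hL x γ γ' w.2 (mem_ballU.1 hw.2).2))
        rw [add_sub_add_comm, add_mul]
        exact h3) measurable_const one_pos
      (fun _ => zero_le_one) (fun _ => le_rfl) hg hg1
      (w := fun T ω => (M.uhat T ω, v T ω)) (w₀ := fun ω => (u ω, u ω)) hmeas
      (hA4.1.prodMk hA4.1) hη0.le
      (fun κ hκ => by
        rw [← hηsum]
        exact eventually_measure_le_of_probFilter_inf hS (ENNReal.ofReal_pos.2 hη3) (hnear hκ))
      (by
        refine (measure_mono ?_).trans (hA4.measure_not_unique_max_le hPu')
        intro ω hω hgd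
        -- A pair other than `(u ω, u ω)` differs from it in at least one coordinate, where the loss
        -- is strict.
        refine hω ⟨⟨hgd.1, hgd.1⟩, fun z hz hne => ?_⟩
        have hle : ∀ y ∈ M.ballU (A + 1), M.logZ (M.coeffLim ω) (M.Γfun ω) y ≤
            M.logZ (M.coeffLim ω) (M.Γfun ω) (u ω) := fun y hy => by
          rcases eq_or_ne y (u ω) with rfl | hy'
          · exact le_rfl
          · exact (hgd.2 y hy hy').le
        simp only
        by_cases hz1 : z.1 = u ω
        · have hz2 : z.2 ≠ u ω := fun hz2 => hne (Prod.ext hz1 hz2)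
          exact add_lt_add_of_le_of_lt (hle _ hz.1) (hgd.2 _ hz.2 hz2)
        · exact add_lt_add_of_lt_of_le (hgd.2 _ hz.1 hz1) (hle _ hz.2))
      (half_pos he)
    filter_upwards [key] with T hT
    have h0 : ∀ ω, g (u ω, u ω) = 0 := fun ω => by simp [g]
    simp only [h0, mul_one, integral_zero] at hT
    linarith
  refine tendstoInMeasure_of_ne_top fun ε hε hεtop => ?_
  have hε' : 0 < ε.toReal := ENNReal.toReal_pos hε.ne' hεtop
  -- The level is truncated as `g` is, so that a deviation of size `ε` forces `g ≥ r` and Markov's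
  -- inequality applies.
  set r : ℝ := min ε.toReal 1 with hr
  have hr0 : 0 < r := lt_min hε' one_pos
  have hlim : Tendsto (fun T => ENNReal.ofReal ((∫ ω, g (M.uhat T ω, v T ω) ∂P) / r)) atTop (𝓝 0) := by
    have h1 : Tendsto (fun T => ∫ ω, g (M.uhat T ω, v T ω) ∂P) atTop (𝓝 0) := by
      rw [Metric.tendsto_nhds]
      intro e he
      filter_upwards [hint (e / 2) (half_pos he)] with T hT
      rw [Real.dist_eq, sub_zero, abs_of_nonneg (integral_nonneg fun ω => hg0 _)]
      linarith
    simpa using ENNReal.tendsto_ofReal (h1.div_const r)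
  refine tendsto_of_tendsto_of_tendsto_of_le_of_le' tendsto_const_nhds hlim
    (Eventually.of_forall fun _ => zero_le) ?_
  filter_upwards [hmeas] with T hT
  have hmk := mul_meas_ge_le_integral_of_nonneg (μ := P) (f := fun ω => g (M.uhat T ω, v T ω))
    (ae_of_all _ fun ω => hg0 _) (Integrable.of_bound (hg.measurable.comp hT).aestronglyMeasurable 1
      (ae_of_all _ fun ω => hg1 _)) r
  refine (measure_mono (t := {ω | r ≤ g (M.uhat T ω, v T ω)}) fun ω hω => ?_).trans ?_
  · change min ε.toReal 1 ≤ min ‖M.uhat T ω - v T ω‖ 1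
    refine min_le_min_right 1 ?_
    have h1 : ε ≤ edist (M.uhat T ω - v T ω) 0 := hω
    rw [edist_zero_right] at h1
    have h2 := ENNReal.toReal_mono (by simp) h1
    simpa using h2
  · rw [ENNReal.le_ofReal_iff_toReal_le (measure_ne_top _ _)
      (div_nonneg (integral_nonneg fun ω => hg0 _) hr0.le), le_div_iff₀ hr0, mul_comm]
    exact hmk

end PenalizedModel

/-- Stable limit of the penalized quasi-maximum likelihood estimator when the true value may lie on
the boundary of the parameter space. -/
theorem theorem5 {Ω : Type*} {mΩ : MeasurableSpace Ω} (P : Measure Ω) [IsProbabilityMeasure P]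
    (p q : ℕ) (hp : 1 ≤ p) (M : PenalizedModel P p q)
    (hC1 : M.C1) (hC2 : M.C2) (hC3 : M.C3) (hC4 : M.C4) (hC5 : M.C5) (hA3 : M.A3)
    (u : Ω → Vec p) (hA4 : M.A4 u) :
    StablyConverges P M.𝒢 (atTop : Filter M.𝕋) M.uhat u ∧
    ∀ (T₀ : M.𝕋) (v : M.𝕋 → Ω → Vec p), M.A5 T₀ v →
      TendstoInMeasure P (fun T ω => M.uhat T ω - v T ω) atTop (fun _ => 0) := by
  have : NeZero p := ⟨by omega⟩
  exact ⟨PenalizedModel.stablyConverges_uhat hC1 hC2 hC3 hC4 hC5 hA3 hA4,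
    fun T₀ v h => h.tendstoInMeasure_uhat_sub hC1 hC2 hC3 hC4 hC5 hA3 hA4⟩
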